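/- **Setting.** Let $G=(V,E)$ be a finite $d$-regular simple graph, $T>0$, $\alpha>0$ ($\hbar=1$). On the qubits $(\mathbb C^2)^{\otimes V}$ put $\gamma_v=\sigma_x^{(v)}/\alpha$ for $v\in V$ and $\gamma_e=O_e=\tfrac12\bigl(1-\sigma_z^{(a)}\sigma_z^{(b)}\bigr)$ for $e=\{a,b\}\in E$. Let $U_t=U_t^G$ solve $i\,\dot U_t=H(t)U_t$, $U_0=1$, where $H(t)=-(1-\tfrac tT)\sum_{v\in V}\gamma_v-\tfrac tT\sum_{e\in E}\gamma_e$. For an operator $M$ write $M(t)=U_t^\dagger M U_t$, and let $\langle O_X\rangle_G=\langle\psi_0|O_X(T)|\psi_0\rangle$ with $\psi_0$ the uniform superposition. Norms are operator norms. For an edge $X=\{a,b\}$ and $p\ge1$, the ball $B_p(X)$ is the subgraph of all vertices and edges lying on paths of length at most $p$ starting at an endpoint of $X$; $\langle O_X\rangle_{B_p(X)}$ is the same expectation for the annealing run on the graph $B_p(X)$ alone (with the same $T,\alpha$). The commutativity graph $\mathbf G$ has node set $V\sqcup E$, and $i,j$ are adjacent iff $[\gamma_i,\gamma_j]\ne0$.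 A path in $\mathbf G$ may repeat nodes and edges. Let $$I_n=\int_0^1(1-u_1)\int_0^{u_1}u_2\int_0^{u_2}(1-u_3)\cdots\,du_n\cdots du_1$$ ($n$ nested integrals with alternating weights $1-u$ and $u$). Fix an edge $X$, $q\ge1$, $k=q+1$. Let $N_n$ be the number of paths of length $n$ in $\mathbf G$ from $X$ to a node (vertex or edge of $G$) not belonging to $B_q(X)$, let $N_n(j)$ be the number of paths of length $n$ from $X$ to the node $j$, and for an operator $A$ let $\gamma_j^A(t)=[\gamma_j(t),A]$. Put $$\varepsilon_{loc}^G=\sum_{r=0}^{5}T^{2k+r}\Bigl(\tfrac2\alpha\Bigr)^{k+\lceil r/2\rceil}I_{2k+r}\,N_{2k+r}+T^{2k+6}\Bigl(\tfrac2\alpha\Bigr)^{k+3}I_{2k+6}\,(2d)^{k+3},$$ let $\varepsilon_{loc}(B_q(X),T,\alpha)$ be the supremum of $\varepsilon_{loc}^{G'}$ over all finite $d$-regular graphs $G'$ with an edge $X'$ whose ball $B_q(X')$ is isomorphic to $B_q(X)$ by an isomorphism taking $X'$ to $X$, and let $$\begin{aligned}\varepsilon(q,T,\alpha)={}&T^{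2k}(\tfrac2\alpha)^kI_{2k}\,2(d-1)^k+T^{2k+1}(\tfrac2\alpha)^{k+1}I_{2k+1}\,2(d-1)^k\\&+T^{2k+2}(\tfrac2\alpha)^{k+1}I_{2k+2}\,2(d-1)^k[d(k+1)+1]+T^{2k+3}(\tfrac2\alpha)^{k+2}I_{2k+3}\,2(d-1)^k[d(k+2)]\\&+T^{2k+4}(\tfrac2\alpha)^{k+2}I_{2k+4}\,2(d-1)^k\Bigl[d^2\tfrac{(k+1)^2+3}2+d\tfrac{3k+2}2+k\Bigr]\\&+T^{2k+5}(\tfrac2\alpha)^{k+3}I_{2k+5}\,2(d-1)^k\Bigl[d^2\tfrac{(k+2)^2+3}2+d\tfrac{k+1}2+k-1\Bigr]\\&+T^{2k+6}(\tfrac2\alpha)^{k+3}I_{2k+6}\,(2d)^{k+3}.\end{aligned}$$ **Claim.** 1. (Commutator.) For every unitary $A$ supported on $V\setminus V(B_q(X))$ and every $t\in[0,T]$ (in particular $t=T$), $$\|[O_X(t),A]\|\le\sum_{r=0}^{5}T^{2k+r}(\tfrac2\alpha)^{k+\lfloor r/2\rfloor}I_{2k+r}\sum_jN_{2k+r}(j)\|\gamma_j^A(0)\|+T^{2k+6}(\tfrac2\alpha)^{k+3}I_{2k+6}\sum_jN_{2k+6}(j)\max_{s\in[0,T]}\|\gamma_j^A(s)\|\le\varepsilon_{loc}^G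 ,$$ and also $\|[O_X(t),A]\|\le\varepsilon(q,T,\alpha)$. 2. (Edge energy.) $|\langle O_X\rangle_G-\langle O_X\rangle_{B_q(X)}|\le\varepsilon_{loc}^G$ and $|\langle O_X\rangle_G-\langle O_X\rangle_{B_q(X)}|\le\varepsilon(q,T,\alpha)$. 3. $\varepsilon_{loc}^G\le\varepsilon_{loc}(B_q(X),T,\alpha)$, so the local bounds hold with the latter, which depends only on the ball. 4. (Path counts.) There are exactly $(2d)^{k+3}$ paths of length $2k+6$ in $\mathbf G$ starting at $X$, and $N_{2k}\le2(d-1)^k$, $N_{2k+1}\le2(d-1)^k$, $N_{2k+2}\le2(d-1)^k[d(k+1)+1]$, $N_{2k+3}\le2(d-1)^k[d(k+2)]$. If $B_{q+3}(X)$ has no cycle, these four are equalities, and each $N_{2k+r}$, $0\le r\le5$, is the largest one among all edges of all finite $d$-regular graphs. -/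

import Mathlib

open scoped Matrix.Norms.L2Operator

universe u

namespace QAnneal

noncomputable section

/-! ### Linear time-dependent differential equations -/

/-- Terms of the Dyson series of `U' = K U`, `U 0 = 1`. -/
def dysonTerm {R : Type*} [NormedRing R] [NormedAlgebra ℝ R] (K : ℝ → R) : ℕ → ℝ → R
  | 0 => fun _ => 1
  | n + 1 => fun t => ∫ s in (0 : ℝ)..t, K s * dysonTerm K n s

theorem dysonTerm_continuous {R : Type*} [NormedRing R] [NormedAlgebra ℝ R] [CompleteSpace R]
    {K : ℝ → R} (hK : Continuous K) (n : ℕ) : Continuous (dysonTerm K n) := by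
  induction n with
  | zero => exact continuous_const
  | succ n ih =>
    exact intervalIntegral.continuous_primitive
      (fun a b => (hK.mul ih).intervalIntegrable a b) 0

theorem dysonTerm_hasDerivAt {R : Type*} [NormedRing R] [NormedAlgebra ℝ R] [CompleteSpace R]
    {K : ℝ → R} (hK : Continuous K) (n : ℕ) (t : ℝ) :
    HasDerivAt (dysonTerm K (n + 1)) (K t * dysonTerm K n t) t := by
  have hc : Continuous fun s => K s * dysonTerm K n s := hK.mul (dysonTerm_continuous hK n)
  exact intervalIntegral.integral_hasDerivAt_right (hc.intervalIntegrable 0 t)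
    (hc.stronglyMeasurableAtFilter _ _) hc.continuousAt

theorem dysonTerm_norm_le {R : Type*} [NormedRing R] [NormedAlgebra ℝ R]
    {K : ℝ → R} {r C : ℝ} (hC : 0 ≤ C) (hKC : ∀ s, |s| ≤ r → ‖K s‖ ≤ C)
    (n : ℕ) : ∀ t, |t| ≤ r → ‖dysonTerm K n t‖ ≤ ‖(1 : R)‖ * (C ^ n * |t| ^ n / n.factorial) := by
  induction n with
  | zero => intro t _; simp [dysonTerm]
  | succ n ih =>
    intro t ht
    have h1 : ∀ s ∈ Set.uIoc (0 : ℝ) t, |s| ≤ |t| := by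
      intro s hs
      have := Set.abs_sub_left_of_mem_uIcc (Set.uIoc_subset_uIcc hs)
      simpa using this
    have h2 : ‖∫ s in (0 : ℝ)..t, K s * dysonTerm K n s‖ ≤
        |∫ s in (0 : ℝ)..t, ‖(1 : R)‖ * (C ^ (n + 1) / n.factorial) * |s - 0| ^ n| := by
      apply intervalIntegral.norm_integral_le_abs_of_norm_le
      · refine (MeasureTheory.ae_restrict_iff' measurableSet_uIoc).2 (Filter.Eventually.of_forall ?_)
        intro s hs
        have hs' := (h1 s hs).trans ht
        calc ‖K s * dysonTerm K n s‖ ≤ ‖K s‖ * ‖dysonTerm K n s‖ := norm_mul_le _ _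
          _ ≤ C * (‖(1 : R)‖ * (C ^ n * |s| ^ n / n.factorial)) :=
            mul_le_mul (hKC s hs') (ih s hs') (norm_nonneg _) hC
          _ = _ := by rw [sub_zero]; ring
      · exact Continuous.intervalIntegrable (by fun_prop) _ _
    refine h2.trans (le_of_eq ?_)
    rw [intervalIntegral.integral_const_mul, abs_mul,
      intervalIntegral.abs_intervalIntegral_eq, integral_pow_abs_sub_uIoc, sub_zero,
      abs_of_nonneg (by positivity), abs_of_nonneg (by positivity), Nat.factorial_succ]
    push_cast
    field_simp

/-- A linear equation `U' = K U` with continuous coefficients has a solution on all of `ℝ`. -/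
theorem exists_linear_solution {R : Type*} [NormedRing R] [NormedAlgebra ℝ R] [CompleteSpace R]
    {K : ℝ → R} (hK : Continuous K) :
    ∃ U : ℝ → R, U 0 = 1 ∧ ∀ t, HasDerivAt U (K t * U t) t := by
  have hbd : ∀ r : ℝ, ∃ C, 0 ≤ C ∧ ∀ s, |s| ≤ r → ‖K s‖ ≤ C := by
    intro r
    obtain ⟨C, hC⟩ := (isCompact_Icc (a := -r) (b := r)).exists_bound_of_continuousOn
      hK.continuousOn
    exact ⟨max C 0, le_max_right _ _, fun s hs => (hC s (abs_le.1 hs)).trans (le_max_left _ _)⟩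
  have hz : ∀ n, dysonTerm K (n + 1) 0 = 0 := fun n => by simp [dysonTerm]
  refine ⟨fun t => 1 + ∑' n, dysonTerm K (n + 1) t, by simp [hz], ?_⟩
  intro t
  obtain ⟨C, hC, hKC⟩ := hbd (|t| + 1)
  set r : ℝ := |t| + 1 with hr
  have hr0 : 0 < r := by positivity
  have hle : ∀ n s, |s| ≤ r →
      ‖dysonTerm K n s‖ ≤ ‖(1 : R)‖ * ((C * r) ^ n / n.factorial) := by
    intro n s hs
    refine (dysonTerm_norm_le hC hKC n s hs).trans ?_
    rw [mul_pow]
    gcongr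
  have hsum : Summable fun n : ℕ => ‖(1 : R)‖ * ((C * r) ^ n / n.factorial) :=
    (Real.summable_pow_div_factorial (C * r)).mul_left _
  have hs0 : Summable fun n => dysonTerm K n t :=
    Summable.of_norm_bounded hsum fun n => hle n t (by rw [hr]; linarith)
  have key := hasDerivAt_tsum_of_isPreconnected (𝕜 := ℝ) (g := fun n => dysonTerm K (n + 1))
    (g' := fun n s => K s * dysonTerm K n s) (hsum.mul_left C) Metric.isOpen_ball
    (convex_ball (0 : ℝ) r).isPreconnected
    (fun n y _ => dysonTerm_hasDerivAt hK n y)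
    (fun n y hy => by
      have hy' : |y| ≤ r := by
        have := Metric.mem_ball.1 hy
        rw [Real.dist_eq, sub_zero] at this
        exact this.le
      exact (norm_mul_le _ _).trans
        (mul_le_mul (hKC y hy') (hle n y hy') (norm_nonneg _) hC))
    (y₀ := 0) (Metric.mem_ball_self hr0) (by simp [hz])
    (y := t) (by rw [Metric.mem_ball, Real.dist_eq, sub_zero, hr]; linarith)
  have h2 : (∑' n, K t * dysonTerm K n t) = K t * (1 + ∑' n, dysonTerm K (n + 1) t) := by
    rw [hs0.tsum_mul_left, hs0.tsum_eq_zero_add]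
    rfl
  rw [h2] at key
  exact key.const_add 1

/-! ### Qubits on a finite vertex set -/

/-- Operators on the space of qubits sitting at the points of `V`, as matrices in the
computational basis `V → Fin 2`, with the operator norm of the Euclidean norm. -/
abbrev Op (V : Type u) : Type u := Matrix (V → Fin 2) (V → Fin 2) ℂ

def pauliX : Matrix (Fin 2) (Fin 2) ℂ := !![0, 1; 1, 0]

def pauliZ : Matrix (Fin 2) (Fin 2) ℂ := !![1, 0; 0, -1]

open Classical in
/-- The one-qubit operator `M` acting at the site `v` (and as the identity elsewhere). -/
def onSite {V : Type u} (v : V) (M : Matrix (Fin 2) (Fin 2) ℂ) : Op V :=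
  Matrix.of fun x y => if ∀ w, w ≠ v → x w = y w then M (x v) (y v) else 0

open Classical in
/-- `A` is supported on `S`: it has the form `B ⊗ 1` with `B` acting on the qubits of `S`. -/
def SupportedOn {V : Type u} (S : Set V) (A : Op V) : Prop :=
  ∃ B : Op S, ∀ x y : V → Fin 2,
    A x y = if ∀ w, w ∉ S → x w = y w then B (fun s => x s) (fun s => y s) else 0

section Operators

variable {V : Type u} [Fintype V] [DecidableEq V]

theorem onSite_pauliZ (v : V) :
    onSite v pauliZ = Matrix.diagonal fun x : V → Fin 2 => pauliZ (x v) (x v) := by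
  ext x y
  by_cases hxy : x = y
  · subst hxy; simp [onSite]
  · rw [Matrix.diagonal_apply_ne _ hxy]
    simp only [onSite, Matrix.of_apply]
    split_ifs with h
    · have hv : x v ≠ y v := fun hv => hxy (funext fun w => by
        by_cases hw : w = v
        · rw [hw, hv]
        · exact h w hw)
      generalize x v = p at hv
      generalize y v = q at hv
      fin_cases p <;> fin_cases q <;> simp_all [pauliZ]
    · rfl

/-- The edge observable `(1 - σ_z σ_z) / 2`. -/
def cutOp : Sym2 V → Op V :=
  Sym2.lift ⟨fun a b => (2⁻¹ : ℂ) • (1 - onSite a pauliZ * onSite b pauliZ), fun a b => by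
    simp only [onSite_pauliZ, Matrix.diagonal_mul_diagonal, mul_comm]⟩

/-- The mixing term `σ_x / α` at a vertex. -/
def mixOp (α : ℝ) (v : V) : Op V := ((α : ℂ)⁻¹) • onSite v pauliX

/-! ### Annealing for MaxCut -/

/-- `H₀(α) = - ∑ᵥ σ_x⁽ᵛ⁾ / α`. -/
def hamInit (V : Type u) [Fintype V] [DecidableEq V] (α : ℝ) : Op V := -∑ v : V, mixOp α v

open Classical in
/-- `H₁ = - ∑ₑ Oₑ`, the sum over the edges of `G`. -/
def hamTarget (G : SimpleGraph V) : Op V := -∑ e : G.edgeSet, cutOp (e : Sym2 V)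

/-- The linear schedule `H(t) = (1 - t/T) H₀(α) + (t/T) H₁`. -/
def ham (G : SimpleGraph V) (T α t : ℝ) : Op V :=
  ((1 - t / T : ℝ) : ℂ) • hamInit V α + ((t / T : ℝ) : ℂ) • hamTarget G

theorem exists_propagator (G : SimpleGraph V) (T α : ℝ) :
    ∃ U : ℝ → Op V, U 0 = 1 ∧ ∀ t, HasDerivAt U ((-Complex.I) • (ham G T α t * U t)) t := by
  have hK : Continuous fun t => (-Complex.I) • ham G T α t := by
    unfold ham
    fun_prop
  obtain ⟨U, h0, hU⟩ := exists_linear_solution hK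
  exact ⟨U, h0, fun t => by simpa only [Matrix.smul_mul] using hU t⟩

/-- The evolution operator `U_t`: the solution of `i U' = H(t) U`, `U_0 = 1` (`ħ = 1`). -/
def propagator (G : SimpleGraph V) (T α : ℝ) : ℝ → Op V := (exists_propagator G T α).choose

/-- Heisenberg evolution `U_t† M U_t`. -/
def evolve (G : SimpleGraph V) (T α t : ℝ) (M : Op V) : Op V :=
  (propagator G T α t).conjTranspose * M * propagator G T α t

/-- The uniform superposition. -/
def psi0 (V : Type u) [Fintype V] : (V → Fin 2) → ℂ :=
  fun _ => ((Real.sqrt (2 ^ Fintype.card V))⁻¹ : ℝ)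

/-- The state at the end of the annealing. -/
def finalState (G : SimpleGraph V) (T α : ℝ) : (V → Fin 2) → ℂ :=
  (propagator G T α T).mulVec (psi0 V)

/-- `⟨O_e⟩_G`, the expectation of the edge observable in the final state. -/
def edgeEnergy (G : SimpleGraph V) (T α : ℝ) (e : Sym2 V) : ℝ :=
  (star (finalState G T α) ⬝ᵥ (cutOp e).mulVec (finalState G T α)).re

/-! ### The commutativity graph -/

/-- The Hamiltonian terms `γ_v = σ_x⁽ᵛ⁾ / α` and `γ_e = O_e`. -/
def gam (G : SimpleGraph V) (α : ℝ) : V ⊕ G.edgeSet → Op V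
  | Sum.inl v => mixOp α v
  | Sum.inr e => cutOp (e : Sym2 V)

/-- Two terms are adjacent iff they do not commute. -/
def commGraph (G : SimpleGraph V) (α : ℝ) : SimpleGraph (V ⊕ G.edgeSet) where
  Adj i j := gam G α i * gam G α j ≠ gam G α j * gam G α i
  symm := ⟨fun _ _ h => Ne.symm h⟩
  loopless := ⟨fun _ h => h rfl⟩

/-- Number of paths (repetitions allowed) of length `n` from `X` to `j` in the commutativity
graph. -/
def numPaths (G : SimpleGraph V) (α : ℝ) (X : G.edgeSet) (n : ℕ) (j : V ⊕ G.edgeSet) : ℕ :=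
  {p : (commGraph G α).Walk (Sum.inr X) j | p.length = n}.ncard

/-- `γ_j^A(t) = [γ_j(t), A]`. -/
def gamComm (G : SimpleGraph V) (T α : ℝ) (A : Op V) (j : V ⊕ G.edgeSet) (t : ℝ) : Op V :=
  ⁅evolve G T α t (gam G α j), A⁆

end Operators

/-! ### Balls around an edge -/

/-- `B_p(X)`: the subgraph of the vertices and edges lying on paths of length at most `p` that
start at an endpoint of `X = {a, b}`. -/
def ball {V : Type u} (G : SimpleGraph V) (a b : V) (p : ℕ) : G.Subgraph where
  verts := {v | ∃ x y : V, ∃ w : G.Walk x y,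
    (x = a ∨ x = b) ∧ w.IsPath ∧ w.length ≤ p ∧ v ∈ w.support}
  Adj u v := ∃ x y : V, ∃ w : G.Walk x y,
    (x = a ∨ x = b) ∧ w.IsPath ∧ w.length ≤ p ∧ s(u, v) ∈ w.edges
  adj_sub := by
    rintro u v ⟨x, y, w, -, -, -, h⟩
    exact w.adj_of_mem_edges h
  edge_vert := by
    rintro u v ⟨x, y, w, hx, hp, hl, h⟩
    exact ⟨x, y, w, hx, hp, hl, w.fst_mem_support_of_mem_edges h⟩
  symm := ⟨by
    rintro u v ⟨x, y, w, hx, hp, hl, h⟩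
    exact ⟨x, y, w, hx, hp, hl, Sym2.eq_swap ▸ h⟩⟩

theorem left_mem_ball {V : Type u} (G : SimpleGraph V) (a b : V) (p : ℕ) :
    a ∈ (ball G a b p).verts :=
  ⟨a, a, SimpleGraph.Walk.nil, Or.inl rfl, by simp, by simp, by simp⟩

theorem right_mem_ball {V : Type u} (G : SimpleGraph V) (a b : V) (p : ℕ) :
    b ∈ (ball G a b p).verts :=
  ⟨b, b, SimpleGraph.Walk.nil, Or.inr rfl, by simp, by simp, by simp⟩

/-- The endpoints of `X` as vertices of the ball. -/
def ballLeft {V : Type u} (G : SimpleGraph V) (a b : V) (p : ℕ) : (ball G a b p).verts :=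
  ⟨a, left_mem_ball G a b p⟩

def ballRight {V : Type u} (G : SimpleGraph V) (a b : V) (p : ℕ) : (ball G a b p).verts :=
  ⟨b, right_mem_ball G a b p⟩

open Classical in
/-- `⟨O_X⟩_{B_p(X)}`: the annealing is run on the graph `B_p(X)` alone. -/
def ballEnergy {V : Type u} [Fintype V] (G : SimpleGraph V) (a b : V) (p : ℕ) (T α : ℝ) : ℝ :=
  edgeEnergy (ball G a b p).coe T α s(ballLeft G a b p, ballRight G a b p)

/-- A node of the commutativity graph lies outside the ball. -/
def IsOutside {V : Type u} (G : SimpleGraph V) (a b : V) (p : ℕ) : V ⊕ G.edgeSet → Prop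
  | Sum.inl v => v ∉ (ball G a b p).verts
  | Sum.inr e => (e : Sym2 V) ∉ (ball G a b p).edgeSet

open Classical in
/-- Number of paths of length `n` in the commutativity graph from `X = {a, b}` to a node outside
`B_p(X)`. -/
def numExit {V : Type u} [Fintype V] [DecidableEq V] (G : SimpleGraph V) (α : ℝ) {a b : V}
    (hab : G.Adj a b) (p n : ℕ) : ℕ :=
  ∑ j ∈ Finset.univ.filter (IsOutside G a b p), numPaths G α ⟨s(a, b), hab⟩ n j

/-! ### The bounds -/

/-- Nested integrals with alternating weights; the outermost weight is `1 - u` if the flag is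
`false` and `u` if it is `true`. -/
def nested : Bool → ℕ → ℝ → ℝ
  | _, 0, _ => 1
  | s, n + 1, x => ∫ y in (0 : ℝ)..x, (if s then y else 1 - y) * nested (!s) n y

/-- `I_n = ∫₀¹ (1 - u₁) ∫₀^{u₁} u₂ ∫₀^{u₂} (1 - u₃) ⋯ duₙ ⋯ du₁`. -/
def schedInt (n : ℕ) : ℝ := nested false n 1

open Classical in
/-- The seven-term bound in which every path is weighted with the commutator at its endpoint. -/
def localSum {V : Type u} [Fintype V] [DecidableEq V] (G : SimpleGraph V) (T α : ℝ) (A : Op V)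
    (X : G.edgeSet) (k : ℕ) : ℝ :=
  (∑ r ∈ Finset.range 6, T ^ (2 * k + r) * (2 / α) ^ (k + r / 2) * schedInt (2 * k + r) *
      ∑ j, (numPaths G α X (2 * k + r) j : ℝ) * ‖gamComm G T α A j 0‖) +
    T ^ (2 * k + 6) * (2 / α) ^ (k + 3) * schedInt (2 * k + 6) *
      ∑ j, (numPaths G α X (2 * k + 6) j : ℝ) * ⨆ t : Set.Icc 0 T, ‖gamComm G T α A j t‖

/-- The local bound with the path counts of the graph `G` (`k = q + 1`). The commutators at the
endpoints are replaced by their maxima `1` (edges) and `2/α` (vertices). -/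
def epsLocIn {V : Type u} [Fintype V] [DecidableEq V] (d : ℕ) (G : SimpleGraph V) {a b : V}
    (hab : G.Adj a b) (q : ℕ) (T α : ℝ) : ℝ :=
  let k := q + 1
  (∑ r ∈ Finset.range 6, T ^ (2 * k + r) * (2 / α) ^ (k + (r + 1) / 2) * schedInt (2 * k + r) *
      (numExit G α hab q (2 * k + r) : ℝ)) +
    T ^ (2 * k + 6) * (2 / α) ^ (k + 3) * schedInt (2 * k + 6) * (2 * d : ℝ) ^ (k + 3)

/-- The graph `B` with marked edge `{x, y}` is the ball of radius `q` around the edge `{a, b}` of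
`G`. -/
def IsBallIn {W V : Type u} (B : SimpleGraph W) (x y : W) (q : ℕ) (G : SimpleGraph V)
    (a b : V) : Prop :=
  ∃ f : B ≃g (ball G a b q).coe, s(f x, f y) = s(ballLeft G a b q, ballRight G a b q)

/-- `ε_loc(B, T, α)`, a function of the marked ball `B` only: the path counts are maximized over
the ways to extend `B` to a finite `d`-regular graph. -/
def epsLoc {W : Type u} (d : ℕ) (B : SimpleGraph W) (x y : W) (q : ℕ) (T α : ℝ) : ℝ :=
  sSup {ε : ℝ | ∃ (V : Type u) (_ : Fintype V) (_ : DecidableEq V) (G : SimpleGraph V)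
    (_ : G.LocallyFinite) (a b : V) (hab : G.Adj a b),
    G.IsRegularOfDegree d ∧ IsBallIn B x y q G a b ∧ ε = epsLocIn d G hab q T α}

/-- The global bound `ε(q, T, α)` in closed form, `k = q + 1`. -/
def epsGlobal (d q : ℕ) (T α : ℝ) : ℝ :=
  let k := q + 1
  let D : ℝ := d
  let κ : ℝ := k
  T ^ (2 * k) * (2 / α) ^ k * schedInt (2 * k) * (2 * (D - 1) ^ k)
  + T ^ (2 * k + 1) * (2 / α) ^ (k + 1) * schedInt (2 * k + 1) * (2 * (D - 1) ^ k)
  + T ^ (2 * k + 2) * (2 / α) ^ (k + 1) * schedInt (2 * k + 2) *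
      (2 * (D - 1) ^ k * (D * (κ + 1) + 1))
  + T ^ (2 * k + 3) * (2 / α) ^ (k + 2) * schedInt (2 * k + 3) *
      (2 * (D - 1) ^ k * (D * (κ + 2)))
  + T ^ (2 * k + 4) * (2 / α) ^ (k + 2) * schedInt (2 * k + 4) *
      (2 * (D - 1) ^ k * (D ^ 2 * (((κ + 1) ^ 2 + 3) / 2) + D * ((3 * κ + 2) / 2) + κ))
  + T ^ (2 * k + 5) * (2 / α) ^ (k + 3) * schedInt (2 * k + 5) *
      (2 * (D - 1) ^ k * (D ^ 2 * (((κ + 2) ^ 2 + 3) / 2) + D * ((κ + 1) / 2) + κ - 1))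
  + T ^ (2 * k + 6) * (2 / α) ^ (k + 3) * schedInt (2 * k + 6) * (2 * D) ^ (k + 3)

/-- The path counts of the first four terms of the global bound. -/
def treeCount (d k : ℕ) : Fin 4 → ℕ :=
  ![2 * (d - 1) ^ k, 2 * (d - 1) ^ k, 2 * (d - 1) ^ k * (d * (k + 1) + 1),
    2 * (d - 1) ^ k * (d * (k + 2))]

end

end QAnneal

open QAnneal

/-! The commutativity graph is the subdivision of `G`: a term fails to commute only with the terms
incident to it. In the Heisenberg picture `γ_j' = -i s_j(t) ∑_{l ~ j} [γ_l, γ_j]`. The single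
schedule factor `s_j` comes out because all neighbours of `j` are of the other kind. Let `D_j` be
either `[γ_j(t), A]` or the difference of the evolutions of `γ_j` in `G` and in the ball. By the
Jacobi identity in the first case and by telescoping in the second, `D_j'` is a commutator of `D_j`
with a Hermitian generator, which does not change the norm, plus a source of norm at most `c_j s_j
∑_{l ~ j} ‖D_l‖`. Here `c_j` is `2/α` at a vertex and `1` at an edge (`norm_lie_heis_le_integral`,
`norm_heis_sub_le_integral`). Iterating the resulting integral inequality along paths
(`le_of_integral_inequality`) produces powers of `T` and `2/α`, the nested integrals and the path
counts. In both cases `D_j(0) = 0` at the nodes of the ball, and no path of length below `2k`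
starting at `X` ends outside it.

The inequality is used in two ways. Expanding it along all paths gives `localSum`. Making the
outside nodes absorbing gives `firstExitBound`, which serves the commutator and the edge energy
alike (`le_firstExitBound`). An edge of the ball has both endpoints in the ball, so a first exit
always happens at an edge. Hence the odd orders vanish, and `‖D_e‖ ≤ 1` is the only a priori bound
needed.

Paths are counted by reduction. Each walk reduces to a non-backtracking one, and the number of walks
with a given reduction depends only on the two lengths (`IsBiregular.pow_apply`). So the universal
cover bounds all exit counts (`coverExit`), with equality when non-backtracking walks keep moving
away from `X`, as they do in an acyclic ball (`dartCount_of_isAcyclic`).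

One coefficient needs more. For `d ≥ 2` the bracket of `ε(q, T, α)` at order `2k + 4` is smaller
than the count of all exits in the universal cover. It does dominate the count of first exits
(`IsBiregular.sum_stopMatrix_pow_add_four_le`), and this is why `firstExitBound` is introduced. -/

namespace QAnneal

/-! ### Unitary evolutions -/

section Evolution

variable {n : Type*} [Fintype n] [DecidableEq n]

/-- `U` solves `i U' = H U` with `U 0 = 1`. -/
def IsEvolution (H U : ℝ → Matrix n n ℂ) : Prop :=
  U 0 = 1 ∧ ∀ t, HasDerivAt U ((-Complex.I) • (H t * U t)) t

/-- The Heisenberg equation for an observable with its own time dependence. Since `H` is Hermitian,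
the derivatives of `star U` and of `U` combine into one commutator. -/
theorem IsEvolution.hasDerivAt_conj {H U : ℝ → Matrix n n ℂ} (hU : IsEvolution H U)
    (hH : ∀ t, star (H t) = H t) {M : ℝ → Matrix n n ℂ} {M' : Matrix n n ℂ} {t : ℝ}
    (hM : HasDerivAt M M' t) :
    HasDerivAt (fun s => star (U s) * M s * U s)
      (star (U t) * (Complex.I • ⁅H t, M t⁆ + M') * U t) t := by
  have h := ((hU.2 t).star.mul hM).mul (hU.2 t)
  have key : star (U t) * (Complex.I • ⁅H t, M t⁆ + M') * U t =
      (star ((-Complex.I) • (H t * U t)) * M t + star (U t) * M') * U t +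
        star (U t) * M t * ((-Complex.I) • (H t * U t)) := by
    simp only [star_smul, star_mul, hH, star_neg, Complex.star_def, Complex.conj_I, neg_neg,
      Ring.lie_def, neg_smul, smul_mul_assoc, mul_smul_comm, mul_add, add_mul, mul_sub, sub_mul,
      smul_sub, mul_neg, mul_assoc]
    abel
  rw [key]
  exact h

theorem IsEvolution.star_mul_self {H U : ℝ → Matrix n n ℂ} (hU : IsEvolution H U)
    (hH : ∀ t, star (H t) = H t) (t : ℝ) : star (U t) * U t = 1 := by
  have h : ∀ s, HasDerivAt (fun s => star (U s) * (1 : Matrix n n ℂ) * U s) 0 s := by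
    intro s
    have := hU.hasDerivAt_conj hH (hasDerivAt_const s (1 : Matrix n n ℂ))
    simpa [Ring.lie_def] using this
  have := is_const_of_deriv_eq_zero (fun s => (h s).differentiableAt) (fun s => (h s).deriv) t 0
  simpa [hU.1] using this

theorem IsEvolution.mem_unitary {H U : ℝ → Matrix n n ℂ} (hU : IsEvolution H U)
    (hH : ∀ t, star (H t) = H t) (t : ℝ) : U t ∈ unitary (Matrix n n ℂ) :=
  Unitary.mem_iff.2 ⟨hU.star_mul_self hH t, mul_eq_one_comm.1 (hU.star_mul_self hH t)⟩

theorem IsEvolution.continuous {H U : ℝ → Matrix n n ℂ} (hU : IsEvolution H U) : Continuous U :=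
  continuous_iff_continuousAt.2 fun t => (hU.2 t).continuousAt

theorem exists_isEvolution {H : ℝ → Matrix n n ℂ} (hH : Continuous H) :
    ∃ U, IsEvolution H U := by
  obtain ⟨U, h0, hU⟩ := exists_linear_solution (K := fun t => (-Complex.I) • H t) (by fun_prop)
  exact ⟨U, h0, fun t => by simpa only [Matrix.smul_mul] using hU t⟩

theorem norm_star_mul_mul_of_mem_unitary {U : Matrix n n ℂ} (hU : U ∈ unitary (Matrix n n ℂ))
    (M : Matrix n n ℂ) : ‖star U * M * U‖ = ‖M‖ := by
  rw [CStarRing.norm_mul_mem_unitary _ hU,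
    CStarRing.norm_mem_unitary_mul _ (Unitary.star_mem hU)]

/-- A commutator with a Hermitian generator does not change the norm, so that only the
inhomogeneous term contributes to its growth. -/
theorem norm_le_of_hasDerivAt_lie {K R D : ℝ → Matrix n n ℂ} (hK : Continuous K)
    (hR : Continuous R) (hsa : ∀ t, star (K t) = K t)
    (hD : ∀ t, HasDerivAt D ((-Complex.I) • ⁅K t, D t⁆ + R t) t) {t : ℝ} (ht : 0 ≤ t) :
    ‖D t‖ ≤ ‖D 0‖ + ∫ s in (0 : ℝ)..t, ‖R s‖ := by
  -- Interaction picture: conjugating by the unitary evolution `W` generated by `K` cancels the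
  -- commutator and preserves norms.
  obtain ⟨W, hW⟩ := exists_isEvolution hK
  have hu := hW.mem_unitary hsa
  have hder : ∀ s, HasDerivAt (fun s => star (W s) * D s * W s) (star (W s) * R s * W s) s := by
    intro s
    have := hW.hasDerivAt_conj hsa (hD s)
    convert this using 3
    module
  have hWc := hW.continuous
  have hcont : Continuous fun s => star (W s) * R s * W s := by fun_prop
  have hint := intervalIntegral.integral_eq_sub_of_hasDerivAt (fun s _ => hder s)
    (hcont.intervalIntegrable 0 t)
  have h0 : star (W 0) * D 0 * W 0 = D 0 := by simp [hW.1]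
  rw [h0] at hint
  have h1 : star (W t) * D t * W t = D 0 + ∫ s in (0 : ℝ)..t, star (W s) * R s * W s := by
    rw [hint]; abel
  rw [← norm_star_mul_mul_of_mem_unitary (hu t) (D t), h1]
  refine (norm_add_le _ _).trans (add_le_add le_rfl ?_)
  refine (intervalIntegral.norm_integral_le_integral_norm ht).trans (le_of_eq ?_)
  exact intervalIntegral.integral_congr fun s _ => norm_star_mul_mul_of_mem_unitary (hu s) _

/-- `M` differs from a scalar by `r` times a unitary. -/
def IsShiftedUnitary (r : ℝ) (M : Matrix n n ℂ) : Prop :=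
  ∃ c : ℂ, ∃ P ∈ unitary (Matrix n n ℂ), M = c • 1 + (r : ℂ) • P

theorem IsShiftedUnitary.conj {r : ℝ} {M U : Matrix n n ℂ} (hM : IsShiftedUnitary r M)
    (hU : U ∈ unitary (Matrix n n ℂ)) : IsShiftedUnitary r (star U * M * U) := by
  obtain ⟨c, P, hP, rfl⟩ := hM
  refine ⟨c, star U * P * U, mul_mem (mul_mem (Unitary.star_mem hU) hP) hU, ?_⟩
  simp [mul_add, add_mul, Unitary.star_mul_self_of_mem hU]

/-- The scalar part drops out of the commutator, and the unitary part contributes `‖Y‖` once on each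
side. For `O_e`, with centre and radius `1/2`, the constant is `1`, half of what the norm of `O_e`
would give. -/
theorem IsShiftedUnitary.norm_lie_le {r : ℝ} (hr : 0 ≤ r) {M : Matrix n n ℂ}
    (hM : IsShiftedUnitary r M) (Y : Matrix n n ℂ) : ‖⁅M, Y⁆‖ ≤ 2 * r * ‖Y‖ := by
  obtain ⟨c, P, hP, rfl⟩ := hM
  have h : ⁅c • (1 : Matrix n n ℂ) + (r : ℂ) • P, Y⁆ = (r : ℂ) • (P * Y - Y * P) := by
    simp only [Ring.lie_def, add_mul, mul_add, smul_mul_assoc, mul_smul_comm, one_mul, mul_one,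
      smul_sub]
    abel
  rw [h, norm_smul, Complex.norm_real, Real.norm_of_nonneg hr]
  have := norm_sub_le (P * Y) (Y * P)
  rw [CStarRing.norm_mem_unitary_mul _ hP, CStarRing.norm_mul_mem_unitary _ hP] at this
  nlinarith

theorem norm_lie_comm (M Y : Matrix n n ℂ) : ‖⁅M, Y⁆‖ = ‖⁅Y, M⁆‖ := by
  rw [Ring.lie_def, Ring.lie_def, norm_sub_rev]

end Evolution

/-! ### Iterating the integral inequality -/

theorem nested_continuous (b : Bool) (n : ℕ) : Continuous (nested b n) := by
  induction n generalizing b with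
  | zero => exact continuous_const
  | succ n ih =>
    have hc : Continuous fun y : ℝ => (if b then y else 1 - y) * nested (!b) n y := by
      have := ih (!b)
      cases b <;> simp <;> fun_prop
    exact intervalIntegral.continuous_primitive (fun a c => hc.intervalIntegrable a c) 0

theorem nested_nonneg (b : Bool) (n : ℕ) {x : ℝ} (hx : x ∈ Set.Icc (0 : ℝ) 1) :
    0 ≤ nested b n x := by
  induction n generalizing b x with
  | zero => exact zero_le_one
  | succ n ih =>
    refine intervalIntegral.integral_nonneg hx.1 fun y hy => ?_
    have hy' : y ∈ Set.Icc (0 : ℝ) 1 := ⟨hy.1, hy.2.trans hx.2⟩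
    refine mul_nonneg ?_ (ih _ hy')
    cases b <;> simp [hy'.1, hy'.2]

/-- The integrands are nonnegative on `[0, 1]`, so the integral grows with its endpoint. This makes
the bounds uniform in `t ∈ [0, T]`. -/
theorem nested_le_nested_one (b : Bool) (n : ℕ) {x : ℝ} (hx : x ∈ Set.Icc (0 : ℝ) 1) :
    nested b n x ≤ nested b n 1 := by
  cases n with
  | zero => exact le_rfl
  | succ n =>
    have hc : Continuous fun y : ℝ => (if b then y else 1 - y) * nested (!b) n y := by
      have := nested_continuous (!b) n
      cases b <;> simp <;> fun_prop
    have h := intervalIntegral.integral_add_adjacent_intervals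
      (μ := MeasureTheory.volume) (hc.intervalIntegrable 0 x) (hc.intervalIntegrable x 1)
    have h2 : 0 ≤ ∫ y in x..1, (if b then y else 1 - y) * nested (!b) n y := by
      refine intervalIntegral.integral_nonneg hx.2 fun y hy => ?_
      have hy' : y ∈ Set.Icc (0 : ℝ) 1 := ⟨hx.1.trans hy.1, hy.2⟩
      refine mul_nonneg ?_ (nested_nonneg _ _ hy')
      cases b <;> simp [hy'.1, hy'.2]
    change (∫ y in (0 : ℝ)..x, _) ≤ ∫ y in (0 : ℝ)..1, _
    linarith

theorem schedInt_nonneg (n : ℕ) : 0 ≤ schedInt n :=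
  nested_nonneg _ _ ⟨zero_le_one, le_rfl⟩

/-- The schedule multiplying the neighbours of a vertex (`true`) or of an edge (`false`). -/
noncomputable def schedule (b : Bool) (T s : ℝ) : ℝ := if b then s / T else 1 - s / T

theorem schedule_continuous (b : Bool) (T : ℝ) : Continuous (schedule b T) := by
  unfold schedule
  cases b <;> simp <;> fun_prop

theorem schedule_nonneg (b : Bool) {T s : ℝ} (hT : 0 < T) (hs : s ∈ Set.Icc 0 T) :
    0 ≤ schedule b T s := by
  have h1 : s / T ≤ 1 := (div_le_one hT).2 hs.2
  have h2 : 0 ≤ s / T := div_nonneg hs.1 hT.le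
  cases b <;> simp [schedule, h1, h2]

/-- Substitution `y = s / T`: each expansion step yields one factor `T` and one more nested
integral, with the opposite weight outermost. -/
theorem integral_schedule_mul_nested (b : Bool) (n : ℕ) {T : ℝ} (hT : 0 < T) (t : ℝ) :
    ∫ s in (0 : ℝ)..t, schedule b T s * nested (!b) n (s / T) =
      T * nested b (n + 1) (t / T) := by
  have h := intervalIntegral.integral_comp_div (a := 0) (b := t)
    (fun y : ℝ => (if b then y else 1 - y) * nested (!b) n y) hT.ne'
  rw [zero_div, smul_eq_mul] at h
  exact h

/-- The number of vertices among the first `n` nodes of a path that alternates between vertices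
and edges and starts at a vertex (`true`) or at an edge (`false`). -/
def vertexCount (b : Bool) (n : ℕ) : ℕ := if b then (n + 1) / 2 else n / 2

theorem mul_pow_vertexCount (b : Bool) (n : ℕ) (l : ℝ) :
    (if b then l else 1) * l ^ vertexCount (!b) n = l ^ vertexCount b (n + 1) := by
  cases b
  · simp [vertexCount]
  · have : (n + 1 + 1) / 2 = n / 2 + 1 := by omega
    simp [vertexCount, ← pow_succ', this]

section Iterate

variable {N : Type*} [Fintype N] [DecidableEq N]

/-- A functional whose weights are powers of a nonnegative matrix is bounded by expanding the
integral inequality `m` times along the paths that the matrix describes. -/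
theorem le_of_integral_inequality (b : N → Bool) (M : Matrix N N ℝ) (hM0 : ∀ i j, 0 ≤ M i j)
    (hMb : ∀ i j, M i j ≠ 0 → b j = !b i) {T l : ℝ} (hT : 0 < T) (hl : 0 ≤ l)
    (x : N → ℝ → ℝ) (hxc : ∀ j, Continuous (x j)) (x₀ S : N → ℝ)
    (hS : ∀ j, ∀ t ∈ Set.Icc 0 T, x j t ≤ S j)
    (hx : ∀ j, ∀ t ∈ Set.Icc 0 T, x j t ≤ x₀ j + ∫ s in (0 : ℝ)..t,
      (if b j then l else 1) * (schedule (b j) T s * ∑ i, M j i * x i s))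
    (m : ℕ) (j : N) {t : ℝ} (ht : t ∈ Set.Icc 0 T) :
    x j t ≤ (∑ n ∈ Finset.range m, T ^ n * l ^ vertexCount (b j) n * nested (b j) n (t / T) *
        ∑ i, (M ^ n) j i * x₀ i) +
      T ^ m * l ^ vertexCount (b j) m * nested (b j) m (t / T) * ∑ i, (M ^ m) j i * S i := by
  induction m generalizing j t with
  | zero =>
    have h0 : vertexCount (b j) 0 = 0 := by cases b j <;> simp [vertexCount]
    simpa [h0, nested, Matrix.one_apply] using hS j t ht
  | succ m ih =>
    have hpow : ∀ (n : ℕ) (z : N → ℝ), ∑ i, M j i * ∑ i', (M ^ n) i i' * z i' =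
        ∑ i', (M ^ (n + 1)) j i' * z i' := by
      intro n z
      simp only [pow_succ', Matrix.mul_apply, Finset.sum_mul, Finset.mul_sum]
      rw [Finset.sum_comm]
      simp only [mul_assoc]
    set B : ℝ → ℝ := fun s =>
      (∑ n ∈ Finset.range m, T ^ n * l ^ vertexCount (!b j) n * nested (!b j) n (s / T) *
        ∑ i, (M ^ (n + 1)) j i * x₀ i) +
      T ^ m * l ^ vertexCount (!b j) m * nested (!b j) m (s / T) *
        ∑ i, (M ^ (m + 1)) j i * S i with hB
    have hle : ∀ s ∈ Set.Icc 0 T, ∑ i, M j i * x i s ≤ B s := by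
      intro s hs
      have h1 : ∀ i, M j i * x i s ≤ M j i * ((∑ n ∈ Finset.range m,
          T ^ n * l ^ vertexCount (!b j) n * nested (!b j) n (s / T) *
            ∑ i', (M ^ n) i i' * x₀ i') +
          T ^ m * l ^ vertexCount (!b j) m * nested (!b j) m (s / T) *
            ∑ i', (M ^ m) i i' * S i') := by
        intro i
        by_cases hz : M j i = 0
        · simp [hz]
        · have := ih i hs
          rw [hMb j i hz] at this
          exact mul_le_mul_of_nonneg_left this (hM0 j i)
      refine (Finset.sum_le_sum fun i _ => h1 i).trans (le_of_eq ?_)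
      simp only [hB, mul_add, Finset.sum_add_distrib, ← hpow]
      congr 1
      · simp only [Finset.mul_sum (Finset.range m)]
        rw [Finset.sum_comm]
        refine Finset.sum_congr rfl fun n _ => ?_
        rw [Finset.mul_sum]
        exact Finset.sum_congr rfl fun i _ => by ring
      · rw [Finset.mul_sum]
        exact Finset.sum_congr rfl fun i _ => by ring
    have hsc := schedule_continuous (b j) T
    have hnc : ∀ n, Continuous fun s : ℝ => nested (!b j) n (s / T) := fun n =>
      (nested_continuous _ n).comp (by fun_prop)
    have hBc : Continuous B := by
      simp only [hB]
      fun_prop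
    have hc0 : 0 ≤ (if b j then l else 1) := by split_ifs <;> simp [hl]
    have hmono : ∫ s in (0 : ℝ)..t,
          (if b j then l else 1) * (schedule (b j) T s * ∑ i, M j i * x i s) ≤
        ∫ s in (0 : ℝ)..t, (if b j then l else 1) * (schedule (b j) T s * B s) := by
      refine intervalIntegral.integral_mono_on ht.1 ?_ ?_ fun s hs => ?_
      · exact Continuous.intervalIntegrable (by fun_prop) _ _
      · exact Continuous.intervalIntegrable (by fun_prop) _ _
      · have hs' : s ∈ Set.Icc 0 T := ⟨hs.1, hs.2.trans ht.2⟩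
        exact mul_le_mul_of_nonneg_left
          (mul_le_mul_of_nonneg_left (hle s hs') (schedule_nonneg _ hT hs')) hc0
    have hterm : ∀ (n : ℕ) (z : ℝ), ∫ s in (0 : ℝ)..t, (if b j then l else 1) *
          (schedule (b j) T s * (T ^ n * l ^ vertexCount (!b j) n * nested (!b j) n (s / T) * z)) =
        T ^ (n + 1) * l ^ vertexCount (b j) (n + 1) * nested (b j) (n + 1) (t / T) * z := by
      intro n z
      have : ∀ s, (if b j then l else 1) * (schedule (b j) T s *
          (T ^ n * l ^ vertexCount (!b j) n * nested (!b j) n (s / T) * z)) =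
          (T ^ n * ((if b j then l else 1) * l ^ vertexCount (!b j) n) * z) *
            (schedule (b j) T s * nested (!b j) n (s / T)) := fun s => by ring
      simp only [this]
      rw [intervalIntegral.integral_const_mul, integral_schedule_mul_nested _ _ hT,
        mul_pow_vertexCount]
      ring
    have hint : ∫ s in (0 : ℝ)..t, (if b j then l else 1) * (schedule (b j) T s * B s) =
        (∑ n ∈ Finset.range m, T ^ (n + 1) * l ^ vertexCount (b j) (n + 1) *
          nested (b j) (n + 1) (t / T) * ∑ i, (M ^ (n + 1)) j i * x₀ i) +
        T ^ (m + 1) * l ^ vertexCount (b j) (m + 1) * nested (b j) (m + 1) (t / T) *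
          ∑ i, (M ^ (m + 1)) j i * S i := by
      simp only [hB, mul_add]
      rw [intervalIntegral.integral_add]
      · rw [hterm]
        congr 1
        simp only [Finset.mul_sum (Finset.range m)]
        rw [intervalIntegral.integral_finsetSum]
        · exact Finset.sum_congr rfl fun n _ => hterm n _
        · intro n _
          exact Continuous.intervalIntegrable (by fun_prop) _ _
      · exact Continuous.intervalIntegrable (by fun_prop) _ _
      · exact Continuous.intervalIntegrable (by fun_prop) _ _
    have h0 : T ^ 0 * l ^ vertexCount (b j) 0 * nested (b j) 0 (t / T) *
        ∑ i, (M ^ 0) j i * x₀ i = x₀ j := by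
      have : vertexCount (b j) 0 = 0 := by cases b j <;> simp [vertexCount]
      simp [this, nested, Matrix.one_apply]
    rw [Finset.sum_range_succ', h0]
    have := hx j t ht
    linarith

end Iterate

/-! ### One-qubit operators -/

section Sites

variable {V : Type u} [Fintype V] [DecidableEq V]

theorem onSite_mul_apply (v : V) (M : Matrix (Fin 2) (Fin 2) ℂ) (A : Op V) (x y : V → Fin 2) :
    (onSite v M * A) x y = ∑ c, M (x v) c * A (Function.update x v c) y := by
  rw [Matrix.mul_apply]
  symm
  refine Fintype.sum_of_injective (fun c => Function.update x v c)
    (Function.update_injective x v) _ _ ?_ ?_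
  · intro z hz
    rw [onSite, Matrix.of_apply, if_neg, zero_mul]
    intro h
    refine hz ⟨z v, funext fun w => ?_⟩
    by_cases hw : w = v
    · subst hw; simp
    · simp [hw, h w hw]
  · intro c
    rw [onSite, Matrix.of_apply, if_pos, Function.update_self]
    intro w hw
    rw [Function.update_of_ne hw]

theorem mul_onSite_apply (v : V) (M : Matrix (Fin 2) (Fin 2) ℂ) (A : Op V) (x y : V → Fin 2) :
    (A * onSite v M) x y = ∑ c, A x (Function.update y v c) * M c (y v) := by
  rw [Matrix.mul_apply]
  symm
  refine Fintype.sum_of_injective (fun c => Function.update y v c)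
    (Function.update_injective y v) _ _ ?_ ?_
  · intro z hz
    rw [onSite, Matrix.of_apply, if_neg, mul_zero]
    intro h
    refine hz ⟨z v, funext fun w => ?_⟩
    by_cases hw : w = v
    · subst hw; simp
    · simp [hw, h w hw]
  · intro c
    rw [onSite, Matrix.of_apply, if_pos, Function.update_self]
    intro w hw
    rw [Function.update_of_ne hw]

theorem onSite_mul_onSite (v : V) (M M' : Matrix (Fin 2) (Fin 2) ℂ) :
    onSite v M * onSite v M' = onSite v (M * M') := by
  ext x y
  rw [onSite_mul_apply]
  have h : ∀ c, (∀ w, w ≠ v → Function.update x v c w = y w) ↔ ∀ w, w ≠ v → x w = y w :=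
    fun c => forall₂_congr fun w hw => by rw [Function.update_of_ne hw]
  simp only [onSite, Matrix.of_apply, h, Function.update_self, Matrix.mul_apply]
  split_ifs <;> simp

theorem onSite_one (v : V) : onSite v 1 = (1 : Op V) := by
  ext x y
  simp only [onSite, Matrix.of_apply, Matrix.one_apply, ← ite_and]
  congr 1
  simp only [eq_iff_iff]
  constructor
  · rintro ⟨h1, h2⟩
    funext w
    by_cases hw : w = v
    · rw [hw, h2]
    · exact h1 w hw
  · rintro rfl; simp

theorem star_onSite (v : V) (M : Matrix (Fin 2) (Fin 2) ℂ) :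
    star (onSite v M) = onSite v (star M) := by
  ext x y
  rw [Matrix.star_apply]
  simp only [onSite, Matrix.of_apply, Matrix.star_apply, eq_comm]
  split_ifs <;> simp

/-- `A` acts as the identity on the qubit `v`, so its entries vanish unless the two configurations
agree at `v`. In each product a single summand survives, and the two summands coincide. -/
theorem SupportedOn.commute_onSite {S : Set V} {A : Op V} (hA : SupportedOn S A) {v : V}
    (hv : v ∉ S) (M : Matrix (Fin 2) (Fin 2) ℂ) : Commute (onSite v M) A := by
  obtain ⟨B, hB⟩ := hA
  have hvS : ∀ s : S, (s : V) ≠ v := fun s h => hv (h ▸ s.2)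
  ext x y
  rw [onSite_mul_apply, mul_onSite_apply, Finset.sum_eq_single (y v), Finset.sum_eq_single (x v)]
  · rw [hB, hB, mul_comm]
    congr 1
    simp only [Function.update_of_ne (hvS _)]
    congr 1
    simp only [eq_iff_iff]
    refine forall₂_congr fun w _ => ?_
    by_cases hw : w = v
    · subst hw; simp
    · simp [hw]
  · intro c _ hc
    rw [hB, if_neg, zero_mul]
    intro h
    exact hc (by simpa using (h v hv).symm)
  · simp
  · intro c _ hc
    rw [hB, if_neg, mul_zero]
    intro h
    exact hc (by simpa using h v hv)
  · simp

theorem supportedOn_onSite (v : V) (M : Matrix (Fin 2) (Fin 2) ℂ) :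
    SupportedOn {v} (onSite v M) :=
  ⟨Matrix.of fun x y => M (x ⟨v, rfl⟩) (y ⟨v, rfl⟩), fun x y => by simp [onSite]⟩

theorem commute_onSite_onSite {v w : V} (h : v ≠ w) (M M' : Matrix (Fin 2) (Fin 2) ℂ) :
    Commute (onSite v M) (onSite w M') :=
  (supportedOn_onSite w M').commute_onSite (by simpa using h) M

theorem pauliX_mul_self : pauliX * pauliX = 1 := by
  ext i j; fin_cases i <;> fin_cases j <;> simp [pauliX, Matrix.mul_apply]

theorem pauliZ_mul_self : pauliZ * pauliZ = 1 := by
  ext i j; fin_cases i <;> fin_cases j <;> simp [pauliZ, Matrix.mul_apply]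

theorem star_pauliX : star pauliX = pauliX := by
  ext i j; fin_cases i <;> fin_cases j <;> simp [pauliX, Matrix.star_apply]

theorem star_pauliZ : star pauliZ = pauliZ := by
  ext i j; fin_cases i <;> fin_cases j <;> simp [pauliZ, Matrix.star_apply]

theorem pauliX_mul_pauliZ : pauliX * pauliZ = -(pauliZ * pauliX) := by
  ext i j; fin_cases i <;> fin_cases j <;> simp [pauliX, pauliZ, Matrix.mul_apply]

theorem onSite_neg (v : V) (M : Matrix (Fin 2) (Fin 2) ℂ) : onSite v (-M) = -onSite v M := by
  ext x y
  simp only [onSite, Matrix.of_apply, Matrix.neg_apply]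
  split_ifs <;> simp

theorem onSite_mem_unitary (v : V) {M : Matrix (Fin 2) (Fin 2) ℂ} (h1 : M * M = 1)
    (h2 : star M = M) : onSite v M ∈ unitary (Op V) := by
  rw [Unitary.mem_iff, star_onSite, h2, onSite_mul_onSite, h1, onSite_one]
  exact ⟨rfl, rfl⟩

/-! ### The Hamiltonian terms -/

theorem cutOp_mk (a b : V) :
    cutOp s(a, b) = (2⁻¹ : ℂ) • (1 - onSite a pauliZ * onSite b pauliZ) := rfl

theorem commute_pauliZ (a b : V) : Commute (onSite a pauliZ) (onSite b pauliZ) := by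
  by_cases h : a = b
  · subst h; exact Commute.refl _
  · exact commute_onSite_onSite h _ _

theorem star_cutOp (e : Sym2 V) : star (cutOp e) = cutOp e := by
  induction e with | _ a b
  rw [cutOp_mk, star_smul, star_sub, star_one, star_mul, star_onSite, star_onSite, star_pauliZ,
    (commute_pauliZ b a).eq]
  simp

theorem star_mixOp (α : ℝ) (v : V) : star (mixOp α v) = mixOp α v := by
  rw [mixOp, star_smul, star_onSite, star_pauliX]
  simp

theorem isShiftedUnitary_cutOp (e : Sym2 V) : IsShiftedUnitary (1 / 2) (cutOp e) := by
  induction e with | _ a b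
  refine ⟨2⁻¹, -(onSite a pauliZ * onSite b pauliZ), ?_, ?_⟩
  · have h := mul_mem (onSite_mem_unitary a pauliZ_mul_self star_pauliZ)
      (onSite_mem_unitary b pauliZ_mul_self star_pauliZ)
    rw [Unitary.mem_iff] at h ⊢
    simpa using h
  · rw [cutOp_mk, smul_sub, smul_neg, sub_eq_add_neg]
    norm_num

theorem isShiftedUnitary_mixOp (α : ℝ) (v : V) : IsShiftedUnitary (1 / α) (mixOp α v) := by
  refine ⟨0, onSite v pauliX, onSite_mem_unitary v pauliX_mul_self star_pauliX, ?_⟩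
  simp [mixOp]

theorem commute_mixOp_mixOp (α : ℝ) (v w : V) : Commute (mixOp α v) (mixOp α w) := by
  by_cases h : v = w
  · subst h; exact Commute.refl _
  · exact ((commute_onSite_onSite h _ _).smul_left _).smul_right _

theorem commute_cutOp_of_commute {A : Op V} {a b : V} (ha : Commute (onSite a pauliZ) A)
    (hb : Commute (onSite b pauliZ) A) : Commute (cutOp s(a, b)) A := by
  rw [cutOp_mk]
  exact ((Commute.one_left A).sub_left (ha.mul_left hb)).smul_left _

theorem commute_cutOp_cutOp (e f : Sym2 V) : Commute (cutOp e) (cutOp f) := by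
  induction e with | _ a b
  induction f with | _ c d
  exact commute_cutOp_of_commute
    (commute_cutOp_of_commute (commute_pauliZ c a) (commute_pauliZ d a)).symm
    (commute_cutOp_of_commute (commute_pauliZ c b) (commute_pauliZ d b)).symm

theorem commute_mixOp_cutOp (α : ℝ) {v : V} {e : Sym2 V} (h : v ∉ e) :
    Commute (mixOp α v) (cutOp e) := by
  induction e with | _ a b
  simp only [Sym2.mem_iff, not_or] at h
  refine Commute.smul_left (commute_cutOp_of_commute ?_ ?_).symm _
  · exact commute_onSite_onSite (Ne.symm h.1) _ _
  · exact commute_onSite_onSite (Ne.symm h.2) _ _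

/-- `σ_x` at `v` anticommutes with `σ_z` at `v` and commutes with `σ_z` at `w ≠ v`, so it
anticommutes with their product. If it also commuted, a product of involutions would be zero. -/
theorem not_commute_mixOp_cutOp {α : ℝ} (hα : α ≠ 0) {v w : V} (h : v ≠ w) :
    ¬ Commute (mixOp α v) (cutOp s(v, w)) := by
  intro hc
  set X := onSite v pauliX
  set Z := onSite v pauliZ
  set Z' := onSite w pauliZ
  have h1 : X * X = 1 := by rw [onSite_mul_onSite, pauliX_mul_self, onSite_one]
  have h2 : Z * Z = 1 := by rw [onSite_mul_onSite, pauliZ_mul_self, onSite_one]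
  have h3 : Z' * Z' = 1 := by rw [onSite_mul_onSite, pauliZ_mul_self, onSite_one]
  have h4 : X * Z = -(Z * X) := by
    rw [onSite_mul_onSite, onSite_mul_onSite, pauliX_mul_pauliZ, onSite_neg]
  have h5 : X * Z' = Z' * X := commute_onSite_onSite h _ _
  have hX : X * (Z * Z') = (Z * Z') * X := by
    have h6 : Commute X (cutOp s(v, w)) := by
      have := hc.smul_left (α : ℂ)
      rwa [mixOp, smul_smul, mul_inv_cancel₀ (by exact_mod_cast hα), one_smul] at this
    have h7 := h6.smul_right (2 : ℂ)
    rw [cutOp_mk, smul_smul, mul_inv_cancel₀ two_ne_zero, one_smul] at h7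
    have h8 := (Commute.one_right X).sub_right h7
    rw [sub_sub_cancel] at h8
    exact h8
  have h9 : X * (Z * Z') = -((Z * Z') * X) := by
    rw [← mul_assoc, h4, neg_mul, mul_assoc, h5, mul_assoc]
  have h10 : (Z * Z') * X = 0 := by
    have h11 := hX.symm.trans h9
    have h12 : (2 : ℂ) • ((Z * Z') * X) = 0 := by
      rw [two_smul]
      exact eq_neg_iff_add_eq_zero.1 h11
    exact (smul_eq_zero.1 h12).resolve_left two_ne_zero
  have h12 : (1 : Op V) = 0 := by
    calc (1 : Op V) = Z' * (Z * ((Z * Z') * X)) * X := by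
          simp only [mul_assoc]
          rw [h1, mul_one, ← mul_assoc Z Z, h2, one_mul, h3]
      _ = 0 := by rw [h10]; simp
  exact one_ne_zero h12

end Sites

/-! ### Heisenberg equations along the commutativity graph -/

section Heisenberg

set_option linter.unusedSectionVars false

variable {V : Type u} [Fintype V] [DecidableEq V]

open Classical in
/-- The incidence matrix of vertices and edges, as a symmetric matrix on `V ⊕ E`. -/
noncomputable def incMatrix (G : SimpleGraph V) :
    Matrix (V ⊕ G.edgeSet) (V ⊕ G.edgeSet) ℝ := Matrix.of fun
  | Sum.inl v, Sum.inr e => if v ∈ (e : Sym2 V) then 1 else 0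
  | Sum.inr e, Sum.inl v => if v ∈ (e : Sym2 V) then 1 else 0
  | _, _ => 0

theorem commGraph_adj_inl_inr (G : SimpleGraph V) {α : ℝ} (hα : α ≠ 0) (v : V) (e : G.edgeSet) :
    (commGraph G α).Adj (Sum.inl v) (Sum.inr e) ↔ v ∈ (e : Sym2 V) := by
  change ¬ Commute (mixOp α v) (cutOp (e : Sym2 V)) ↔ _
  constructor
  · intro h
    by_contra hv
    exact h (commute_mixOp_cutOp α hv)
  · intro h
    obtain ⟨w, hw⟩ := h
    have hadj : G.Adj v w := by
      have := e.2
      rwa [hw] at this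
    rw [hw]
    exact not_commute_mixOp_cutOp hα hadj.ne

theorem gam_commute_of_not_adj {G : SimpleGraph V} {α : ℝ} {i j : V ⊕ G.edgeSet}
    (h : ¬ (commGraph G α).Adj i j) : Commute (gam G α i) (gam G α j) := not_not.1 h

-- Adjacency in the commutativity graph is incidence in `G`, whatever the value of `α ≠ 0`. All path
-- counting can therefore be done with `incMatrix`.
open Classical in
theorem incMatrix_apply (G : SimpleGraph V) {α : ℝ} (hα : α ≠ 0) (i j : V ⊕ G.edgeSet) :
    incMatrix G i j = if (commGraph G α).Adj i j then 1 else 0 := by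
  rcases i with v | e <;> rcases j with w | f
  · rw [if_neg]
    · rfl
    · exact fun h => h (commute_mixOp_mixOp α v w)
  · simp only [commGraph_adj_inl_inr G hα]
    rfl
  · simp only [(commGraph G α).adj_comm (Sum.inr e), commGraph_adj_inl_inr G hα]
    rfl
  · rw [if_neg]
    · rfl
    · exact fun h => h (commute_cutOp_cutOp _ _)

theorem incMatrix_nonneg (G : SimpleGraph V) (i j : V ⊕ G.edgeSet) : 0 ≤ incMatrix G i j := by
  classical
  rw [incMatrix_apply G one_ne_zero]
  split_ifs <;> simp

theorem isLeft_of_incMatrix_ne_zero {G : SimpleGraph V} {i j : V ⊕ G.edgeSet}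
    (h : incMatrix G i j ≠ 0) : j.isLeft = !i.isLeft := by
  rcases i with v | e <;> rcases j with w | f <;> simp_all [incMatrix]

theorem star_gam (G : SimpleGraph V) (α : ℝ) (j : V ⊕ G.edgeSet) :
    star (gam G α j) = gam G α j := by
  rcases j with v | e
  · exact star_mixOp α v
  · exact star_cutOp _

theorem isShiftedUnitary_gam (G : SimpleGraph V) (α : ℝ) (j : V ⊕ G.edgeSet) :
    IsShiftedUnitary (if j.isLeft then 1 / α else 1 / 2) (gam G α j) := by
  rcases j with v | e
  · exact isShiftedUnitary_mixOp α v
  · exact isShiftedUnitary_cutOp _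

variable {G : SimpleGraph V} [Fintype G.edgeSet] {T α : ℝ} {In : V ⊕ G.edgeSet → Prop}

open Classical in
/-- The Hamiltonian keeping only the terms in `In`. -/
noncomputable def hamOn (G : SimpleGraph V) [Fintype G.edgeSet] (T α : ℝ)
    (In : V ⊕ G.edgeSet → Prop) (t : ℝ) : Op V :=
  -∑ l, if In l then ((schedule (!l.isLeft) T t : ℝ) : ℂ) • gam G α l else 0

open Classical in
/-- The Heisenberg evolution of the terms in `In`; the other terms are frozen to the scalar `1/2`,
which commutes with everything. -/
noncomputable def heis (α : ℝ) (In : V ⊕ G.edgeSet → Prop) (U : ℝ → Op V) (j : V ⊕ G.edgeSet)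
    (t : ℝ) : Op V :=
  if In j then star (U t) * gam G α j * U t else (2⁻¹ : ℂ) • 1

theorem star_hamOn (t : ℝ) : star (hamOn G T α In t) = hamOn G T α In t := by
  classical
  simp only [hamOn, star_neg, star_sum]
  congr 1
  refine Finset.sum_congr rfl fun l _ => ?_
  split_ifs
  · rw [star_smul, star_gam]
    simp
  · simp

/-- Only neighbours of `j` contribute, and they all have the other colour, so they share the
schedule factor `schedule j.isLeft`. The flag of `schedule` is the colour of the node whose
neighbours are being summed. -/
theorem lie_hamOn (hα : α ≠ 0) (j : V ⊕ G.edgeSet) (t : ℝ) [DecidablePred In] :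
    ⁅hamOn G T α In t, gam G α j⁆ = -(((schedule j.isLeft T t : ℝ) : ℂ) •
      ∑ l, if In l then ((incMatrix G j l : ℝ) : ℂ) • ⁅gam G α l, gam G α j⁆ else 0) := by
  classical
  have h : ∀ l, (if In l then ((schedule (!l.isLeft) T t : ℝ) : ℂ) • gam G α l else 0) *
        gam G α j - gam G α j *
        (if In l then ((schedule (!l.isLeft) T t : ℝ) : ℂ) • gam G α l else 0) =
      ((schedule j.isLeft T t : ℝ) : ℂ) •
        (if In l then ((incMatrix G j l : ℝ) : ℂ) • ⁅gam G α l, gam G α j⁆ else 0) := by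
    intro l
    split_ifs
    · rw [smul_mul_assoc, mul_smul_comm, ← smul_sub, incMatrix_apply G hα]
      split_ifs with hadj
      · have hne : incMatrix G j l ≠ 0 := by rw [incMatrix_apply G hα, if_pos hadj]; simp
        rw [isLeft_of_incMatrix_ne_zero hne]
        simp [Ring.lie_def]
      · rw [(gam_commute_of_not_adj hadj).eq]
        simp
    · simp
  rw [Finset.smul_sum, ← Finset.sum_congr rfl fun l _ => h l, Ring.lie_def, hamOn,
    Finset.sum_sub_distrib, ← Finset.sum_mul, ← Finset.mul_sum, neg_mul, mul_neg]
  convert (neg_sub' _ _).symm using 1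
  simp only [neg_sub', sub_neg_eq_add]
  congr!

theorem lie_heis {U : ℝ → Op V} {t : ℝ} (hU : U t ∈ unitary (Op V)) {j l : V ⊕ G.edgeSet}
    (hj : In j) [DecidablePred In] : ⁅heis α In U l t, heis α In U j t⁆ =
      if In l then star (U t) * ⁅gam G α l, gam G α j⁆ * U t else 0 := by
  have hu : U t * star (U t) = 1 := Unitary.mul_star_self_of_mem hU
  simp only [heis, if_pos hj]
  split_ifs
  · have h : ∀ x y : Op V, star (U t) * x * U t * (star (U t) * y * U t) =
        star (U t) * (x * y) * U t := by
      intro x y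
      calc star (U t) * x * U t * (star (U t) * y * U t)
          = star (U t) * x * (U t * star (U t)) * y * U t := by simp only [mul_assoc]
        _ = _ := by rw [hu, mul_one]; simp only [mul_assoc]
    rw [Ring.lie_def, Ring.lie_def, h, h, mul_sub, sub_mul]
  · simp [Ring.lie_def]

/-- The frozen terms are scalars, so their commutators vanish, exactly as the omitted terms of the
Hamiltonian require. The truncated evolution thus obeys an equation of the same form as the full
one, summed over all neighbours. -/
theorem hasDerivAt_heis (hα : α ≠ 0) {U : ℝ → Op V} (hU : IsEvolution (hamOn G T α In) U)
    {j : V ⊕ G.edgeSet} (hj : In j) (t : ℝ) :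
    HasDerivAt (heis α In U j) ((-Complex.I) • (((schedule j.isLeft T t : ℝ) : ℂ) •
      ∑ l, ((incMatrix G j l : ℝ) : ℂ) • ⁅heis α In U l t, heis α In U j t⁆)) t := by
  classical
  have h := hU.hasDerivAt_conj star_hamOn (hasDerivAt_const t (gam G α j))
  have he : heis α In U j = fun s => star (U s) * gam G α j * U s := by
    funext s; simp only [heis, if_pos hj]
  rw [he]
  convert h using 1
  rw [lie_hamOn hα, add_zero, smul_neg, neg_smul, mul_neg, neg_mul, mul_smul_comm, mul_smul_comm,
    smul_mul_assoc, smul_mul_assoc, Finset.mul_sum, Finset.sum_mul]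
  congr 3
  refine Finset.sum_congr rfl fun l _ => ?_
  have := lie_heis (α := α) (hU.mem_unitary star_hamOn t) (l := l) hj
  rw [he] at this
  rw [this]
  split_ifs <;> simp

theorem continuous_heis {U : ℝ → Op V} (hU : Continuous U) (j : V ⊕ G.edgeSet) :
    Continuous (heis α In U j) := by
  classical
  by_cases hj : In j
  · have he : heis α In U j = fun s => star (U s) * gam G α j * U s := by
      funext s; simp only [heis, if_pos hj]
    rw [he]
    fun_prop
  · have he : heis α In U j = fun s => (2⁻¹ : ℂ) • (1 : Op V) := by
      funext s; simp only [heis, if_neg hj]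
    rw [he]
    exact continuous_const

theorem star_heis {U : ℝ → Op V} (j : V ⊕ G.edgeSet) (t : ℝ) :
    star (heis α In U j t) = heis α In U j t := by
  classical
  unfold heis
  split_ifs
  · simp only [star_mul, star_star, star_gam, mul_assoc]
  · simp

theorem isShiftedUnitary_heis {U : ℝ → Op V} {t : ℝ} (hU : U t ∈ unitary (Op V))
    {j : V ⊕ G.edgeSet} (hj : In j) :
    IsShiftedUnitary (if j.isLeft then 1 / α else 1 / 2) (heis α In U j t) := by
  simp only [heis, if_pos hj]
  exact (isShiftedUnitary_gam G α j).conj hU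

theorem norm_lie_heis_le (hα : 0 < α) {U : ℝ → Op V} {t : ℝ} (hU : U t ∈ unitary (Op V))
    {j : V ⊕ G.edgeSet} (hj : In j) (Y : Op V) :
    ‖⁅heis α In U j t, Y⁆‖ ≤ (if j.isLeft then 2 / α else 1) * ‖Y‖ := by
  refine ((isShiftedUnitary_heis hU hj).norm_lie_le ?_ Y).trans (le_of_eq ?_)
  · split_ifs <;> positivity
  · split_ifs
    · ring
    · ring

/-- If `D j` is driven by the commutators with the neighbours of `j`, up to source terms bounded
by the neighbouring `D l`, then its norm satisfies the integral inequality. -/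
theorem norm_le_of_hasDerivAt_neighbors (hT : 0 < T) {j : V ⊕ G.edgeSet}
    {g D E : V ⊕ G.edgeSet → ℝ → Op V} (hg : ∀ l, Continuous (g l))
    (hgs : ∀ l t, star (g l t) = g l t) (hD : ∀ l, Continuous (D l))
    (hE : ∀ l, Continuous (E l)) {c : ℝ} (hEle : ∀ l t, ‖E l t‖ ≤ c * ‖D l t‖)
    (hder : ∀ t, HasDerivAt (D j) ((-Complex.I) • (((schedule j.isLeft T t : ℝ) : ℂ) •
      ∑ l, ((incMatrix G j l : ℝ) : ℂ) • (⁅g l t, D j t⁆ + E l t))) t)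
    {t : ℝ} (ht : t ∈ Set.Icc 0 T) :
    ‖D j t‖ ≤ ‖D j 0‖ + ∫ s in (0 : ℝ)..t,
      c * (schedule j.isLeft T s * ∑ l, incMatrix G j l * ‖D l s‖) := by
  have hsc := schedule_continuous j.isLeft T
  -- `K` collects the commutators acting on `D j` itself and is Hermitian. Only the source `R`
  -- enters the estimate.
  set K : ℝ → Op V := fun t => ((schedule j.isLeft T t : ℝ) : ℂ) •
    ∑ l, ((incMatrix G j l : ℝ) : ℂ) • g l t with hK
  set R : ℝ → Op V := fun t => (-Complex.I) • (((schedule j.isLeft T t : ℝ) : ℂ) •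
    ∑ l, ((incMatrix G j l : ℝ) : ℂ) • E l t) with hR
  have hKc : Continuous K := by simp only [hK]; fun_prop
  have hRc : Continuous R := by simp only [hR]; fun_prop
  have hKs : ∀ t, star (K t) = K t := by
    intro t
    simp [hK, hgs]
  refine (norm_le_of_hasDerivAt_lie hKc hRc hKs (D := D j) (fun t => ?_) ht.1).trans ?_
  · have h := hder t
    have heq : (-Complex.I) • ⁅K t, D j t⁆ + R t = (-Complex.I) •
        (((schedule j.isLeft T t : ℝ) : ℂ) •
          ∑ l, ((incMatrix G j l : ℝ) : ℂ) • (⁅g l t, D j t⁆ + E l t)) := by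
      simp only [hK, hR, ← smul_add]
      congr 1
      simp only [Ring.lie_def, smul_mul_assoc, mul_smul_comm, ← smul_sub, ← smul_add,
        Finset.sum_mul, Finset.mul_sum, ← Finset.sum_sub_distrib, ← Finset.sum_add_distrib]
    rw [heq]
    exact h
  · gcongr
    refine intervalIntegral.integral_mono_on ht.1 ?_ ?_ fun s hs => ?_
    · exact Continuous.intervalIntegrable (by fun_prop) _ _
    · exact Continuous.intervalIntegrable (by fun_prop) _ _
    have hs0 := schedule_nonneg j.isLeft hT ⟨hs.1, hs.2.trans ht.2⟩
    simp only [hR, norm_smul, norm_neg, Complex.norm_I, one_mul, Complex.norm_real,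
      Real.norm_of_nonneg hs0]
    rw [mul_left_comm]
    refine mul_le_mul_of_nonneg_left ?_ hs0
    refine (norm_sum_le _ _).trans ?_
    rw [Finset.mul_sum]
    refine Finset.sum_le_sum fun l _ => ?_
    rw [norm_smul, Complex.norm_real, Real.norm_of_nonneg (incMatrix_nonneg G j l), mul_left_comm]
    exact mul_le_mul_of_nonneg_left (hEle l s) (incMatrix_nonneg G j l)

/-- Jacobi identity: `[[γ_l, γ_j], A] = [γ_l, [γ_j, A]] - [γ_j, [γ_l, A]]`. The first term rotates
`[γ_j, A]`, and the second is at most a constant times the norm of the commutator at the neighbour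
`l`. -/
theorem norm_lie_heis_le_integral (hT : 0 < T) (hα : 0 < α) {U : ℝ → Op V}
    (hU : IsEvolution (hamOn G T α fun _ => True) U) (A : Op V) (j : V ⊕ G.edgeSet)
    {t : ℝ} (ht : t ∈ Set.Icc 0 T) :
    ‖⁅heis α (fun _ => True) U j t, A⁆‖ ≤ ‖⁅heis α (fun _ => True) U j 0, A⁆‖ +
      ∫ s in (0 : ℝ)..t, (if j.isLeft then 2 / α else 1) * (schedule j.isLeft T s *
        ∑ l, incMatrix G j l * ‖⁅heis α (fun _ => True) U l s, A⁆‖) := by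
  set g : V ⊕ G.edgeSet → ℝ → Op V := heis α (fun _ => True) U with hg
  have hgc : ∀ l, Continuous (g l) := continuous_heis hU.continuous
  refine norm_le_of_hasDerivAt_neighbors hT (g := g) (D := fun l t => ⁅g l t, A⁆)
    (E := fun l t => -⁅g j t, ⁅g l t, A⁆⁆) hgc (fun l t => star_heis l t) ?_ ?_ ?_ ?_ ht
  · intro l
    have := hgc l
    simp only [Ring.lie_def]
    fun_prop
  · intro l
    have := hgc l
    have := hgc j
    simp only [Ring.lie_def]
    fun_prop
  · intro l t
    rw [norm_neg]
    exact norm_lie_heis_le hα (hU.mem_unitary star_hamOn t) trivial _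
  · intro t
    have h := hasDerivAt_heis hα.ne' hU (j := j) trivial t
    have h2 := (h.mul_const A).sub (h.const_mul A)
    refine h2.congr_deriv ?_
    simp only [Ring.lie_def, smul_mul_assoc, mul_smul_comm, ← smul_sub, Finset.sum_mul, Finset.mul_sum,
      ← Finset.sum_sub_distrib]
    congr 2
    refine Finset.sum_congr rfl fun l _ => ?_
    congr 1
    simp only [mul_sub, sub_mul, mul_assoc]
    abel

/-- Telescoping: `[g_l, g_j] - [h_l, h_j] = [g_l, g_j - h_j] + [g_l - h_l, h_j]`. The first term
rotates `g_j - h_j`, and the second is the source. No initial term appears because both evolutions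
start from `γ_j`. -/
theorem norm_heis_sub_le_integral (hT : 0 < T) (hα : 0 < α) {U W : ℝ → Op V}
    (hU : IsEvolution (hamOn G T α fun _ => True) U) (hW : IsEvolution (hamOn G T α In) W)
    {j : V ⊕ G.edgeSet} (hj : In j) {t : ℝ} (ht : t ∈ Set.Icc 0 T) :
    ‖heis α (fun _ => True) U j t - heis α In W j t‖ ≤
      ∫ s in (0 : ℝ)..t, (if j.isLeft then 2 / α else 1) * (schedule j.isLeft T s *
        ∑ l, incMatrix G j l * ‖heis α (fun _ => True) U l s - heis α In W l s‖) := by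
  set g : V ⊕ G.edgeSet → ℝ → Op V := heis α (fun _ => True) U with hg
  set h : V ⊕ G.edgeSet → ℝ → Op V := heis α In W with hh
  have hgc : ∀ l, Continuous (g l) := continuous_heis hU.continuous
  have hhc : ∀ l, Continuous (h l) := continuous_heis hW.continuous
  have h0 : g j 0 - h j 0 = 0 := by
    simp [hg, hh, heis, hj, hU.1, hW.1]
  have key := norm_le_of_hasDerivAt_neighbors hT (j := j) (g := g) (D := fun l t => g l t - h l t)
    (E := fun l t => ⁅g l t - h l t, h j t⁆) (c := if j.isLeft then 2 / α else 1) hgc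
    (fun l t => star_heis l t) (fun l => (hgc l).sub (hhc l)) ?_ ?_ ?_ ht
  · simpa [h0] using key
  · intro l
    have := hgc l
    have := hhc l
    have := hhc j
    simp only [Ring.lie_def]
    fun_prop
  · intro l t
    rw [norm_lie_comm]
    exact norm_lie_heis_le hα (hW.mem_unitary star_hamOn t) hj _
  · intro t
    have h1 := hasDerivAt_heis hα.ne' hU (j := j) trivial t
    have h2 := hasDerivAt_heis hα.ne' hW hj t
    refine (h1.sub h2).congr_deriv ?_
    simp only [← smul_sub, ← Finset.sum_sub_distrib]
    congr 2
    refine Finset.sum_congr rfl fun l _ => ?_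
    congr 1
    simp only [Ring.lie_def, ← hg, ← hh, mul_sub, sub_mul]
    abel

end Heisenberg

/-! ### Walks in biregular bipartite graphs -/

section Biregular

set_option linter.unusedSectionVars false

variable {N : Type*} [Fintype N] [DecidableEq N]

/-- `a` is the adjacency matrix of a bipartite graph in which the nodes of colour `true` have
degree `D` and those of colour `false` have degree `2`. -/
structure IsBiregular (a : Matrix N N ℝ) (b : N → Bool) (D : ℝ) : Prop where
  zero_or_one : ∀ i j, a i j = 0 ∨ a i j = 1
  symm : ∀ i j, a i j = a j i
  color : ∀ i j, a i j ≠ 0 → b j = !b i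
  degree : ∀ i, ∑ j, a i j = if b i then D else 2

/-- The number of children of a node at depth `m` of the universal cover rooted at a node of
degree `2`. -/
def children (D : ℝ) : ℕ → ℝ
  | 0 => 2
  | m + 1 => if m.bodd then 1 else D - 1

/-- The number of nodes at depth `m` of the universal cover. -/
def sphereSize (D : ℝ) : ℕ → ℝ
  | 0 => 1
  | m + 1 => children D m * sphereSize D m

/-- The number of walks of length `n` from the root of the universal cover to a fixed node at
depth `m`. -/
noncomputable def coverWalks (D : ℝ) : ℕ → ℕ → ℝ
  | 0, m => if m = 0 then 1 else 0
  | n + 1, 0 => children D 0 * coverWalks D n 1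
  | n + 1, m + 1 => coverWalks D n m + children D (m + 1) * coverWalks D n (m + 2)

theorem children_nonneg {D : ℝ} (hD : 1 ≤ D) (m : ℕ) : 0 ≤ children D m := by
  cases m with
  | zero => norm_num [children]
  | succ m =>
    simp only [children]
    split_ifs <;> linarith

theorem sphereSize_odd (D : ℝ) (s : ℕ) : sphereSize D (2 * s + 1) = 2 * (D - 1) ^ s := by
  induction s with
  | zero => simp [sphereSize, children]
  | succ s ih =>
    have h : 2 * (s + 1) + 1 = 2 * s + 1 + 1 + 1 := by ring
    rw [h, sphereSize, sphereSize, ih]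
    simp [children, pow_succ']
    ring

theorem sphereSize_even (D : ℝ) (s : ℕ) :
    sphereSize D (2 * s + 2) = 2 * (D - 1) ^ (s + 1) := by
  rw [sphereSize, sphereSize_odd]
  simp [children, pow_succ']
  ring

theorem coverWalks_nonneg {D : ℝ} (hD : 1 ≤ D) (n m : ℕ) : 0 ≤ coverWalks D n m := by
  induction n generalizing m with
  | zero => simp only [coverWalks]; split_ifs <;> simp
  | succ n ih =>
    cases m with
    | zero => exact mul_nonneg (children_nonneg hD _) (ih _)
    | succ m => exact add_nonneg (ih _) (mul_nonneg (children_nonneg hD _) (ih _))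

theorem coverWalks_of_lt (D : ℝ) {n m : ℕ} (h : n < m) : coverWalks D n m = 0 := by
  induction n generalizing m with
  | zero => simp only [coverWalks]; rw [if_neg (by omega)]
  | succ n ih =>
    cases m with
    | zero => omega
    | succ m => simp only [coverWalks]; rw [ih (by omega), ih (by omega)]; simp

theorem coverWalks_of_odd (D : ℝ) {n m : ℕ} (h : Odd (n + m)) : coverWalks D n m = 0 := by
  induction n generalizing m with
  | zero =>
    simp only [coverWalks]
    rw [if_neg]
    rintro rfl
    simp at h
  | succ n ih =>
    cases m with
    | zero => simp only [coverWalks]; rw [ih (by simpa using h), mul_zero]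
    | succ m =>
      simp only [coverWalks]
      rw [Nat.odd_iff] at h
      rw [ih (by rw [Nat.odd_iff]; omega), ih (by rw [Nat.odd_iff]; omega)]
      simp

theorem coverWalks_self (D : ℝ) (n : ℕ) : coverWalks D n n = 1 := by
  induction n with
  | zero => simp [coverWalks]
  | succ n ih => simp only [coverWalks]; rw [ih, coverWalks_of_lt D (by omega)]; simp

/-- A walk two steps longer than its depth makes one detour. The recursion sums the numbers of
children at the depths from `0` to the endpoint: `2` at the root, then `D - 1` and `1` alternately,
so `D` per pair of depths. -/
theorem coverWalks_add_two (D : ℝ) (s : ℕ) :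
    coverWalks D (2 * s + 2) (2 * s) = 2 + s * D ∧
      coverWalks D (2 * s + 3) (2 * s + 1) = (s + 1) * D + 1 := by
  have hodd : ∀ s, coverWalks D (2 * s + 3) (2 * s + 1) =
      coverWalks D (2 * s + 2) (2 * s) + (D - 1) := by
    intro s
    rw [coverWalks, coverWalks_self]
    simp [children]
  induction s with
  | zero =>
    have h0 : coverWalks D 2 0 = 2 := by
      rw [coverWalks, coverWalks_self]; simp [children]
    have := hodd 0
    norm_num at this ⊢
    rw [this, h0]
    exact ⟨rfl, by ring⟩
  | succ s ih =>
    have h1 : coverWalks D (2 * (s + 1) + 2) (2 * (s + 1)) = 2 + ((s + 1 : ℕ) : ℝ) * D := by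
      have h : coverWalks D (2 * s + 3 + 1) (2 * s + 1 + 1) =
          coverWalks D (2 * s + 3) (2 * s + 1) + 1 := by
        rw [coverWalks, coverWalks_self]
        simp [children]
      rw [show 2 * (s + 1) + 2 = 2 * s + 3 + 1 by ring, show 2 * (s + 1) = 2 * s + 1 + 1 by ring,
        h, ih.2]
      push_cast
      ring
    refine ⟨h1, ?_⟩
    rw [hodd, h1]
    push_cast
    ring

theorem coverWalks_add_four_succ (D : ℝ) (m : ℕ) : coverWalks D (m + 5) (m + 1) =
    coverWalks D (m + 4) m + children D (m + 1) * coverWalks D (m + 4) (m + 2) := by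
  rw [coverWalks]

/-- Two detours: passing from depth `m` to `m + 1` adds the number of children times the
corresponding count with one detour. -/
theorem coverWalks_add_four (D : ℝ) (s : ℕ) :
    coverWalks D (2 * s + 4) (2 * s) = 2 * D + 2 + D ^ 2 * (s * (s + 1) / 2) + s * (3 * D - 1) ∧
      coverWalks D (2 * s + 5) (2 * s + 1) =
        D ^ 2 * ((s + 1) * (s + 2) / 2) + (2 * s + 3) * D - s := by
  have hodd : ∀ s : ℕ, coverWalks D (2 * s + 5) (2 * s + 1) =
      coverWalks D (2 * s + 4) (2 * s) + (D - 1) * (2 + (s + 1) * D) := by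
    intro s
    rw [coverWalks_add_four_succ]
    have := (coverWalks_add_two D (s + 1)).1
    rw [show 2 * (s + 1) + 2 = 2 * s + 4 by ring, show 2 * (s + 1) = 2 * s + 2 by ring] at this
    rw [this]
    simp [children]
  induction s with
  | zero =>
    have h0 : coverWalks D 4 0 = 2 * (D + 1) := by
      have := (coverWalks_add_two D 0).2
      norm_num at this
      rw [coverWalks, this]
      simp [children]
    have := hodd 0
    norm_num at this ⊢
    rw [this, h0]
    constructor <;> ring
  | succ s ih =>
    have h1 : coverWalks D (2 * (s + 1) + 4) (2 * (s + 1)) = 2 * D + 2 +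
        D ^ 2 * (((s + 1 : ℕ) : ℝ) * (((s + 1 : ℕ) : ℝ) + 1) / 2) +
        ((s + 1 : ℕ) : ℝ) * (3 * D - 1) := by
      have h := coverWalks_add_four_succ D (2 * s + 1)
      have h2 := (coverWalks_add_two D (s + 1)).2
      rw [show 2 * (s + 1) + 3 = 2 * s + 1 + 4 by ring,
        show 2 * (s + 1) + 1 = 2 * s + 1 + 2 by ring] at h2
      rw [show 2 * (s + 1) + 4 = 2 * s + 1 + 5 by ring, show 2 * (s + 1) = 2 * s + 1 + 1 by ring,
        h, h2, show 2 * s + 1 + 4 = 2 * s + 5 by ring, ih.2]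
      simp [children]
      ring
    refine ⟨h1, ?_⟩
    rw [hodd, h1]
    push_cast
    ring

/-- The number of walks of length `n` in the universal cover that end at depth at least `2k`. -/
noncomputable def coverExit (D : ℝ) (k n : ℕ) : ℝ :=
  ∑ m ∈ Finset.Ico (2 * k) (n + 1), coverWalks D n m * sphereSize D m

theorem coverExit_of_lt (D : ℝ) {k n : ℕ} (h : n < 2 * k) : coverExit D k n = 0 := by
  rw [coverExit, Finset.Ico_eq_empty (by omega), Finset.sum_empty]

theorem coverExit_two_mul (D : ℝ) {k : ℕ} (hk : 1 ≤ k) :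
    coverExit D k (2 * k) = 2 * (D - 1) ^ k := by
  obtain ⟨s, rfl⟩ := Nat.exists_eq_add_of_le' hk
  simp [coverExit, coverWalks_self, mul_add, sphereSize_even]

theorem coverExit_add_one (D : ℝ) (k : ℕ) :
    coverExit D k (2 * k + 1) = 2 * (D - 1) ^ k := by
  rw [coverExit, Finset.sum_Ico_succ_top (by omega), Finset.sum_Ico_succ_top (by omega),
    coverWalks_self, coverWalks_of_odd D (by simp [parity_simps]), sphereSize_odd]
  simp

theorem coverExit_add_two (D : ℝ) {k : ℕ} (hk : 1 ≤ k) :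
    coverExit D k (2 * k + 2) = 2 * (D - 1) ^ k * (D * (k + 1) + 1) := by
  obtain ⟨s, rfl⟩ := Nat.exists_eq_add_of_le' hk
  rw [coverExit, Finset.sum_Ico_succ_top (by omega), Finset.sum_Ico_succ_top (by omega),
    Finset.sum_Ico_succ_top (by omega),
    coverWalks_self, coverWalks_of_odd D (n := 2 * (s + 1) + 2) (m := 2 * (s + 1) + 1)
      (by rw [Nat.odd_iff]; omega), sphereSize_even, (coverWalks_add_two D (s + 1)).1, show 2 * (s + 1) = 2 * s + 2 by ring, sphereSize_even]
  simp
  ring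

theorem coverExit_add_three (D : ℝ) (k : ℕ) :
    coverExit D k (2 * k + 3) = 2 * (D - 1) ^ k * (D * (k + 2)) := by
  rw [coverExit, Finset.sum_Ico_succ_top (by omega), Finset.sum_Ico_succ_top (by omega),
    Finset.sum_Ico_succ_top (by omega), Finset.sum_Ico_succ_top (by omega),
    coverWalks_self, coverWalks_of_odd D (n := 2 * k + 3) (m := 2 * k) (by rw [Nat.odd_iff]; omega),
    coverWalks_of_odd D (n := 2 * k + 3) (m := 2 * k + 2) (by rw [Nat.odd_iff]; omega),
    (coverWalks_add_two D k).2, show 2 * k + 3 = 2 * (k + 1) + 1 by ring, sphereSize_odd,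
    sphereSize_odd]
  simp
  ring

variable (a : Matrix N N ℝ) (X : N)

/-- The number of non-backtracking walks from `X` of length `m + 1` whose last step goes from `i`
to `j`. -/
def dartCount : ℕ → N → N → ℝ
  | 0, i, j => if i = X then a i j else 0
  | m + 1, i, j => a i j * (∑ l, dartCount m l i - dartCount m j i)

/-- The number of non-backtracking walks of length `m` from `X` to `j`. -/
def nbCount : ℕ → N → ℝ
  | 0, j => if j = X then 1 else 0
  | m + 1, j => ∑ i, dartCount a X m i j

variable {a X} {b : N → Bool} {D : ℝ}

theorem IsBiregular.nonneg (h : IsBiregular a b D) (i j : N) : 0 ≤ a i j := by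
  rcases h.zero_or_one i j with h | h <;> simp [h]

theorem IsBiregular.dartCount_nonneg (h : IsBiregular a b D) (m : ℕ) (i j : N) :
    0 ≤ dartCount a X m i j := by
  induction m generalizing i j with
  | zero => simp only [dartCount]; split_ifs <;> simp [h.nonneg]
  | succ m ih =>
    refine mul_nonneg (h.nonneg i j) (sub_nonneg.2 ?_)
    exact Finset.single_le_sum (f := fun l => dartCount a X m l i) (fun l _ => ih l i)
      (Finset.mem_univ j)

theorem IsBiregular.nbCount_nonneg (h : IsBiregular a b D) (m : ℕ) (j : N) :
    0 ≤ nbCount a X m j := by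
  cases m with
  | zero => simp only [nbCount]; split_ifs <;> simp
  | succ m => exact Finset.sum_nonneg fun i _ => h.dartCount_nonneg m i j

theorem adj_of_dartCount_ne_zero {m : ℕ} {i j : N} (hne : dartCount a X m i j ≠ 0) :
    a i j ≠ 0 := by
  intro h0
  cases m <;> simp [dartCount, h0] at hne

theorem IsBiregular.mul_dartCount (h : IsBiregular a b D) (m : ℕ) (i j : N) :
    a j i * dartCount a X m i j = dartCount a X m i j := by
  by_cases hz : dartCount a X m i j = 0
  · simp [hz]
  · have := adj_of_dartCount_ne_zero hz
    rw [h.symm j i, (h.zero_or_one i j).resolve_left this, one_mul]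

theorem exists_dartCount_ne_zero {m : ℕ} {i j : N} (hne : dartCount a X (m + 1) i j ≠ 0) :
    ∃ l, l ≠ j ∧ dartCount a X m l i ≠ 0 := by
  by_contra hcon
  push Not at hcon
  refine hne ?_
  simp only [dartCount]
  rw [Finset.sum_eq_single j (fun l _ hl => hcon l hl) (by simp), sub_self, mul_zero]

theorem IsBiregular.color_dart (h : IsBiregular a b D) (hX : b X = false) {m : ℕ} {i j : N}
    (hne : dartCount a X m i j ≠ 0) : b i = m.bodd := by
  induction m generalizing i j with
  | zero =>
    have : i = X := by
      by_contra hi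
      exact hne (by simp [dartCount, hi])
    simp [this, hX]
  | succ m ih =>
    obtain ⟨l, -, hl⟩ := exists_dartCount_ne_zero hne
    rw [h.color l i (adj_of_dartCount_ne_zero hl), ih hl, Nat.bodd_succ]

theorem exists_dartCount_of_nbCount_ne_zero {m : ℕ} {j : N} (hne : nbCount a X (m + 1) j ≠ 0) :
    ∃ i, dartCount a X m i j ≠ 0 := by
  by_contra hcon
  push Not at hcon
  exact hne (Finset.sum_eq_zero fun i _ => hcon i)

theorem IsBiregular.color_nb (h : IsBiregular a b D) (hX : b X = false) {m : ℕ} {j : N}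
    (hne : nbCount a X m j ≠ 0) : b j = m.bodd := by
  cases m with
  | zero =>
    have : j = X := by
      by_contra hj
      exact hne (by simp [nbCount, hj])
    simp [this, hX]
  | succ m =>
    obtain ⟨i, hi⟩ := exists_dartCount_of_nbCount_ne_zero hne
    rw [h.color i j (adj_of_dartCount_ne_zero hi), h.color_dart hX hi, Nat.bodd_succ]

/-- A non-backtracking walk can go on to every neighbour except the one it came from, and all
neighbours are allowed at the start. The degree involved is determined by the parity of the length,
since colours alternate. -/
theorem IsBiregular.sum_dartCount (h : IsBiregular a b D) (hX : b X = false) (m : ℕ) (i : N) :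
    ∑ j, dartCount a X m i j = children D m * nbCount a X m i := by
  cases m with
  | zero =>
    by_cases hi : i = X
    · subst hi
      simp [dartCount, nbCount, children, h.degree, hX]
    · simp [dartCount, nbCount, hi]
  | succ m =>
    have h1 : ∀ j, dartCount a X (m + 1) i j =
        a i j * nbCount a X (m + 1) i - dartCount a X m j i := by
      intro j
      rw [dartCount, mul_sub, h.mul_dartCount]
      rfl
    simp only [h1, Finset.sum_sub_distrib, ← Finset.sum_mul, h.degree]
    change _ - nbCount a X (m + 1) i = _
    by_cases hz : nbCount a X (m + 1) i = 0
    · simp [hz]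
    · rw [h.color_nb hX hz]
      simp only [children, Nat.bodd_succ]
      cases m.bodd <;> simp <;> ring

theorem IsBiregular.sum_nbCount (h : IsBiregular a b D) (hX : b X = false) (m : ℕ) :
    ∑ j, nbCount a X m j = sphereSize D m := by
  induction m with
  | zero => simp [nbCount, sphereSize]
  | succ m ih =>
    simp only [nbCount]
    rw [Finset.sum_comm]
    simp only [h.sum_dartCount hX, ← Finset.mul_sum, ih]
    rfl

theorem sum_nbCount_zero_mul (l : N) : ∑ j, nbCount a X 0 j * a j l = nbCount a X 1 l := by
  simp [nbCount, dartCount]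

/-- A further step either prolongs the non-backtracking walk or undoes its last step. In the second
case each walk of length `m` ending at `l` occurs once for each of its extensions. -/
theorem IsBiregular.sum_nbCount_succ_mul (h : IsBiregular a b D) (hX : b X = false) (m : ℕ)
    (l : N) : ∑ j, nbCount a X (m + 1) j * a j l =
      nbCount a X (m + 2) l + children D m * nbCount a X m l := by
  rw [← h.sum_dartCount hX, nbCount, ← Finset.sum_add_distrib]
  refine Finset.sum_congr rfl fun j _ => ?_
  rw [dartCount, mul_sub, h.mul_dartCount, nbCount]
  ring

/-- Lifted to the universal cover, a walk ends at the node given by its non-backtracking reduction.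
The number of walks with a given reduction depends only on the length of that reduction. The proof
compares the recursion of `coverWalks` with the effect of one more step. -/
theorem IsBiregular.pow_apply (h : IsBiregular a b D) (hX : b X = false) (n : ℕ) (l : N) :
    (a ^ n) X l = ∑ m ∈ Finset.range (n + 1), coverWalks D n m * nbCount a X m l := by
  induction n generalizing l with
  | zero => simp [coverWalks, nbCount, Matrix.one_apply, eq_comm]
  | succ n ih =>
    have h1 : (a ^ (n + 1)) X l = ∑ m ∈ Finset.range (n + 1),
        coverWalks D n m * ∑ j, nbCount a X m j * a j l := by
      rw [pow_succ, Matrix.mul_apply]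
      simp only [ih, Finset.sum_mul, Finset.mul_sum]
      rw [Finset.sum_comm]
      simp only [mul_assoc]
    have h2 : ∑ m ∈ Finset.range (n + 1), coverWalks D n m * nbCount a X (m + 1) l =
        coverWalks D n 0 * nbCount a X 1 l +
          ∑ m ∈ Finset.range n, coverWalks D n (m + 1) * nbCount a X (m + 2) l := by
      rw [Finset.sum_range_succ', add_comm]
    -- The summands with `m ≥ n` vanish, since a walk of length `n` does not reach depth `m + 1`.
    -- This reconciles the summation ranges of the two recursions.
    have h3 : ∑ m ∈ Finset.range (n + 2),
          children D m * coverWalks D n (m + 1) * nbCount a X m l =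
        ∑ m ∈ Finset.range n, children D m * coverWalks D n (m + 1) * nbCount a X m l := by
      rw [Finset.sum_range_succ, Finset.sum_range_succ, coverWalks_of_lt D (by omega),
        coverWalks_of_lt D (by omega)]
      simp
    rw [Finset.sum_range_succ'] at h3
    rw [h1, Finset.sum_range_succ', sum_nbCount_zero_mul, Finset.sum_range_succ' _ (n + 1)]
    simp only [h.sum_nbCount_succ_mul hX, coverWalks, mul_add, add_mul, Finset.sum_add_distrib]
    simp only [zero_add] at h3
    rw [h2]
    have h4 : ∑ m ∈ Finset.range n, coverWalks D n (m + 1) * (children D m * nbCount a X m l) =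
        ∑ m ∈ Finset.range n, children D m * coverWalks D n (m + 1) * nbCount a X m l :=
      Finset.sum_congr rfl fun m _ => by ring
    rw [h4, ← h3]
    ring

/-! ### Counting the exits from a region -/

/-- The region complementary to `out` contains every node at distance less than `2k` from `X`. -/
def ContainsBall (a : Matrix N N ℝ) (X : N) (k : ℕ) (out : N → Prop) : Prop :=
  ∀ m < 2 * k, ∀ j, out j → nbCount a X m j = 0

variable {k : ℕ} {out : N → Prop} [DecidablePred out]

theorem IsBiregular.sum_exit_eq (h : IsBiregular a b D) (hX : b X = false)
    (hk : ContainsBall a X k out) (n : ℕ) :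
    ∑ j with out j, (a ^ n) X j = ∑ m ∈ Finset.Ico (2 * k) (n + 1),
      coverWalks D n m * ∑ j with out j, nbCount a X m j := by
  simp only [h.pow_apply hX, Finset.mul_sum]
  rw [Finset.sum_comm, Finset.range_eq_Ico]
  symm
  refine Finset.sum_subset (Finset.Ico_subset_Ico_left (by omega)) fun m hm hm' => ?_
  refine Finset.sum_eq_zero fun j hj => ?_
  rw [hk m _ j (Finset.mem_filter.1 hj).2, mul_zero]
  simp only [Finset.mem_Ico] at hm hm'
  omega

/-- Reductions shorter than `2k` end inside the region. For longer ones, the number ending outside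
is at most the size of the whole sphere in the cover. -/
theorem IsBiregular.sum_exit_le (h : IsBiregular a b D) (hX : b X = false) (hD : 1 ≤ D)
    (hk : ContainsBall a X k out) (n : ℕ) :
    ∑ j with out j, (a ^ n) X j ≤ coverExit D k n := by
  rw [h.sum_exit_eq hX hk]
  refine Finset.sum_le_sum fun m _ => mul_le_mul_of_nonneg_left ?_ (coverWalks_nonneg hD _ _)
  rw [← h.sum_nbCount hX]
  exact Finset.sum_le_sum_of_subset_of_nonneg (Finset.filter_subset _ _)
    fun j _ _ => h.nbCount_nonneg m j

theorem IsBiregular.sum_exit_eq_coverExit (h : IsBiregular a b D) (hX : b X = false)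
    (hk : ContainsBall a X k out) {n : ℕ}
    (hout : ∀ m, 2 * k ≤ m → m ≤ n → ∀ j, nbCount a X m j ≠ 0 → out j) :
    ∑ j with out j, (a ^ n) X j = coverExit D k n := by
  rw [h.sum_exit_eq hX hk]
  refine Finset.sum_congr rfl fun m hm => ?_
  rw [← h.sum_nbCount hX]
  congr 1
  refine Finset.sum_subset (Finset.filter_subset _ _) fun j _ hj => ?_
  by_contra hne
  rw [Finset.mem_Ico] at hm
  exact hj (by simpa using hout m hm.1 (by omega) j hne)

theorem IsBiregular.nbCount_le_pow (h : IsBiregular a b D) (hX : b X = false) (hD : 1 ≤ D)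
    (m : ℕ) (j : N) : nbCount a X m j ≤ (a ^ m) X j := by
  rw [h.pow_apply hX]
  refine le_trans (le_of_eq ?_) (Finset.single_le_sum
    (f := fun i => coverWalks D m i * nbCount a X i j)
    (fun i _ => mul_nonneg (coverWalks_nonneg hD _ _) (h.nbCount_nonneg _ _))
    (Finset.self_mem_range_succ m))
  rw [coverWalks_self, one_mul]

theorem IsBiregular.pow_nonneg (h : IsBiregular a b D) (n : ℕ) (i j : N) : 0 ≤ (a ^ n) i j := by
  induction n generalizing j with
  | zero => rw [pow_zero, Matrix.one_apply]; split_ifs <;> simp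
  | succ n ih =>
    rw [pow_succ, Matrix.mul_apply]
    exact Finset.sum_nonneg fun l _ => mul_nonneg (ih l) (h.nonneg l j)

theorem IsBiregular.sum_pow (h : IsBiregular a b D) (hX : b X = false) (n : ℕ) :
    ∑ j, (a ^ (2 * n)) X j = (2 * D) ^ n := by
  have key : ∀ n (i : N), b i = false → ∑ j, (a ^ (2 * n)) i j = (2 * D) ^ n := by
    intro n
    induction n with
    | zero => intro i _; simp [Matrix.one_apply]
    | succ n ih =>
      intro i hi
      have h1 : ∀ l, a i l * ∑ l', a l l' * ∑ j, (a ^ (2 * n)) l' j =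
          a i l * (D * (2 * D) ^ n) := by
        intro l
        by_cases hz : a i l = 0
        · simp [hz]
        have hl : b l = true := by rw [h.color i l hz, hi]; rfl
        congr 1
        have h2 : ∀ l', a l l' * ∑ j, (a ^ (2 * n)) l' j = a l l' * (2 * D) ^ n := by
          intro l'
          by_cases hz' : a l l' = 0
          · simp [hz']
          rw [ih l' (by rw [h.color l l' hz', hl]; rfl)]
        rw [Finset.sum_congr rfl fun l' _ => h2 l', ← Finset.sum_mul, h.degree, hl]
        simp
      have h3 : ∑ j, (a ^ (2 * (n + 1))) i j =
          ∑ l, a i l * ∑ l', a l l' * ∑ j, (a ^ (2 * n)) l' j := by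
        rw [show 2 * (n + 1) = 2 * n + 1 + 1 by ring, pow_succ', pow_succ']
        simp only [Matrix.mul_apply, Finset.mul_sum]
        rw [Finset.sum_comm]
        refine Finset.sum_congr rfl fun l _ => ?_
        rw [Finset.sum_comm]
      rw [h3, Finset.sum_congr rfl fun l _ => h1 l, ← Finset.sum_mul, h.degree, hi]
      simp
      ring
  exact key n X hX

end Biregular

/-! ### First exits from a region -/

section FirstExit

variable {N : Type*} [Fintype N] [DecidableEq N] {a : Matrix N N ℝ} {X : N} {b : N → Bool} {D : ℝ}
  {k : ℕ} {out : N → Prop} [DecidablePred out]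

/-- The adjacency matrix with no steps starting in `out`: its powers count the walks that stop at
their first exit. -/
def stopMatrix (a : Matrix N N ℝ) (out : N → Prop) [DecidablePred out] : Matrix N N ℝ :=
  Matrix.of fun i j => if out i then 0 else a i j

theorem IsBiregular.stopMatrix_nonneg (h : IsBiregular a b D) (i j : N) :
    0 ≤ stopMatrix a out i j := by
  simp only [stopMatrix, Matrix.of_apply]
  split_ifs <;> simp [h.nonneg]

theorem IsBiregular.stopMatrix_le (h : IsBiregular a b D) (i j : N) :
    stopMatrix a out i j ≤ a i j := by
  simp only [stopMatrix, Matrix.of_apply]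
  split_ifs <;> simp [h.nonneg]

theorem IsBiregular.stopMatrix_pow (h : IsBiregular a b D) (n : ℕ) (i j : N) :
    0 ≤ (stopMatrix a out ^ n) i j ∧ (stopMatrix a out ^ n) i j ≤ (a ^ n) i j := by
  induction n generalizing j with
  | zero => rw [pow_zero, pow_zero, Matrix.one_apply]; split_ifs <;> simp
  | succ n ih =>
    rw [pow_succ, pow_succ, Matrix.mul_apply, Matrix.mul_apply]
    exact ⟨Finset.sum_nonneg fun l _ => mul_nonneg (ih l).1 (h.stopMatrix_nonneg l j),
      Finset.sum_le_sum fun l _ => mul_le_mul (ih l).2 (h.stopMatrix_le l j)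
        (h.stopMatrix_nonneg l j) (h.pow_nonneg n i l)⟩

theorem IsBiregular.sum_stopMatrix_pow_le (h : IsBiregular a b D) (n : ℕ) :
    ∑ j with out j, (stopMatrix a out ^ n) X j ≤ ∑ j with out j, (a ^ n) X j :=
  Finset.sum_le_sum fun j _ => (h.stopMatrix_pow n X j).2

/-- From a node of degree `D`, three steps that leave the region at the last one only: either the
walk returns to its starting point in between, or it does not. -/
theorem IsBiregular.sum_stopMatrix_cube_le (h : IsBiregular a b D) (hD : 1 ≤ D) {v : N}
    (hv : b v = true) :
    ∑ j with out j, (stopMatrix a out ^ 3) v j ≤ D ^ 2 / 4 + D * (D - 1) := by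
  -- `o w` counts the exits at `w`, and `c` counts the neighbours of `v` inside the region. Walks
  -- that return to `v` number at most `c (D - c) ≤ D² / 4`. For the others, the second node of
  -- degree `D` was entered through an inside node, so it has at most `D - 1` exits; this gives at
  -- most `c (D - 1)` walks.
  set o : N → ℝ := fun w => ∑ j with out j, a w j with ho
  have ho0 : ∀ w, 0 ≤ o w := fun w => Finset.sum_nonneg fun j _ => h.nonneg w j
  set c : ℝ := ∑ e with ¬ out e, a v e with hc
  have hco : o v + c = D := by
    rw [ho, hc, Finset.sum_filter_add_sum_filter_not, h.degree, hv]
    simp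
  have hc0 : 0 ≤ c := Finset.sum_nonneg fun j _ => h.nonneg v j
  have h1 : ∑ j with out j, (stopMatrix a out ^ 3) v j ≤
      ∑ e with ¬ out e, a v e * ∑ w, a e w * o w := by
    have h3 : (stopMatrix a out) ^ 3 = stopMatrix a out * (stopMatrix a out * stopMatrix a out) := by
      rw [pow_succ', pow_two]
    simp only [h3, Matrix.mul_apply]
    rw [Finset.sum_comm, Finset.sum_filter (fun e => ¬ out e)]
    refine Finset.sum_le_sum fun e _ => ?_
    rw [← Finset.mul_sum]
    by_cases he : out e
    · have : ∀ w, stopMatrix a out e w = 0 := fun w => by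
        simp [stopMatrix, he]
      simp [this, he]
    · rw [if_pos he, Finset.sum_comm]
      refine mul_le_mul (h.stopMatrix_le v e) ?_ ?_ (h.nonneg v e)
      · refine Finset.sum_le_sum fun w _ => ?_
        rw [← Finset.mul_sum]
        refine mul_le_mul (h.stopMatrix_le e w) ?_ ?_ (h.nonneg e w)
        · exact Finset.sum_le_sum fun j _ => h.stopMatrix_le w j
        · exact Finset.sum_nonneg fun j _ => h.stopMatrix_nonneg w j
      · exact Finset.sum_nonneg fun w _ => Finset.sum_nonneg fun j _ =>
          mul_nonneg (h.stopMatrix_nonneg e w) (h.stopMatrix_nonneg w j)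
  have h2 : ∀ e ∈ Finset.univ.filter (fun e => ¬ out e),
      a v e * ∑ w, a e w * o w ≤ a v e * (o v + (D - 1)) := by
    intro e he
    have he' : ¬ out e := (Finset.mem_filter.1 he).2
    rcases h.zero_or_one v e with hz | hz
    · simp [hz]
    rw [hz, one_mul, one_mul]
    have hev : a e v = 1 := by rw [h.symm, hz]
    have hbe : b e = false := by rw [h.color v e (by simp [hz]), hv]; rfl
    have hdeg : ∑ w, a e w = 2 := by rw [h.degree, hbe]; simp
    rw [← Finset.add_sum_erase _ _ (Finset.mem_univ v)] at hdeg ⊢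
    rw [hev] at hdeg ⊢
    rw [one_mul]
    gcongr
    calc ∑ w ∈ Finset.univ.erase v, a e w * o w
        ≤ ∑ w ∈ Finset.univ.erase v, a e w * (D - 1) := by
          refine Finset.sum_le_sum fun w _ => ?_
          rcases h.zero_or_one e w with hw | hw
          · simp [hw]
          rw [hw, one_mul, one_mul]
          have hbw : b w = true := by rw [h.color e w (by simp [hw]), hbe]; rfl
          have hdw : o w + ∑ j with ¬ out j, a w j = D := by
            rw [ho, Finset.sum_filter_add_sum_filter_not, h.degree, hbw]
            simp
          have : a w e ≤ ∑ j with ¬ out j, a w j :=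
            Finset.single_le_sum (f := fun j => a w j) (fun j _ => h.nonneg w j) he
          rw [h.symm w e, hw] at this
          linarith
      _ = D - 1 := by
          rw [← Finset.sum_mul]
          have : ∑ w ∈ Finset.univ.erase v, a e w = 1 := by linarith
          rw [this, one_mul]
  refine h1.trans ((Finset.sum_le_sum h2).trans ?_)
  rw [← Finset.sum_mul, ← hc, mul_add]
  have h4 : c ≤ D := by linarith [ho0 v]
  have h5 : o v = D - c := by linarith
  rw [h5]
  nlinarith [sq_nonneg (2 * c - D), mul_le_mul_of_nonneg_right h4 (sub_nonneg.2 hD)]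

/-- This compares the brackets for `k = s + 2`, after dividing by `2 (D - 1) ^ (s + 1)`. The
left-hand terms come from reductions of lengths `2s + 1`, `2s + 3` and `2s + 5`. At `D = 1` the
inequality fails. -/
theorem firstExit_estimate {D : ℝ} (hD : D = 2 ∨ 3 ≤ D) {s : ℝ} (hs : 0 ≤ s) :
    (D - 1) * (D ^ 2 * ((s + 1) * (s + 2) / 2) + (2 * s + 3) * D - s) +
      ((s + 2) * D + 1) * (D ^ 2 / 4 + D * (D - 1)) +
      (D - 1) * (D ^ 2 / 4 + D * (D - 1)) ≤
    (D - 1) * (D ^ 2 * (((s + 2 + 1) ^ 2 + 3) / 2) + D * ((3 * (s + 2) + 2) / 2) + (s + 2)) := by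
  rcases hD with rfl | hD
  · nlinarith
  · obtain ⟨y, rfl⟩ : ∃ y, D = y + 3 := ⟨D - 3, by ring⟩
    have hy : 0 ≤ y := by linarith
    have : 0 ≤ s * y := by positivity
    have : 0 ≤ s * y ^ 2 := by positivity
    have : 0 ≤ s * y ^ 3 := by positivity
    have : 0 ≤ y ^ 2 := by positivity
    have : 0 ≤ y ^ 3 := by positivity
    nlinarith

/-- The walks of length `2k + 4` that first leave the region at their end. -/
theorem IsBiregular.sum_stopMatrix_pow_add_four_le (h : IsBiregular a b D) (hX : b X = false)
    (hD : D = 1 ∨ D = 2 ∨ 3 ≤ D) (hk2 : 2 ≤ k) (hk : ContainsBall a X k out) :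
    ∑ j with out j, (stopMatrix a out ^ (2 * k + 4)) X j ≤
      2 * (D - 1) ^ k * (D ^ 2 * (((k + 1 : ℝ) ^ 2 + 3) / 2) + D * ((3 * k + 2) / 2) + k) := by
  have hD1 : 1 ≤ D := by rcases hD with rfl | rfl | hD <;> linarith
  obtain ⟨s, rfl⟩ := Nat.exists_eq_add_of_le' hk2
  -- `D = 1` is separate because `firstExit_estimate` fails there. The cover then has no nodes at
  -- depth `2` or more, so there are no exits at all.
  rcases hD with rfl | hD
  · refine (h.sum_stopMatrix_pow_le _).trans ((h.sum_exit_le hX le_rfl hk _).trans ?_)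
    have : coverExit (1 : ℝ) (s + 2) (2 * (s + 2) + 4) = 0 := by
      refine Finset.sum_eq_zero fun m hm => ?_
      have hm2 : 2 * (s + 2) ≤ m := (Finset.mem_Ico.1 hm).1
      have hz : sphereSize (1 : ℝ) m = 0 := by
        obtain ⟨r, hr | hr⟩ := Nat.even_or_odd' m
        · obtain ⟨r', rfl⟩ : ∃ r', r = r' + 1 := ⟨r - 1, by omega⟩
          rw [hr, mul_add, mul_one, sphereSize_even]
          simp
        · rw [hr, sphereSize_odd, sub_self, zero_pow (by omega), mul_zero]
      rw [hz, mul_zero]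
    rw [this]
    simp
  -- The last three steps are split off, and the first `2s + 5 = 2k + 1` are relaxed to arbitrary
  -- walks, sorted by the length `m` of their reduction. Below `m = 2s + 1` three steps cannot reach
  -- the outside. At `m = 2s + 1` they can only do so at total depth `2k`, which `hlow` counts. The
  -- lengths `2s + 3` and `2s + 5` are covered by the three-step bound.
  set κ : N → ℝ := fun v => ∑ j with out j, (stopMatrix a out ^ 3) v j with hκ
  have hκ0 : ∀ v, 0 ≤ κ v := fun v => Finset.sum_nonneg fun j _ => (h.stopMatrix_pow 3 v j).1
  have h1 : ∑ j with out j, (stopMatrix a out ^ (2 * (s + 2) + 4)) X j ≤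
      ∑ m ∈ Finset.range (2 * s + 6), coverWalks D (2 * s + 5) m *
        ∑ v, nbCount a X m v * κ v := by
    have h2 : ∑ m ∈ Finset.range (2 * s + 6), coverWalks D (2 * s + 5) m *
        ∑ v, nbCount a X m v * κ v = ∑ v, (a ^ (2 * s + 5)) X v * κ v := by
      simp only [h.pow_apply hX, Finset.mul_sum, Finset.sum_mul]
      rw [Finset.sum_comm]
      simp only [mul_assoc]
    rw [h2, show 2 * (s + 2) + 4 = 2 * s + 5 + 3 by ring, pow_add]
    simp only [Matrix.mul_apply]
    rw [Finset.sum_comm]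
    refine Finset.sum_le_sum fun v _ => ?_
    rw [← Finset.mul_sum]
    exact mul_le_mul_of_nonneg_right (h.stopMatrix_pow _ X v).2 (hκ0 v)
  have hlow : ∀ m, ∑ v, nbCount a X m v * κ v ≤ coverExit D (s + 2) (m + 3) := by
    intro m
    refine le_trans ?_ (h.sum_exit_le hX hD1 hk (m + 3))
    simp only [pow_add, Matrix.mul_apply]
    rw [Finset.sum_comm]
    refine Finset.sum_le_sum fun v _ => ?_
    rw [← Finset.mul_sum]
    refine mul_le_mul (h.nbCount_le_pow hX hD1 m v) ?_ (hκ0 v) (h.pow_nonneg m X v)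
    exact Finset.sum_le_sum fun j _ => (h.stopMatrix_pow 3 v j).2
  have hhigh : ∀ m, m.bodd = true → ∑ v, nbCount a X m v * κ v ≤
      sphereSize D m * (D ^ 2 / 4 + D * (D - 1)) := by
    intro m hm
    rw [← h.sum_nbCount hX, Finset.sum_mul]
    refine Finset.sum_le_sum fun v _ => ?_
    by_cases hz : nbCount a X m v = 0
    · simp [hz]
    · refine mul_le_mul_of_nonneg_left (h.sum_stopMatrix_cube_le hD1 ?_) (h.nbCount_nonneg m v)
      rw [h.color_nb hX hz, hm]
  have hzero : ∑ m ∈ Finset.range (2 * s + 1), coverWalks D (2 * s + 5) m *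
      ∑ v, nbCount a X m v * κ v ≤ 0 := by
    refine Finset.sum_nonpos fun m hm => ?_
    have := hlow m
    rw [coverExit_of_lt D (by have := Finset.mem_range.1 hm; omega)] at this
    exact mul_nonpos_of_nonneg_of_nonpos (coverWalks_nonneg hD1 _ _) this
  refine h1.trans ?_
  rw [Finset.sum_range_succ, Finset.sum_range_succ, Finset.sum_range_succ, Finset.sum_range_succ,
    Finset.sum_range_succ, coverWalks_self,
    coverWalks_of_odd D (n := 2 * s + 5) (m := 2 * s + 4) (by rw [Nat.odd_iff]; omega),
    coverWalks_of_odd D (n := 2 * s + 5) (m := 2 * s + 2) (by rw [Nat.odd_iff]; omega),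
    (coverWalks_add_four D s).2]
  have e1 := (coverWalks_add_two D (s + 1)).2
  rw [show 2 * (s + 1) + 3 = 2 * s + 5 by ring, show 2 * (s + 1) + 1 = 2 * s + 3 by ring] at e1
  rw [e1]
  have i1 := hlow (2 * s + 1)
  rw [show 2 * s + 1 + 3 = 2 * (s + 2) by ring, coverExit_two_mul D (by omega)] at i1
  have i2 := hhigh (2 * s + 3) (by simp)
  rw [show sphereSize D (2 * s + 3) = 2 * (D - 1) ^ (s + 1) from sphereSize_odd D (s + 1)] at i2
  have i3 := hhigh (2 * s + 5) (by simp)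
  rw [show sphereSize D (2 * s + 5) = 2 * (D - 1) ^ (s + 2) from sphereSize_odd D (s + 2)] at i3
  have hs0 : (0 : ℝ) ≤ s := by positivity
  have hA : 0 ≤ D ^ 2 * (((s : ℝ) + 1) * (s + 2) / 2) + (2 * s + 3) * D - s := by
    nlinarith [sq_nonneg D, mul_nonneg hs0 (sub_nonneg.2 hD1),
      mul_nonneg (sq_nonneg D) (by positivity : 0 ≤ ((s : ℝ) + 1) * (s + 2) / 2)]
  have j1 := mul_le_mul_of_nonneg_left i1 hA
  have j2 := mul_le_mul_of_nonneg_left i2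
    (by positivity : 0 ≤ (((s + 1 : ℕ) : ℝ) + 1) * D + 1)
  have hfin := mul_le_mul_of_nonneg_left (firstExit_estimate hD hs0)
    (by have := sub_nonneg.2 hD1; positivity : 0 ≤ 2 * (D - 1) ^ (s + 1))
  push_cast at j1 j2 hfin ⊢
  have p1 : (D - 1) ^ (s + 2) = (D - 1) ^ (s + 1) * (D - 1) := pow_succ _ _
  rw [p1] at j1 i3 ⊢
  have q1 : ((s : ℝ) + 1 + 1) = s + 2 := by ring
  rw [q1] at j2 ⊢
  linarith

end FirstExit

/-! ### Balls around an edge -/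

section Balls

variable {V : Type u} {G : SimpleGraph V} {a b : V}

/-- A walk can be shortened to a path with the same ends, so for vertices the ball is determined by
distance alone. -/
theorem mem_ball_verts {s : ℕ} {v : V} : v ∈ (ball G a b s).verts ↔
    ∃ x, (x = a ∨ x = b) ∧ ∃ w : G.Walk x v, w.length ≤ s := by
  classical
  constructor
  · rintro ⟨x, y, w, hx, -, hl, hv⟩
    exact ⟨x, hx, w.takeUntil v hv, (w.length_takeUntil_le_length hv).trans hl⟩
  · rintro ⟨x, hx, w, hl⟩
    exact ⟨x, v, w.bypass, hx, w.bypass_isPath, w.length_bypass_le_length.trans hl, by simp⟩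

theorem ball_verts_mono {s s' : ℕ} (h : s ≤ s') :
    (ball G a b s).verts ⊆ (ball G a b s').verts := by
  rintro v ⟨x, y, w, hx, hp, hl, hv⟩
  exact ⟨x, y, w, hx, hp, hl.trans h, hv⟩

theorem ball_adj_mono {s s' : ℕ} (h : s ≤ s') {u v : V} (huv : (ball G a b s).Adj u v) :
    (ball G a b s').Adj u v := by
  obtain ⟨x, y, w, hx, hp, hl, hv⟩ := huv
  exact ⟨x, y, w, hx, hp, hl.trans h, hv⟩

theorem mem_ball_verts_zero {v : V} : v ∈ (ball G a b 0).verts ↔ v = a ∨ v = b := by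
  rw [mem_ball_verts]
  constructor
  · rintro ⟨x, hx, w, hw⟩
    have := SimpleGraph.Walk.eq_of_length_eq_zero (Nat.le_zero.1 hw)
    rwa [← this]
  · intro h
    exact ⟨v, h, SimpleGraph.Walk.nil, le_rfl⟩

theorem mem_ball_verts_of_adj {s : ℕ} {u v : V} (hu : u ∈ (ball G a b s).verts)
    (h : G.Adj u v) : v ∈ (ball G a b (s + 1)).verts := by
  rw [mem_ball_verts] at hu ⊢
  obtain ⟨x, hx, w, hw⟩ := hu
  exact ⟨x, hx, w.concat h, by simpa using hw⟩

theorem mem_ball_verts_succ {s : ℕ} {v : V} (hv : v ∈ (ball G a b (s + 1)).verts) :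
    v ∈ (ball G a b s).verts ∨ ∃ u ∈ (ball G a b s).verts, G.Adj u v := by
  simp only [mem_ball_verts] at hv ⊢
  obtain ⟨x, hx, w, hw⟩ := hv
  induction w using SimpleGraph.Walk.concatRec with
  | Hnil => exact Or.inl ⟨_, hx, SimpleGraph.Walk.nil, by simp⟩
  | Hconcat p h _ =>
    exact Or.inr ⟨_, ⟨_, hx, p, by simpa using hw⟩, h⟩

theorem exists_walk_of_mem_edges {x y u v : V} (w : G.Walk x y) (h : s(u, v) ∈ w.edges) :
    (∃ p : G.Walk x u, p.length + 1 ≤ w.length) ∨ ∃ p : G.Walk x v, p.length + 1 ≤ w.length := by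
  induction w with
  | nil => simp at h
  | @cons x z y hxz p ih =>
    rw [SimpleGraph.Walk.edges_cons, List.mem_cons] at h
    rcases h with h | h
    · rcases Sym2.eq_iff.1 h with ⟨rfl, -⟩ | ⟨-, rfl⟩
      · exact Or.inl ⟨SimpleGraph.Walk.nil, by simp⟩
      · exact Or.inr ⟨SimpleGraph.Walk.nil, by simp⟩
    · rcases ih h with ⟨r, hr⟩ | ⟨r, hr⟩
      · exact Or.inl ⟨SimpleGraph.Walk.cons hxz r, by simpa using hr⟩
      · exact Or.inr ⟨SimpleGraph.Walk.cons hxz r, by simpa using hr⟩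

theorem mem_ball_verts_of_ball_adj {s : ℕ} {u v : V} (h : (ball G a b (s + 1)).Adj u v) :
    u ∈ (ball G a b s).verts ∨ v ∈ (ball G a b s).verts := by
  obtain ⟨x, y, w, hx, hp, hl, hv⟩ := h
  rcases exists_walk_of_mem_edges w hv with ⟨p, hp⟩ | ⟨p, hp⟩
  · exact Or.inl (mem_ball_verts.2 ⟨x, hx, p, by omega⟩)
  · exact Or.inr (mem_ball_verts.2 ⟨x, hx, p, by omega⟩)

/-- A short path to `u` can be prolonged by the edge unless it already visits `v`. In that case it
is cut at `v` and prolonged from `v` to `u`. Either way the edge lies on a path of length at most `s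
+ 1`. -/
theorem ball_adj_of_mem {s : ℕ} {u v : V} (hu : u ∈ (ball G a b s).verts) (h : G.Adj u v) :
    (ball G a b (s + 1)).Adj u v := by
  classical
  obtain ⟨x, hx, w, hw⟩ := mem_ball_verts.1 hu
  have hp := w.bypass_isPath
  have hl := w.length_bypass_le_length.trans hw
  by_cases hv : v ∈ w.bypass.support
  · have hnot := SimpleGraph.Walk.endpoint_notMem_support_takeUntil hp hv h.ne
    refine ⟨x, u, (w.bypass.takeUntil v hv).concat h.symm, hx,
      (hp.takeUntil hv).concat hnot h.symm, ?_, ?_⟩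
    · have := w.bypass.length_takeUntil_le_length hv
      rw [SimpleGraph.Walk.length_concat]
      omega
    · simp [SimpleGraph.Walk.edges_concat, Sym2.eq_swap]
  · refine ⟨x, v, w.bypass.concat h, hx, hp.concat hv h, ?_, ?_⟩
    · rw [SimpleGraph.Walk.length_concat]
      omega
    · simp [SimpleGraph.Walk.edges_concat]

theorem ball_adj_endpoints (hab : G.Adj a b) {q : ℕ} (hq : 1 ≤ q) : (ball G a b q).Adj a b :=
  ball_adj_mono hq (ball_adj_of_mem (left_mem_ball G a b 0) hab)

theorem mem_ball_verts_of_mem_edge {s : ℕ} {e : Sym2 V} (he : e ∈ (ball G a b s).edgeSet) {v : V}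
    (hv : v ∈ e) : v ∈ (ball G a b s).verts := by
  obtain ⟨w, rfl⟩ := hv
  exact (ball G a b s).edge_vert (SimpleGraph.Subgraph.mem_edgeSet.1 he)

/-- Off an edge with an endpoint outside the ball of radius `s`, all points of this ball are
connected. -/
theorem reachable_of_mem_ball (hab : G.Adj a b) {Q s : ℕ} (hs : s ≤ Q) (hQ : 1 ≤ Q)
    (e : Sym2 (ball G a b Q).verts) (he : ∃ v ∈ e, (v : V) ∉ (ball G a b s).verts)
    {x : V} (hx : x ∈ (ball G a b s).verts) :
    ((ball G a b Q).coe.deleteEdges {e}).Reachable ⟨x, ball_verts_mono hs hx⟩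
      (ballLeft G a b Q) := by
  induction s generalizing x with
  | zero =>
    rcases mem_ball_verts_zero.1 hx with rfl | rfl
    · exact SimpleGraph.Reachable.refl _
    · refine SimpleGraph.Adj.reachable ?_
      rw [SimpleGraph.deleteEdges_adj]
      refine ⟨(ball_adj_endpoints hab hQ).symm, ?_⟩
      rintro rfl
      obtain ⟨v, hv, hv'⟩ := he
      rcases Sym2.mem_iff.1 hv with rfl | rfl
      · exact hv' hx
      · exact hv' (left_mem_ball _ _ _ _)
  | succ s ih =>
    obtain ⟨v, hv, hv'⟩ := he
    have he' : ∃ v ∈ e, (v : V) ∉ (ball G a b s).verts :=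
      ⟨v, hv, fun h => hv' (ball_verts_mono (by omega) h)⟩
    rcases mem_ball_verts_succ hx with h | ⟨u, hu, hux⟩
    · exact ih (by omega) he' h
    · refine SimpleGraph.Reachable.trans (SimpleGraph.Adj.reachable ?_) (ih (by omega) he' hu)
      rw [SimpleGraph.deleteEdges_adj]
      refine ⟨(ball_adj_mono hs (ball_adj_of_mem hu hux)).symm, ?_⟩
      rintro rfl
      rcases Sym2.mem_iff.1 hv with rfl | rfl
      · exact hv' hx
      · exact hv' (ball_verts_mono (by omega) hu)

/-- In an acyclic ball a vertex on the sphere of radius `s + 1` has only one neighbour in the ball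
of radius `s + 1`. -/
theorem notMem_ball_of_isAcyclic (hab : G.Adj a b) {Q s : ℕ} (hsQ : s + 2 ≤ Q)
    (hac : (ball G a b Q).coe.IsAcyclic) {u v w : V} (hu : u ∈ (ball G a b s).verts)
    (hv : v ∉ (ball G a b s).verts) (huv : G.Adj u v) (hvw : G.Adj v w) (huw : u ≠ w) :
    w ∉ (ball G a b (s + 1)).verts := by
  intro hw
  have hv1 : v ∈ (ball G a b (s + 1)).verts := mem_ball_verts_of_adj hu huv
  have hadj : (ball G a b Q).Adj v w := ball_adj_mono hsQ (ball_adj_of_mem hv1 hvw)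
  have hvQ := (ball G a b Q).edge_vert hadj
  have hwQ := (ball G a b Q).edge_vert hadj.symm
  set v' : (ball G a b Q).verts := ⟨v, hvQ⟩
  set w' : (ball G a b Q).verts := ⟨w, hwQ⟩
  have hmem : ∃ x ∈ s(v', w'), (x : V) ∉ (ball G a b s).verts := ⟨v', by simp, hv⟩
  have hreach : ∀ {x : V} (hx : x ∈ (ball G a b s).verts),
      ((ball G a b Q).coe.deleteEdges {s(v', w')}).Reachable
        ⟨x, ball_verts_mono (by omega) hx⟩ (ballLeft G a b Q) := fun hx =>
    reachable_of_mem_ball hab (by omega) (by omega) _ hmem hx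
  -- Acyclicity makes `vw` a bridge. The route from `v` through `u` and `a` to `w`, which stays
  -- closer to the centre, avoids that edge: a contradiction.
  have hbr : (ball G a b Q).coe.IsBridge s(v', w') :=
    SimpleGraph.isAcyclic_iff_forall_adj_isBridge.1 hac hadj
  rw [SimpleGraph.isBridge_iff] at hbr
  refine hbr (SimpleGraph.Reachable.trans (SimpleGraph.Reachable.trans
    (SimpleGraph.Adj.reachable (v := ⟨u, ball_verts_mono (by omega) hu⟩) ?_) (hreach hu)) ?_)
  · rw [SimpleGraph.deleteEdges_adj]
    refine ⟨(ball_adj_mono (by omega) (ball_adj_of_mem hu huv)).symm, ?_⟩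
    intro h
    rcases Sym2.eq_iff.1 h with ⟨-, h⟩ | ⟨h, -⟩
    · exact huw (congrArg Subtype.val h)
    · exact hvw.ne (congrArg Subtype.val h)
  · rcases mem_ball_verts_succ hw with h | ⟨u', hu', huw'⟩
    · exact (hreach h).symm
    · refine SimpleGraph.Reachable.trans (hreach hu').symm (SimpleGraph.Adj.reachable ?_)
      rw [SimpleGraph.deleteEdges_adj]
      refine ⟨ball_adj_mono (by omega) (ball_adj_of_mem hu' huw'), ?_⟩
      intro h
      rcases Sym2.eq_iff.1 h with ⟨h, -⟩ | ⟨h, -⟩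
      · have hvu : u' = v := congrArg Subtype.val h
        exact hv (hvu ▸ hu')
      · exact huw'.ne (congrArg Subtype.val h)

end Balls

/-! ### Paths in the commutativity graph of a regular graph -/

section RegularGraph

set_option linter.unusedSectionVars false

variable {V : Type u} [Fintype V] [DecidableEq V] {G : SimpleGraph V} [Fintype G.edgeSet]

theorem sum_incMatrix_inl [G.LocallyFinite] {d : ℕ} (hreg : G.IsRegularOfDegree d) (v : V) :
    ∑ j, incMatrix G (Sum.inl v) j = d := by
  classical
  have h1 : ∑ j, incMatrix G (Sum.inl v) j =
      ((Finset.univ.filter fun e : G.edgeSet => v ∈ (e : Sym2 V)).card : ℝ) := by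
    rw [Fintype.sum_sum_type, Finset.card_filter]
    simp [incMatrix]
  rw [h1, ← hreg v, ← G.card_incidenceSet_eq_degree, Nat.cast_inj, ← Fintype.card_coe]
  refine Fintype.card_congr ⟨fun e => ⟨e.1.1, e.1.2, (Finset.mem_filter.1 e.2).2⟩,
    fun e => ⟨⟨e.1, e.2.1⟩, Finset.mem_filter.2 ⟨Finset.mem_univ _, e.2.2⟩⟩,
    fun _ => rfl, fun _ => rfl⟩

theorem sum_incMatrix_inr (e : G.edgeSet) : ∑ j, incMatrix G (Sum.inr e) j = 2 := by
  classical
  have h1 : ∑ j, incMatrix G (Sum.inr e) j =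
      ((Finset.univ.filter fun v : V => v ∈ (e : Sym2 V)).card : ℝ) := by
    rw [Fintype.sum_sum_type, Finset.card_filter]
    simp [incMatrix]
  rw [h1]
  obtain ⟨e, he⟩ := e
  induction e with | _ a b
  have hne : a ≠ b := (show G.Adj a b from he).ne
  have : (Finset.univ.filter fun v : V => v ∈ s(a, b)) = {a, b} := by
    ext v; simp
  rw [this, Finset.card_pair hne]
  norm_num

theorem isBiregular_incMatrix [G.LocallyFinite] {d : ℕ} (hreg : G.IsRegularOfDegree d) :
    IsBiregular (incMatrix G) Sum.isLeft (d : ℝ) where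
  zero_or_one i j := by
    classical
    rw [incMatrix_apply G one_ne_zero]
    split_ifs <;> simp
  symm i j := by
    classical
    rw [incMatrix_apply G one_ne_zero, incMatrix_apply G one_ne_zero, SimpleGraph.adj_comm]
  color i j h := isLeft_of_incMatrix_ne_zero h
  degree i := by
    rcases i with v | e
    · simpa using sum_incMatrix_inl hreg v
    · simpa using sum_incMatrix_inr e

theorem numPaths_eq {α : ℝ} (hα : α ≠ 0) (X : G.edgeSet) (n : ℕ) (j : V ⊕ G.edgeSet) :
    (numPaths G α X n j : ℝ) = (incMatrix G ^ n) (Sum.inr X) j := by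
  classical
  have h : incMatrix G = (commGraph G α).adjMatrix ℝ := by
    ext i j
    rw [incMatrix_apply G hα, SimpleGraph.adjMatrix_apply]
  rw [h, SimpleGraph.adjMatrix_pow_apply_eq_card_walk, numPaths, ← Nat.card_coe_set_eq,
    Nat.card_eq_fintype_card]

theorem numExit_eq {α : ℝ} (hα : α ≠ 0) {a b : V} (hab : G.Adj a b) (q n : ℕ)
    [DecidablePred (IsOutside G a b q)] :
    (numExit G α hab q n : ℝ) = ∑ j with IsOutside G a b q j,
      (incMatrix G ^ n) (Sum.inr ⟨s(a, b), hab⟩) j := by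
  rw [numExit, Nat.cast_sum]
  simp only [← numPaths_eq hα]
  congr!

theorem exists_eq_of_mem_edge (e : G.edgeSet) {v : V} (hv : v ∈ (e : Sym2 V)) :
    ∃ w, (e : Sym2 V) = s(v, w) ∧ G.Adj v w := by
  obtain ⟨w, hw⟩ := hv
  refine ⟨w, hw, ?_⟩
  have := e.2
  rwa [hw] at this

theorem mem_of_incMatrix_ne_zero {v : V} {e : G.edgeSet}
    (h : incMatrix G (Sum.inl v) (Sum.inr e) ≠ 0) : v ∈ (e : Sym2 V) := by
  by_contra hv
  exact h (by simp [incMatrix, hv])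

theorem mem_of_incMatrix_ne_zero' {v : V} {e : G.edgeSet}
    (h : incMatrix G (Sum.inr e) (Sum.inl v) ≠ 0) : v ∈ (e : Sym2 V) := by
  by_contra hv
  exact h (by simp [incMatrix, hv])

variable {a b : V} {d : ℕ}

/-- The nodes that non-backtracking walks of length `m` can reach. -/
theorem mem_ball_of_nbCount_ne_zero [G.LocallyFinite] (hreg : G.IsRegularOfDegree d)
    (hab : G.Adj a b) (m : ℕ) :
    (∀ v : V, nbCount (incMatrix G) (Sum.inr ⟨s(a, b), hab⟩) m (Sum.inl v) ≠ 0 →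
      v ∈ (ball G a b (m / 2)).verts) ∧
    (∀ e : G.edgeSet, nbCount (incMatrix G) (Sum.inr ⟨s(a, b), hab⟩) m (Sum.inr e) ≠ 0 →
      (e : Sym2 V) = s(a, b) ∨ (e : Sym2 V) ∈ (ball G a b (m / 2)).edgeSet) := by
  have hB := isBiregular_incMatrix hreg
  set X : V ⊕ G.edgeSet := Sum.inr ⟨s(a, b), hab⟩ with hX
  have hXb : X.isLeft = false := rfl
  induction m with
  | zero =>
    constructor
    · intro v hv
      simp [nbCount, hX] at hv
    · intro e he
      have : Sum.inr e = X := by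
        by_contra h
        exact he (by simp [nbCount, h])
      exact Or.inl (congrArg Subtype.val (Sum.inr.inj this))
  | succ m ih =>
    have hstep : ∀ j, nbCount (incMatrix G) X (m + 1) j ≠ 0 → ∃ i,
        nbCount (incMatrix G) X m i ≠ 0 ∧ incMatrix G i j ≠ 0 := by
      intro j hj
      obtain ⟨i, hi⟩ := exists_dartCount_of_nbCount_ne_zero hj
      refine ⟨i, fun h0 => hi ?_, adj_of_dartCount_ne_zero hi⟩
      have h1 := hB.sum_dartCount hXb m i
      rw [h0, mul_zero] at h1
      exact (Finset.sum_eq_zero_iff_of_nonneg fun j _ => hB.dartCount_nonneg m i j).1 h1 j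
        (Finset.mem_univ j)
    constructor
    · intro v hv
      obtain ⟨i, hi, hadj⟩ := hstep _ hv
      rcases i with w | e
      · simp [incMatrix] at hadj
      have hve := mem_of_incMatrix_ne_zero' hadj
      have hm : m / 2 ≤ (m + 1) / 2 := by omega
      rcases ih.2 e hi with h | h
      · rw [h] at hve
        exact ball_verts_mono (Nat.zero_le _) (mem_ball_verts_zero.2 (Sym2.mem_iff.1 hve))
      · exact ball_verts_mono hm (mem_ball_verts_of_mem_edge h hve)
    · intro e he
      obtain ⟨i, hi, hadj⟩ := hstep _ he
      rcases i with v | f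
      -- The walk stands at a vertex, so `m` is odd and the radius grows by one at this step.
      · have hm : (m + 1) / 2 = m / 2 + 1 := by
          have h1 := hB.color_nb hXb hi
          have h2 := Nat.mod_two_of_bodd m
          rw [← h1] at h2
          simp at h2
          omega
        obtain ⟨w, hw, hvw⟩ := exists_eq_of_mem_edge e (mem_of_incMatrix_ne_zero hadj)
        right
        rw [hw, hm]
        exact ball_adj_of_mem (ih.1 v hi) hvw
      · simp [incMatrix] at hadj

/-- Fewer than `2(q + 1)` steps reach radius at most `q`. The start `X` itself is an edge of the
ball because `q ≥ 1`; the ball of radius `0` has no edges. -/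
theorem containsBall_incMatrix [G.LocallyFinite] (hreg : G.IsRegularOfDegree d)
    (hab : G.Adj a b) {q : ℕ} (hq : 1 ≤ q) :
    ContainsBall (incMatrix G) (Sum.inr ⟨s(a, b), hab⟩) (q + 1) (IsOutside G a b q) := by
  intro m hm j hj
  have hle : m / 2 ≤ q := by omega
  obtain ⟨h1, h2⟩ := mem_ball_of_nbCount_ne_zero hreg hab m
  by_contra hne
  rcases j with v | e
  · exact hj (ball_verts_mono hle (h1 v hne))
  · rcases h2 e hne with h | h
    · exact hj (h ▸ ball_adj_endpoints hab hq)
    · obtain ⟨e, he⟩ := e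
      induction e with | _ x y
      exact hj (ball_adj_mono hle h)

/-- The step `e → v` of a non-backtracking walk arrives at the sphere of radius `s`, coming from
the inside. -/
def ArrivesAt (G : SimpleGraph V) (a b : V) (s : ℕ) (e : G.edgeSet) (v : V) : Prop :=
  v ∈ (ball G a b s).verts ∧ (∀ s' < s, v ∉ (ball G a b s').verts) ∧
    ∃ u, (e : Sym2 V) = s(u, v) ∧ ((s = 0 ∧ (e : Sym2 V) = s(a, b)) ∨
      ∃ s', s = s' + 1 ∧ u ∈ (ball G a b s').verts)

/-- The step `v → e` of a non-backtracking walk leaves the ball of radius `s`. -/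
def DepartsFrom (G : SimpleGraph V) (a b : V) (s : ℕ) (v : V) (e : G.edgeSet) : Prop :=
  v ∈ (ball G a b s).verts ∧ (∀ s' < s, v ∉ (ball G a b s').verts) ∧
    ∃ w, (e : Sym2 V) = s(v, w) ∧ w ∉ (ball G a b s).verts

/-- At radius `0`, the only edge joining the two endpoints is `X` itself. At larger radius, a new
step along the sphere or back inside would close a cycle in the ball. -/
theorem departsFrom_of_arrivesAt (hab : G.Adj a b) {Q s : ℕ} (hs : s + 1 ≤ Q)
    (hac : (ball G a b Q).coe.IsAcyclic) {e f : G.edgeSet} {v : V} (h : ArrivesAt G a b s e v)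
    (hvf : v ∈ (f : Sym2 V)) (hne : e ≠ f) : DepartsFrom G a b s v f := by
  obtain ⟨hv, hv', u, hu, hcase⟩ := h
  obtain ⟨w, hw, hvw⟩ := exists_eq_of_mem_edge f hvf
  refine ⟨hv, hv', w, hw, ?_⟩
  rcases hcase with ⟨rfl, he⟩ | ⟨s', rfl, hus⟩
  · intro hw0
    refine hne (Subtype.ext ?_)
    rw [he, hw]
    rcases mem_ball_verts_zero.1 hv with rfl | rfl <;>
      rcases mem_ball_verts_zero.1 hw0 with rfl | rfl
    · exact absurd rfl hvw.ne
    · rfl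
    · exact Sym2.eq_swap
    · exact absurd rfl hvw.ne
  · have huv : G.Adj u v := by
      have := e.2
      rwa [hu] at this
    refine notMem_ball_of_isAcyclic hab hs hac hus (hv' s' (by omega)) huv hvw ?_
    rintro rfl
    refine hne (Subtype.ext ?_)
    rw [hu, hw, Sym2.eq_swap]

theorem arrivesAt_of_departsFrom {s : ℕ} {e : G.edgeSet} {v w : V}
    (h : DepartsFrom G a b s v e) (hwe : w ∈ (e : Sym2 V)) (hne : v ≠ w) :
    ArrivesAt G a b (s + 1) e w := by
  obtain ⟨hv, -, w', hw', hout⟩ := h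
  have hvw : G.Adj v w' := by
    have := e.2
    rwa [hw'] at this
  obtain rfl : w = w' := by
    rw [hw', Sym2.mem_iff] at hwe
    exact hwe.resolve_left (Ne.symm hne)
  refine ⟨mem_ball_verts_of_adj hv hvw, fun s' hs' hmem => hout ?_, v, hw', Or.inr ⟨s, rfl, hv⟩⟩
  exact ball_verts_mono (by omega) hmem

/-- In an acyclic ball, non-backtracking walks move away from the initial edge. -/
theorem dartCount_of_isAcyclic (hab : G.Adj a b) {Q : ℕ}
    (hac : (ball G a b Q).coe.IsAcyclic) (s : ℕ) :
    (s ≤ Q → ∀ (e : G.edgeSet) (v : V),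
      dartCount (incMatrix G) (Sum.inr ⟨s(a, b), hab⟩) (2 * s) (Sum.inr e) (Sum.inl v) ≠ 0 →
      ArrivesAt G a b s e v) ∧
    (s + 1 ≤ Q → ∀ (v : V) (e : G.edgeSet),
      dartCount (incMatrix G) (Sum.inr ⟨s(a, b), hab⟩) (2 * s + 1) (Sum.inl v) (Sum.inr e) ≠ 0 →
      DepartsFrom G a b s v e) := by
  have hdep : ∀ s, (∀ (e : G.edgeSet) (v : V),
      dartCount (incMatrix G) (Sum.inr ⟨s(a, b), hab⟩) (2 * s) (Sum.inr e) (Sum.inl v) ≠ 0 →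
      ArrivesAt G a b s e v) → s + 1 ≤ Q → ∀ (v : V) (e : G.edgeSet),
      dartCount (incMatrix G) (Sum.inr ⟨s(a, b), hab⟩) (2 * s + 1) (Sum.inl v) (Sum.inr e) ≠ 0 →
      DepartsFrom G a b s v e := by
    intro s harr hs v f hne
    obtain ⟨l, hl, hl'⟩ := exists_dartCount_ne_zero hne
    rcases l with w | e
    · exact absurd (adj_of_dartCount_ne_zero hl') (by simp [incMatrix])
    · exact departsFrom_of_arrivesAt hab hs hac (harr e v hl')
        (mem_of_incMatrix_ne_zero (adj_of_dartCount_ne_zero hne)) fun h => hl (by rw [h])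
  induction s with
  | zero =>
    have h0 : ∀ (e : G.edgeSet) (v : V),
        dartCount (incMatrix G) (Sum.inr ⟨s(a, b), hab⟩) (2 * 0) (Sum.inr e) (Sum.inl v) ≠ 0 →
        ArrivesAt G a b 0 e v := by
      intro e v hne
      have hadj := adj_of_dartCount_ne_zero hne
      have he : e = ⟨s(a, b), hab⟩ := by
        by_contra h
        exact hne (by simp [dartCount, h])
      have hve := mem_of_incMatrix_ne_zero' hadj
      obtain ⟨u, hu, -⟩ := exists_eq_of_mem_edge e hve
      refine ⟨?_, by simp, u, by rw [hu, Sym2.eq_swap], Or.inl ⟨rfl, by rw [he]⟩⟩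
      rw [he] at hve
      exact mem_ball_verts_zero.2 (Sym2.mem_iff.1 hve)
    exact ⟨fun _ => h0, hdep 0 h0⟩
  | succ s ih =>
    have h1 : s + 1 ≤ Q → ∀ (e : G.edgeSet) (v : V),
        dartCount (incMatrix G) (Sum.inr ⟨s(a, b), hab⟩) (2 * (s + 1)) (Sum.inr e) (Sum.inl v) ≠ 0 →
        ArrivesAt G a b (s + 1) e v := by
      intro hs e w hne
      have hadj := adj_of_dartCount_ne_zero hne
      obtain ⟨l, hl, hl'⟩ := exists_dartCount_ne_zero (m := 2 * s + 1) hne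
      rcases l with v | f
      · exact arrivesAt_of_departsFrom (ih.2 hs v e hl') (mem_of_incMatrix_ne_zero' hadj)
          fun h => hl (by rw [h])
      · exact absurd (adj_of_dartCount_ne_zero hl') (by simp [incMatrix])
    exact ⟨h1, fun hs => hdep (s + 1) (h1 (by omega)) hs⟩

/-- The last step decides. If it ends at a vertex, this vertex is at distance at least `q + 1`. If
it ends at an edge, this edge leaves a sphere of radius at least `q`, so neither endpoint is in the
ball of radius `q - 1`, whereas an edge of `B_q` needs one there. -/
theorem isOutside_of_nbCount_ne_zero [G.LocallyFinite] (hreg : G.IsRegularOfDegree d)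
    (hab : G.Adj a b) {q Q : ℕ} (hac : (ball G a b Q).coe.IsAcyclic) {m : ℕ}
    (hm : 2 * (q + 1) ≤ m) (hmQ : m ≤ 2 * Q + 1) {j : V ⊕ G.edgeSet}
    (hj : nbCount (incMatrix G) (Sum.inr ⟨s(a, b), hab⟩) m j ≠ 0) : IsOutside G a b q j := by
  have hB := isBiregular_incMatrix hreg
  obtain ⟨m, rfl⟩ : ∃ m', m = m' + 1 := ⟨m - 1, by omega⟩
  obtain ⟨i, hi⟩ := exists_dartCount_of_nbCount_ne_zero hj
  have hadj := adj_of_dartCount_ne_zero hi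
  have hcol := hB.color_dart (b := Sum.isLeft) rfl hi
  have hm2 := Nat.mod_two_of_bodd m
  rcases i with v | e
  · rcases j with w | e
    · exact absurd hadj (by simp [incMatrix])
    rw [← hcol] at hm2
    obtain ⟨s, rfl⟩ : ∃ s, m = 2 * s + 1 := ⟨m / 2, by simp at hm2; omega⟩
    obtain ⟨-, hv, w, hw, hout⟩ := (dartCount_of_isAcyclic hab hac s).2 (by omega) v e hi
    intro he
    rw [hw, SimpleGraph.Subgraph.mem_edgeSet] at he
    cases q with
    | zero =>
      obtain ⟨x, y, p, -, -, hp, hmem⟩ := he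
      have := SimpleGraph.Walk.length_edges p
      rw [Nat.le_zero.1 hp] at this
      rw [List.length_eq_zero_iff.1 this] at hmem
      simp at hmem
    | succ q =>
      rcases mem_ball_verts_of_ball_adj he with h | h
      · exact hv q (by omega) h
      · exact hout (ball_verts_mono (by omega) h)
  · rcases j with v | f
    · rw [← hcol] at hm2
      obtain ⟨s, rfl⟩ : ∃ s, m = 2 * s := ⟨m / 2, by simp at hm2; omega⟩
      obtain ⟨-, hv, -⟩ := (dartCount_of_isAcyclic hab hac s).1 (by omega) e v hi
      exact hv q (by omega)
    · exact absurd hadj (by simp [incMatrix])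

/-! ### The path counts -/

theorem one_le_of_isRegularOfDegree [G.LocallyFinite] (hreg : G.IsRegularOfDegree d)
    (hab : G.Adj a b) : 1 ≤ d := by
  rw [← hreg a]
  exact (G.degree_pos_iff_exists_adj a).2 ⟨b, hab⟩

theorem numExit_le_coverExit [G.LocallyFinite] (hreg : G.IsRegularOfDegree d) (hab : G.Adj a b)
    {α : ℝ} (hα : α ≠ 0) {q : ℕ} (hq : 1 ≤ q) (n : ℕ) :
    (numExit G α hab q n : ℝ) ≤ coverExit d (q + 1) n := by
  classical
  rw [numExit_eq hα]
  exact (isBiregular_incMatrix hreg).sum_exit_le rfl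
    (by exact_mod_cast one_le_of_isRegularOfDegree hreg hab) (containsBall_incMatrix hreg hab hq) n

theorem numExit_eq_coverExit [G.LocallyFinite] (hreg : G.IsRegularOfDegree d) (hab : G.Adj a b)
    {α : ℝ} (hα : α ≠ 0) {q Q : ℕ} (hq : 1 ≤ q) (hac : (ball G a b Q).coe.IsAcyclic)
    {n : ℕ} (hn : n ≤ 2 * Q + 1) :
    (numExit G α hab q n : ℝ) = coverExit d (q + 1) n := by
  classical
  rw [numExit_eq hα]
  exact (isBiregular_incMatrix hreg).sum_exit_eq_coverExit rfl
    (containsBall_incMatrix hreg hab hq) fun m hm hmn j hj =>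
      isOutside_of_nbCount_ne_zero hreg hab hac hm (hmn.trans hn) hj

theorem coverExit_eq_treeCount {d k : ℕ} (hd : 1 ≤ d) (hk : 1 ≤ k) (r : Fin 4) :
    coverExit d k (2 * k + r) = treeCount d k r := by
  have h : ((d - 1 : ℕ) : ℝ) = (d : ℝ) - 1 := by push_cast [hd]; rfl
  fin_cases r
  · simpa [treeCount, h] using coverExit_two_mul d hk
  · simpa [treeCount, h] using coverExit_add_one d k
  · simpa [treeCount, h] using coverExit_add_two d hk
  · simpa [treeCount, h] using coverExit_add_three d k

theorem finsum_numPaths [G.LocallyFinite] (hreg : G.IsRegularOfDegree d) (hab : G.Adj a b)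
    {α : ℝ} (hα : α ≠ 0) (n : ℕ) :
    ∑ᶠ j, numPaths G α ⟨s(a, b), hab⟩ (2 * n) j = (2 * d) ^ n := by
  rw [finsum_eq_sum_of_fintype]
  have h := (isBiregular_incMatrix hreg).sum_pow (X := Sum.inr ⟨s(a, b), hab⟩) rfl n
  simp only [← numPaths_eq hα] at h
  exact_mod_cast h

end RegularGraph

/-! ### Operators on a subset of the qubits -/

section Extend

set_option linter.unusedSectionVars false

variable {V : Type u} [Fintype V] [DecidableEq V]

open Classical in
/-- The splitting of a configuration into its restrictions to `S` and to the complement. -/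
noncomputable def splitConfig (S : Set V) :
    (V → Fin 2) ≃ ((S → Fin 2) × ({v // v ∉ S} → Fin 2)) :=
  Equiv.piEquivPiSubtypeProd (· ∈ S) fun _ => Fin 2

open Classical in
/-- `B ↦ B ⊗ 1`, from the operators on the qubits of `S` to those on all qubits. -/
noncomputable def extendOp (S : Set V) [Fintype S] [DecidableEq S] : Op S →ₐ[ℂ] Op V :=
  AlgHom.ofLinearMap
    { toFun := fun B => (Matrix.kronecker B (1 : Matrix ({v // v ∉ S} → Fin 2) _ ℂ)).submatrix
        (splitConfig S) (splitConfig S)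
      map_add' := fun B C => by
        ext x y
        simp [add_mul]
      map_smul' := fun c B => by
        ext x y
        simp [mul_assoc] }
    (by
      change (Matrix.kronecker (1 : Op S) (1 : Matrix ({v // v ∉ S} → Fin 2) _ ℂ)).submatrix
        (splitConfig S) (splitConfig S) = 1
      rw [Matrix.kronecker, Matrix.kroneckerMap_one_one _ (by simp) (by simp) (by simp),
        Matrix.submatrix_one_equiv])
    (fun B C => by
      change (Matrix.kronecker (B * C) (1 : Matrix ({v // v ∉ S} → Fin 2) _ ℂ)).submatrix
          (splitConfig S) (splitConfig S) =
        (Matrix.kronecker B (1 : Matrix ({v // v ∉ S} → Fin 2) _ ℂ)).submatrix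
          (splitConfig S) (splitConfig S) *
        (Matrix.kronecker C (1 : Matrix ({v // v ∉ S} → Fin 2) _ ℂ)).submatrix
          (splitConfig S) (splitConfig S)
      rw [Matrix.submatrix_mul_equiv]
      simp only [Matrix.kronecker, ← Matrix.mul_kronecker_mul, mul_one])

variable {S : Set V} [Fintype S] [DecidableEq S]

open Classical in
theorem extendOp_apply' (B : Op S) (x y : V → Fin 2) : extendOp S B x y =
    B (splitConfig S x).1 (splitConfig S y).1 *
      (1 : Matrix ({v // v ∉ S} → Fin 2) _ ℂ) (splitConfig S x).2 (splitConfig S y).2 := rfl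

theorem star_extendOp (B : Op S) : star (extendOp S B) = extendOp S (star B) := by
  classical
  ext x y
  rw [Matrix.star_apply, extendOp_apply', extendOp_apply', Matrix.star_apply, star_mul',
    Matrix.one_apply, Matrix.one_apply]
  simp only [eq_comm (a := (splitConfig S y).2)]
  split_ifs <;> simp

open Classical in
theorem extendOp_apply (B : Op S) (x y : V → Fin 2) : extendOp S B x y =
    if ∀ w, w ∉ S → x w = y w then B (fun s => x s) (fun s => y s) else 0 := by
  rw [extendOp_apply', Matrix.one_apply]
  have h : (splitConfig S x).2 = (splitConfig S y).2 ↔ ∀ w, w ∉ S → x w = y w :=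
    ⟨fun h w hw => congrFun h ⟨w, hw⟩, fun h => funext fun w => h w.1 w.2⟩
  simp only [h]
  split_ifs
  · rw [mul_one]; rfl
  · rw [mul_zero]

theorem extendOp_onSite (v : S) (M : Matrix (Fin 2) (Fin 2) ℂ) :
    extendOp S (onSite v M) = onSite (v : V) M := by
  classical
  ext x y
  rw [extendOp_apply]
  simp only [onSite, Matrix.of_apply, ← ite_and]
  congr 1
  simp only [eq_iff_iff]
  constructor
  · rintro ⟨h1, h2⟩ w hw
    by_cases hS : w ∈ S
    · exact h2 ⟨w, hS⟩ fun h => hw (congrArg Subtype.val h)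
    · exact h1 w hS
  · intro h
    exact ⟨fun w hw => h w fun hv => hw (hv ▸ v.2), fun w hw => h w fun hv => hw (Subtype.ext hv)⟩

theorem extendOp_mixOp (α : ℝ) (v : S) : extendOp S (mixOp α v) = mixOp α (v : V) := by
  rw [mixOp, map_smul, extendOp_onSite, mixOp]

theorem extendOp_cutOp (e : Sym2 S) :
    extendOp S (cutOp e) = cutOp (Sym2.map Subtype.val e) := by
  induction e with | _ a b
  rw [Sym2.map_mk, cutOp_mk, cutOp_mk, map_smul, map_sub, map_one, map_mul, extendOp_onSite,
    extendOp_onSite]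

theorem hasDerivAt_extendOp {U : ℝ → Op S} {U' : Op S} {t : ℝ} (h : HasDerivAt U U' t) :
    HasDerivAt (fun s => extendOp S (U s)) (extendOp S U') t :=
  ((extendOp S).toLinearMap.restrictScalars ℝ).toContinuousLinearMap.hasFDerivAt.comp_hasDerivAt t h

theorem isEvolution_propagator (G : SimpleGraph V) (T α : ℝ) :
    IsEvolution (ham G T α) (propagator G T α) :=
  (exists_propagator G T α).choose_spec

theorem IsEvolution.extendOp {H U : ℝ → Op S} (hU : IsEvolution H U) :
    IsEvolution (fun t => extendOp S (H t)) (fun t => extendOp S (U t)) := by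
  refine ⟨by simp only [hU.1, map_one], fun t => ?_⟩
  have := hasDerivAt_extendOp (hU.2 t)
  rwa [map_smul, map_mul] at this

/-- The Hamiltonian terms of a subgraph. -/
def InSubgraph {G : SimpleGraph V} (H : G.Subgraph) : V ⊕ G.edgeSet → Prop
  | Sum.inl v => v ∈ H.verts
  | Sum.inr e => (e : Sym2 V) ∈ H.edgeSet

/-- Annealing the subgraph alone becomes, on all qubits, the evolution that keeps only those terms
of `G` that belong to the subgraph. The two dynamics can then be compared on the same space. -/
theorem extendOp_ham {G : SimpleGraph V} [Fintype G.edgeSet] (H : G.Subgraph) [Fintype H.verts]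
    [DecidableEq H.verts] (T α t : ℝ) :
    extendOp H.verts (ham H.coe T α t) = hamOn G T α (InSubgraph H) t := by
  classical
  rw [ham, hamInit, hamTarget, hamOn, Fintype.sum_sum_type, map_add, map_smul, map_smul, map_neg,
    map_neg, map_sum, map_sum, neg_add, smul_neg, smul_neg, Finset.smul_sum, Finset.smul_sum]
  congr 2
  · refine Fintype.sum_of_injective Subtype.val Subtype.val_injective _ _ ?_ ?_
    · intro v hv
      rw [if_neg]
      exact fun h => hv ⟨⟨v, h⟩, rfl⟩
    · intro v
      rw [if_pos (show InSubgraph H (Sum.inl (v : V)) from v.2), extendOp_mixOp]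
      rfl
  · have hmem : ∀ e : H.coe.edgeSet, Sym2.map Subtype.val (e : Sym2 H.verts) ∈ H.edgeSet := by
      rintro ⟨e, he⟩
      induction e with | _ x y
      exact he
    refine Fintype.sum_of_injective
      (fun e : H.coe.edgeSet => (⟨Sym2.map Subtype.val (e : Sym2 H.verts),
        H.edgeSet_subset (hmem e)⟩ : G.edgeSet)) ?_ _ _ ?_ ?_
    · intro e f hef
      exact Subtype.ext (Sym2.map.injective Subtype.val_injective (congrArg Subtype.val hef))
    · rintro ⟨e, he⟩ hnot
      rw [if_neg]
      intro h
      induction e with | _ x y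
      have hxy : H.Adj x y := h
      exact hnot ⟨⟨s(⟨x, H.edge_vert hxy⟩, ⟨y, H.edge_vert hxy.symm⟩), hxy⟩, rfl⟩
    · intro e
      rw [if_pos (show InSubgraph H (Sum.inr ⟨Sym2.map Subtype.val (e : Sym2 H.verts),
        H.edgeSet_subset (hmem e)⟩) from hmem e), extendOp_cutOp]
      rfl

theorem ham_eq_hamOn (G : SimpleGraph V) [Fintype G.edgeSet] (T α t : ℝ) :
    ham G T α t = hamOn G T α (fun _ => True) t := by
  rw [ham, hamInit, hamTarget, hamOn, Fintype.sum_sum_type, neg_add, smul_neg, smul_neg,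
    Finset.smul_sum, Finset.smul_sum]
  simp only [if_true]
  congr! 2
  exact Finset.sum_congr (Finset.ext fun _ => by simp) fun _ _ => rfl

/-! ### Expectations in the uniform superposition -/

/-- The expectation in the uniform superposition. -/
noncomputable def expect (M : Op V) : ℂ := star (psi0 V) ⬝ᵥ M.mulVec (psi0 V)

theorem expect_sub (M M' : Op V) : expect (M - M') = expect M - expect M' := by
  rw [expect, Matrix.sub_mulVec, dotProduct_sub]; rfl

theorem expect_eq_sum (M : Op V) :
    expect M = ((2 : ℂ) ^ Fintype.card V)⁻¹ * ∑ x, ∑ y, M x y := by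
  have h : (((Real.sqrt (2 ^ Fintype.card V))⁻¹ : ℝ) : ℂ) *
      (((Real.sqrt (2 ^ Fintype.card V))⁻¹ : ℝ) : ℂ) = ((2 : ℂ) ^ Fintype.card V)⁻¹ := by
    rw [← Complex.ofReal_mul, ← mul_inv, Real.mul_self_sqrt (by positivity)]
    push_cast
    rfl
  rw [← h]
  simp only [expect, psi0, dotProduct, Matrix.mulVec, Finset.mul_sum, Pi.star_apply,
    Complex.star_def, Complex.conj_ofReal]
  refine Finset.sum_congr rfl fun x _ => Finset.sum_congr rfl fun y _ => by ring

theorem norm_expect_le (M : Op V) : ‖expect M‖ ≤ ‖M‖ := by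
  set ψ : EuclideanSpace ℂ (V → Fin 2) := WithLp.toLp 2 (psi0 V) with hψ
  have hn : ‖ψ‖ = 1 := by
    rw [EuclideanSpace.norm_eq, Real.sqrt_eq_one]
    have : ∀ x : V → Fin 2, ‖ψ x‖ ^ 2 = ((2 : ℝ) ^ Fintype.card V)⁻¹ := by
      intro x
      change ‖(((Real.sqrt (2 ^ Fintype.card V))⁻¹ : ℝ) : ℂ)‖ ^ 2 = _
      rw [Complex.norm_real, Real.norm_of_nonneg (by positivity), inv_pow,
        Real.sq_sqrt (by positivity)]
    simp only [this, Finset.sum_const, Finset.card_univ, Fintype.card_fun, Fintype.card_fin,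
      nsmul_eq_mul]
    push_cast
    exact mul_inv_cancel₀ (by positivity)
  have h1 : expect M = inner ℂ ψ (WithLp.toLp 2 (M.mulVec (psi0 V))) := by
    rw [EuclideanSpace.inner_eq_star_dotProduct, expect, dotProduct_comm]
  rw [h1]
  refine (norm_inner_le_norm _ _).trans ?_
  rw [hn, one_mul]
  have := Matrix.l2_opNorm_mulVec M ψ
  rw [hn, mul_one] at this
  exact this

/-- The uniform superposition is a product state. The entries of the identity on the remaining
qubits sum to `2 ^ card`, which cancels their share of the normalization. -/
theorem expect_extendOp (B : Op S) : expect (extendOp S B) = expect B := by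
  classical
  rw [expect_eq_sum, expect_eq_sum]
  have h1 : ∑ x, ∑ y, extendOp S B x y =
      (2 : ℂ) ^ Fintype.card {v // v ∉ S} * ∑ x, ∑ y, B x y := by
    simp only [extendOp_apply']
    rw [(splitConfig S).sum_comp (fun p => ∑ y, B p.1 (splitConfig S y).1 *
      (1 : Matrix ({v // v ∉ S} → Fin 2) _ ℂ) p.2 (splitConfig S y).2)]
    have h2 : ∀ p : (S → Fin 2) × ({v // v ∉ S} → Fin 2),
        ∑ y, B p.1 (splitConfig S y).1 *
          (1 : Matrix ({v // v ∉ S} → Fin 2) _ ℂ) p.2 (splitConfig S y).2 = ∑ y, B p.1 y := by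
      intro p
      rw [(splitConfig S).sum_comp (fun p' => B p.1 p'.1 *
        (1 : Matrix ({v // v ∉ S} → Fin 2) _ ℂ) p.2 p'.2), Fintype.sum_prod_type]
      simp [Matrix.one_apply]
    simp only [h2, Fintype.sum_prod_type, Finset.sum_const, Finset.card_univ, Fintype.card_fun,
      Fintype.card_fin, nsmul_eq_mul, Finset.mul_sum]
    push_cast
    rfl
  have hcard : Fintype.card V = Fintype.card S + Fintype.card {v // v ∉ S} := by
    have h3 := Fintype.card_subtype_compl (fun v => v ∈ S)
    have h4 := Fintype.card_subtype_le (fun v => v ∈ S)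
    have h5 : Fintype.card S = Fintype.card {v // v ∈ S} := Fintype.card_congr (Equiv.refl _)
    omega
  rw [h1, hcard, pow_add]
  field_simp

theorem edgeEnergy_eq (G : SimpleGraph V) (T α : ℝ) (e : Sym2 V) :
    edgeEnergy G T α e = (expect (evolve G T α T (cutOp e))).re := by
  rw [edgeEnergy, finalState, expect, evolve, Matrix.star_mulVec, ← Matrix.dotProduct_mulVec,
    Matrix.mulVec_mulVec, Matrix.mulVec_mulVec, mul_assoc]

end Extend

/-! ### The bound by first exits -/

section FirstExitBound

set_option linter.unusedSectionVars false

theorem IsBiregular.color_pow {N : Type*} [Fintype N] [DecidableEq N] {a : Matrix N N ℝ} {X : N}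
    {b : N → Bool} {D : ℝ} (h : IsBiregular a b D) (hX : b X = false) {n : ℕ} {j : N}
    (hne : (a ^ n) X j ≠ 0) : b j = n.bodd := by
  induction n generalizing j with
  | zero =>
    have : X = j := by
      by_contra hj
      exact hne (by simp [hj])
    simp [← this, hX]
  | succ n ih =>
    rw [pow_succ, Matrix.mul_apply] at hne
    obtain ⟨l, -, hl⟩ := Finset.exists_ne_zero_of_sum_ne_zero hne
    rw [h.color l j (right_ne_zero_of_mul hl), ih (left_ne_zero_of_mul hl), Nat.bodd_succ]

variable {V : Type u} [Fintype V] [DecidableEq V] {G : SimpleGraph V} [Fintype G.edgeSet]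
  {a b : V} {d q : ℕ} {T α : ℝ}

open Classical in
/-- The number of paths of length `n` from the edge `{a, b}` whose first node outside the ball is
their endpoint, an edge. -/
noncomputable def firstExit (G : SimpleGraph V) [Fintype G.edgeSet] {a b : V} (hab : G.Adj a b)
    (q n : ℕ) : ℝ :=
  ∑ j, (stopMatrix (incMatrix G) (IsOutside G a b q) ^ n) (Sum.inr ⟨s(a, b), hab⟩) j *
    if IsOutside G a b q j ∧ j.isLeft = false then 1 else 0

theorem firstExit_nonneg [G.LocallyFinite] (hreg : G.IsRegularOfDegree d) (hab : G.Adj a b)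
    (q n : ℕ) : 0 ≤ firstExit G hab q n := by
  classical
  refine Finset.sum_nonneg fun j _ => mul_nonneg ((isBiregular_incMatrix hreg).stopMatrix_pow n _ j).1 ?_
  split_ifs <;> simp

open Classical in
theorem firstExit_le_sum [G.LocallyFinite] (hreg : G.IsRegularOfDegree d) (hab : G.Adj a b)
    (q n : ℕ) : firstExit G hab q n ≤ ∑ j with IsOutside G a b q j,
      (stopMatrix (incMatrix G) (IsOutside G a b q) ^ n) (Sum.inr ⟨s(a, b), hab⟩) j := by
  rw [firstExit, Finset.sum_filter]
  refine Finset.sum_le_sum fun j _ => ?_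
  have := ((isBiregular_incMatrix hreg).stopMatrix_pow (out := IsOutside G a b q) n
    (Sum.inr ⟨s(a, b), hab⟩) j).1
  split_ifs with h1 h2 h2
  · simp
  · exact absurd h1.1 h2
  · simpa using this
  · simp

theorem firstExit_le_numExit [G.LocallyFinite] (hreg : G.IsRegularOfDegree d) (hab : G.Adj a b)
    (hα : α ≠ 0) (q n : ℕ) : firstExit G hab q n ≤ numExit G α hab q n := by
  classical
  rw [numExit_eq hα]
  exact (firstExit_le_sum hreg hab q n).trans ((isBiregular_incMatrix hreg).sum_stopMatrix_pow_le n)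

theorem firstExit_le_coverExit [G.LocallyFinite] (hreg : G.IsRegularOfDegree d) (hab : G.Adj a b)
    (hq : 1 ≤ q) (n : ℕ) : firstExit G hab q n ≤ coverExit d (q + 1) n :=
  (firstExit_le_numExit hreg hab one_ne_zero q n).trans
    (numExit_le_coverExit hreg hab one_ne_zero hq n)

theorem firstExit_of_lt [G.LocallyFinite] (hreg : G.IsRegularOfDegree d) (hab : G.Adj a b)
    (hq : 1 ≤ q) {n : ℕ} (hn : n < 2 * (q + 1)) : firstExit G hab q n = 0 :=
  le_antisymm ((firstExit_le_coverExit hreg hab hq n).trans (coverExit_of_lt _ hn).le)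
    (firstExit_nonneg hreg hab q n)

/-- By parity such a path ends at a vertex, and `firstExit` gives weight only to edges. -/
theorem firstExit_of_odd [G.LocallyFinite] (hreg : G.IsRegularOfDegree d) (hab : G.Adj a b)
    (q : ℕ) {n : ℕ} (hn : n.bodd = true) : firstExit G hab q n = 0 := by
  classical
  have hB := isBiregular_incMatrix hreg
  refine Finset.sum_eq_zero fun j _ => ?_
  by_cases hz : (incMatrix G ^ n) (Sum.inr ⟨s(a, b), hab⟩) j = 0
  · have := hB.stopMatrix_pow (out := IsOutside G a b q) n (Sum.inr ⟨s(a, b), hab⟩) j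
    rw [le_antisymm (this.2.trans hz.le) this.1, zero_mul]
  · rw [if_neg, mul_zero]
    rintro ⟨-, h⟩
    rw [hB.color_pow rfl hz, hn] at h
    simp at h

theorem firstExit_add_four_le [G.LocallyFinite] (hreg : G.IsRegularOfDegree d) (hab : G.Adj a b)
    (hq : 1 ≤ q) : firstExit G hab q (2 * (q + 1) + 4) ≤ 2 * ((d : ℝ) - 1) ^ (q + 1) *
      ((d : ℝ) ^ 2 * ((((q + 1 : ℕ) + 1 : ℝ) ^ 2 + 3) / 2) +
        d * ((3 * (q + 1 : ℕ) + 2) / 2) + (q + 1 : ℕ)) := by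
  classical
  refine (firstExit_le_sum hreg hab q _).trans
    ((isBiregular_incMatrix hreg).sum_stopMatrix_pow_add_four_le rfl ?_ (by omega)
      (containsBall_incMatrix hreg hab hq))
  have hd := one_le_of_isRegularOfDegree hreg hab
  have : d = 1 ∨ d = 2 ∨ 3 ≤ d := by omega
  exact_mod_cast this

/-- The bound in which paths stop at their first exit from the ball. -/
noncomputable def firstExitBound (d : ℕ) (G : SimpleGraph V) [Fintype G.edgeSet] {a b : V}
    (hab : G.Adj a b) (q : ℕ) (T α : ℝ) : ℝ :=
  (∑ r ∈ Finset.range 6, T ^ (2 * (q + 1) + r) * (2 / α) ^ (q + 1 + r / 2) *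
    schedInt (2 * (q + 1) + r) * firstExit G hab q (2 * (q + 1) + r)) +
  T ^ (2 * (q + 1) + 6) * (2 / α) ^ (q + 1 + 3) * schedInt (2 * (q + 1) + 6) *
    (2 * d : ℝ) ^ (q + 1 + 3)

/-- For even `r` the exponents `⌊r/2⌋` and `⌈r/2⌉` agree, and first exits are among all exits. For
odd `r` the left-hand term is zero. -/
theorem firstExitBound_le_epsLocIn [G.LocallyFinite] (hreg : G.IsRegularOfDegree d)
    (hab : G.Adj a b) (hT : 0 < T) (hα : 0 < α) (q : ℕ) :
    firstExitBound d G hab q T α ≤ epsLocIn d G hab q T α := by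
  rw [firstExitBound, epsLocIn]
  refine add_le_add (Finset.sum_le_sum fun r _ => ?_) le_rfl
  have hI := schedInt_nonneg (2 * (q + 1) + r)
  rcases Nat.even_or_odd' r with ⟨s, rfl | rfl⟩
  · have : (2 * s + 1) / 2 = 2 * s / 2 := by omega
    rw [this]
    gcongr
    exact firstExit_le_numExit hreg hab hα.ne' q _
  · rw [firstExit_of_odd hreg hab q (by simp), mul_zero]
    positivity

/-- Orders `0` and `2` follow from the universal cover. Order `4` needs the finer first-exit count,
and the odd orders only need the nonnegativity of the coefficients of `epsGlobal`. -/
theorem firstExitBound_le_epsGlobal [G.LocallyFinite] (hreg : G.IsRegularOfDegree d)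
    (hab : G.Adj a b) (hT : 0 < T) (hα : 0 < α) (hq : 1 ≤ q) :
    firstExitBound d G hab q T α ≤ epsGlobal d q T α := by
  have hd : (0 : ℝ) ≤ (d : ℝ) - 1 := by
    have : (1 : ℝ) ≤ d := by exact_mod_cast one_le_of_isRegularOfDegree hreg hab
    linarith
  have h0 := firstExit_le_coverExit hreg hab hq (2 * (q + 1))
  rw [coverExit_two_mul _ (by omega)] at h0
  have h2 := firstExit_le_coverExit hreg hab hq (2 * (q + 1) + 2)
  rw [coverExit_add_two _ (by omega)] at h2
  have h4 := firstExit_add_four_le hreg hab hq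
  have h1 := firstExit_of_odd hreg hab q (n := 2 * (q + 1) + 1) (by simp)
  have h3 := firstExit_of_odd hreg hab q (n := 2 * (q + 1) + 3) (by simp)
  have h5 := firstExit_of_odd hreg hab q (n := 2 * (q + 1) + 5) (by simp)
  have hI := schedInt_nonneg
  rw [firstExitBound, epsGlobal]
  simp only [Finset.sum_range_succ, Finset.sum_range_zero, zero_add, add_zero, Nat.zero_div, h1, h3,
    h5, mul_zero]
  have hbr : 0 ≤ (d : ℝ) ^ 2 * ((((q + 1 : ℕ) + 2 : ℝ) ^ 2 + 3) / 2) +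
      d * (((q + 1 : ℕ) + 1 : ℝ) / 2) + (q + 1 : ℕ) - 1 := by
    have : (0 : ℝ) ≤ (q + 1 : ℕ) - 1 := by push_cast; simp
    have : 0 ≤ (d : ℝ) ^ 2 * ((((q + 1 : ℕ) + 2 : ℝ) ^ 2 + 3) / 2) := by positivity
    have : 0 ≤ d * (((q + 1 : ℕ) + 1 : ℝ) / 2) := by positivity
    linarith
  have hp : ∀ n m, 0 ≤ T ^ (2 * (q + 1) + n) * (2 / α) ^ (q + 1 + m) * schedInt (2 * (q + 1) + n) :=
    fun n m => mul_nonneg (by positivity) (hI _)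
  have k0 := mul_le_mul_of_nonneg_left h0 (hp 0 0)
  have k1 : 0 ≤ 2 * ((d : ℝ) - 1) ^ (q + 1) := by positivity
  have k2 := mul_le_mul_of_nonneg_left h2 (hp 2 1)
  have k3 : 0 ≤ 2 * ((d : ℝ) - 1) ^ (q + 1) * ((d : ℝ) * ((q + 1 : ℕ) + 2)) := by positivity
  have k4 := mul_le_mul_of_nonneg_left h4 (hp 4 2)
  have k5 := mul_nonneg k1 hbr
  have l1 := mul_nonneg (hp 1 1) k1
  have l3 := mul_nonneg (hp 3 2) k3
  have l5 := mul_nonneg (hp 5 3) k5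
  norm_num at k0 k2 k4 l1 l3 l5 ⊢
  linarith

/-- The argument common to the commutator and the edge energy: it uses only the integral inequality
inside the ball, without initial term, and the bound `1` on edges. -/
theorem le_firstExitBound [G.LocallyFinite] (hreg : G.IsRegularOfDegree d) (hab : G.Adj a b)
    (hq : 1 ≤ q) (hT : 0 < T) (hα : 0 < α) (y : V ⊕ G.edgeSet → ℝ → ℝ)
    (hyc : ∀ j, Continuous (y j)) (hy1 : ∀ e, ∀ t ∈ Set.Icc 0 T, y (Sum.inr e) t ≤ 1)
    (hy : ∀ j, ¬ IsOutside G a b q j → ∀ t ∈ Set.Icc 0 T, y j t ≤ ∫ s in (0 : ℝ)..t,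
      (if j.isLeft then 2 / α else 1) *
        (schedule j.isLeft T s * ∑ l, incMatrix G j l * y l s))
    {t : ℝ} (ht : t ∈ Set.Icc 0 T) :
    y (Sum.inr ⟨s(a, b), hab⟩) t ≤ firstExitBound d G hab q T α := by
  classical
  have hB := isBiregular_incMatrix hreg
  set out := IsOutside G a b q with hout
  set X : V ⊕ G.edgeSet := Sum.inr ⟨s(a, b), hab⟩ with hX
  have hXin : ¬ out X := not_not.2 (ball_adj_endpoints hab hq)
  have hl0 : 0 ≤ 2 / α := by positivity
  -- Outside nodes become absorbing: the function is replaced there by the constant `1` on edges and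
  -- `0` on vertices.
  set x₀ : V ⊕ G.edgeSet → ℝ := fun j => if out j ∧ j.isLeft = false then 1 else 0 with hx₀
  set x : V ⊕ G.edgeSet → ℝ → ℝ := fun j s => if out j then x₀ j else y j s with hx
  have hxc : ∀ j, Continuous (x j) := by
    intro j
    by_cases hj : out j
    · simp only [hx, if_pos hj]; exact continuous_const
    · simp only [hx, if_neg hj]; exact hyc j
  have hx1 : ∀ e, ∀ t ∈ Set.Icc 0 T, x (Sum.inr e) t ≤ 1 := by
    intro e t ht
    simp only [hx, hx₀]
    split_ifs <;> first | exact hy1 e t ht | norm_num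
  choose C hC using fun j => (isCompact_Icc (a := 0) (b := T)).exists_bound_of_continuousOn
    (hxc j).continuousOn
  -- Some finite bound is needed at the vertices, but its value is irrelevant: the remainder has
  -- even order, so its paths end at edges.
  set S : V ⊕ G.edgeSet → ℝ := fun j => if j.isLeft then C j else 1 with hS
  have hxS : ∀ j, ∀ t ∈ Set.Icc 0 T, x j t ≤ S j := by
    intro j t ht
    rcases j with v | e
    · exact (le_abs_self _).trans (hC _ t ht)
    · exact hx1 e t ht
  have hineq : ∀ j, ∀ t ∈ Set.Icc 0 T, x j t ≤ x₀ j + ∫ s in (0 : ℝ)..t,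
      (if j.isLeft then 2 / α else 1) * (schedule j.isLeft T s *
        ∑ i, stopMatrix (incMatrix G) out j i * x i s) := by
    intro j t ht
    by_cases hj : out j
    · have : ∀ i, stopMatrix (incMatrix G) out j i = 0 := fun i => by simp [stopMatrix, hj]
      simp [hx, hj, this]
    · have hx0 : x₀ j = 0 := by simp [hx₀, hj]
      have hxj : x j t = y j t := by simp [hx, hj]
      rw [hx0, zero_add, hxj]
      refine (hy j hj t ht).trans ?_
      have hsc := schedule_continuous j.isLeft T
      refine intervalIntegral.integral_mono_on ht.1
        (Continuous.intervalIntegrable (by fun_prop) _ _)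
        (Continuous.intervalIntegrable (by fun_prop) _ _) fun s hs => ?_
      have hs' : s ∈ Set.Icc 0 T := ⟨hs.1, hs.2.trans ht.2⟩
      refine mul_le_mul_of_nonneg_left (mul_le_mul_of_nonneg_left ?_
        (schedule_nonneg _ hT hs')) (by split_ifs <;> simp [hl0])
      refine Finset.sum_le_sum fun i _ => ?_
      have hM : stopMatrix (incMatrix G) out j i = incMatrix G j i := by simp [stopMatrix, hj]
      rw [hM]
      -- An outside vertex is never incident to an edge of the ball, so replacing its value by `0`
      -- loses nothing. At an outside edge the bound `1` is used.
      by_cases hi : out i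
      · rcases i with v | e
        · rcases j with w | f
          · simp [incMatrix]
          · have : incMatrix G (Sum.inr f) (Sum.inl v) = 0 := by
              by_contra hne
              exact hi (mem_ball_verts_of_mem_edge (not_not.1 hj) (mem_of_incMatrix_ne_zero' hne))
            simp [this]
        · refine mul_le_mul_of_nonneg_left ?_ (hB.nonneg _ _)
          have : x (Sum.inr e) s = 1 := by simp [hx, hx₀, hi]
          rw [this]
          exact hy1 e s hs'
      · simp [hx, hi]
  have key := le_of_integral_inequality Sum.isLeft (stopMatrix (incMatrix G) out)
    hB.stopMatrix_nonneg (fun i j hne => hB.color i j fun h0 => hne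
      (le_antisymm ((hB.stopMatrix_le i j).trans h0.le) (hB.stopMatrix_nonneg i j)))
    hT hl0 x hxc x₀ S hxS hineq (2 * (q + 1) + 6) X ht
  have hxX : x X t = y X t := by simp only [hx, if_neg hXin]
  rw [hxX] at key
  refine key.trans ?_
  have hXl : X.isLeft = false := rfl
  have ht' : t / T ∈ Set.Icc (0 : ℝ) 1 := ⟨div_nonneg ht.1 hT.le, (div_le_one hT).2 ht.2⟩
  have hnest : ∀ n, nested false n (t / T) ≤ schedInt n := fun n =>
    nested_le_nested_one false n ht'
  have hfe : ∀ n, ∑ i, (stopMatrix (incMatrix G) out ^ n) X i * x₀ i = firstExit G hab q n :=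
    fun n => rfl
  simp only [hXl, hfe]
  rw [Finset.sum_range_add, Finset.sum_eq_zero (s := Finset.range (2 * (q + 1))), zero_add,
    firstExitBound]
  · refine add_le_add (Finset.sum_le_sum fun r _ => ?_) ?_
    · have h1 : vertexCount false (2 * (q + 1) + r) = q + 1 + r / 2 := by
        simp only [vertexCount]; simp; omega
      rw [h1]
      have := firstExit_nonneg hreg hab q (2 * (q + 1) + r)
      gcongr
      exact hnest _
    · have h1 : vertexCount false (2 * (q + 1) + 6) = q + 1 + 3 := by
        simp only [vertexCount]; simp; omega
      rw [h1]
      have h2 : ∑ i, (stopMatrix (incMatrix G) out ^ (2 * (q + 1) + 6)) X i * S i ≤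
          (2 * d : ℝ) ^ (q + 1 + 3) := by
        rw [← hB.sum_pow (X := X) rfl, show 2 * (q + 1 + 3) = 2 * (q + 1) + 6 by ring]
        refine Finset.sum_le_sum fun i _ => ?_
        have hp := hB.stopMatrix_pow (out := out) (2 * (q + 1) + 6) X i
        by_cases hz : (incMatrix G ^ (2 * (q + 1) + 6)) X i = 0
        · rw [le_antisymm (hp.2.trans hz.le) hp.1, zero_mul, hz]
        · have : S i = 1 := by
            have := hB.color_pow rfl hz
            simp only [hS, this]
            simp
          rw [this, mul_one]
          exact hp.2
      have hI := schedInt_nonneg (2 * (q + 1) + 6)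
      have hn0 := nested_nonneg false (2 * (q + 1) + 6) ht'
      have h3 : (0 : ℝ) ≤ (2 * d : ℝ) ^ (q + 1 + 3) := by positivity
      calc _ ≤ T ^ (2 * (q + 1) + 6) * (2 / α) ^ (q + 1 + 3) *
            nested false (2 * (q + 1) + 6) (t / T) * (2 * d : ℝ) ^ (q + 1 + 3) := by gcongr
        _ ≤ _ := by
          gcongr
          exact hnest _
  · intro n hn
    rw [firstExit_of_lt hreg hab hq (Finset.mem_range.1 hn), mul_zero]

end FirstExitBound

/-! ### The commutator and the edge energy -/

section Bounds

set_option linter.unusedSectionVars false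

variable {V : Type u} [Fintype V] [DecidableEq V] {G : SimpleGraph V} [Fintype G.edgeSet]
  {a b : V} {d q : ℕ} {T α : ℝ}

theorem localSum_eq (A : Op V) (X : G.edgeSet) (k : ℕ) : localSum G T α A X k =
    (∑ r ∈ Finset.range 6, T ^ (2 * k + r) * (2 / α) ^ (k + r / 2) * schedInt (2 * k + r) *
      ∑ j, (numPaths G α X (2 * k + r) j : ℝ) * ‖gamComm G T α A j 0‖) +
    T ^ (2 * k + 6) * (2 / α) ^ (k + 3) * schedInt (2 * k + 6) *
      ∑ j, (numPaths G α X (2 * k + 6) j : ℝ) * ⨆ t : Set.Icc 0 T, ‖gamComm G T α A j t‖ := by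
  unfold localSum
  congr!

theorem isEvolution_propagator_hamOn (G : SimpleGraph V) [Fintype G.edgeSet] (T α : ℝ) :
    IsEvolution (hamOn G T α fun _ => True) (propagator G T α) := by
  have h : ham G T α = hamOn G T α fun _ => True := funext fun t => ham_eq_hamOn G T α t
  rw [← h]
  exact isEvolution_propagator G T α

theorem heis_propagator (j : V ⊕ G.edgeSet) (t : ℝ) :
    heis α (fun _ => True) (propagator G T α) j t = evolve G T α t (gam G α j) := by
  simp [heis, evolve, Matrix.star_eq_conjTranspose]

theorem gamComm_eq (A : Op V) (j : V ⊕ G.edgeSet) (t : ℝ) :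
    gamComm G T α A j t = ⁅heis α (fun _ => True) (propagator G T α) j t, A⁆ := by
  rw [heis_propagator, gamComm]

theorem gamComm_zero_of_not_isOutside {A : Op V}
    (hA : SupportedOn (ball G a b q).vertsᶜ A) {j : V ⊕ G.edgeSet} (hj : ¬ IsOutside G a b q j) :
    gamComm G T α A j 0 = 0 := by
  have h0 : gamComm G T α A j 0 = ⁅gam G α j, A⁆ := by
    rw [gamComm, evolve, (isEvolution_propagator G T α).1]
    simp
  have hc : ∀ v ∈ (ball G a b q).verts, ∀ M, Commute (onSite v M) A := fun v hv M =>
    hA.commute_onSite (fun h => h hv) M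
  have : Commute (gam G α j) A := by
    rcases j with v | ⟨e, he⟩
    · exact (hc v (not_not.1 hj) _).smul_left _
    · have hmem : ∀ v ∈ e, v ∈ (ball G a b q).verts := fun v =>
        mem_ball_verts_of_mem_edge (not_not.1 hj)
      induction e with | _ x y
      exact commute_cutOp_of_commute (hc x (hmem x (by simp)) _) (hc y (hmem y (by simp)) _)
  rw [h0, Ring.lie_def, this.eq, sub_self]

theorem norm_gamComm_le (hα : 0 < α) {A : Op V} (hA : A ∈ Matrix.unitaryGroup (V → Fin 2) ℂ)
    (j : V ⊕ G.edgeSet) (t : ℝ) :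
    ‖gamComm G T α A j t‖ ≤ if j.isLeft then 2 / α else 1 := by
  have hn : ‖A‖ = 1 := CStarRing.norm_of_mem_unitary hA
  rw [gamComm_eq]
  have := norm_lie_heis_le hα ((isEvolution_propagator_hamOn G T α).mem_unitary star_hamOn t)
    (j := j) (In := fun _ => True) trivial A
  rwa [hn, mul_one] at this

theorem continuous_gamComm (A : Op V) (j : V ⊕ G.edgeSet) : Continuous (gamComm G T α A j) := by
  have h : gamComm G T α A j =
      fun t => ⁅heis α (fun _ => True) (propagator G T α) j t, A⁆ := funext (gamComm_eq A j)
  have hc : Continuous (heis (G := G) α (fun _ => True) (propagator G T α) j) :=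
    continuous_heis (isEvolution_propagator_hamOn G T α).continuous j
  rw [h]
  simp only [Ring.lie_def]
  fun_prop

theorem norm_gamComm_le_integral (hT : 0 < T) (hα : 0 < α) (A : Op V) (j : V ⊕ G.edgeSet) {t : ℝ}
    (ht : t ∈ Set.Icc 0 T) : ‖gamComm G T α A j t‖ ≤ ‖gamComm G T α A j 0‖ +
      ∫ s in (0 : ℝ)..t, (if j.isLeft then 2 / α else 1) *
        (schedule j.isLeft T s * ∑ l, incMatrix G j l * ‖gamComm G T α A l s‖) := by
  simp only [gamComm_eq]
  exact norm_lie_heis_le_integral hT hα (isEvolution_propagator_hamOn G T α) A j ht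

theorem incMatrix_pow_of_isOutside [G.LocallyFinite] (hreg : G.IsRegularOfDegree d)
    (hab : G.Adj a b) (hq : 1 ≤ q) {n : ℕ} (hn : n < 2 * (q + 1))
    {j : V ⊕ G.edgeSet} (hj : IsOutside G a b q j) :
    (incMatrix G ^ n) (Sum.inr ⟨s(a, b), hab⟩) j = 0 := by
  rw [(isBiregular_incMatrix hreg).pow_apply rfl]
  refine Finset.sum_eq_zero fun m hm => ?_
  rw [containsBall_incMatrix hreg hab hq m (by have := Finset.mem_range.1 hm; omega) j hj, mul_zero]

/-- Here the expansion runs along all paths without stopping at exits, so each path keeps the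
initial commutator at its endpoint and the remainder keeps a supremum over time. -/
theorem norm_lie_evolve_le_localSum [G.LocallyFinite] (hreg : G.IsRegularOfDegree d)
    (hab : G.Adj a b) (hq : 1 ≤ q) (hT : 0 < T) (hα : 0 < α) {A : Op V}
    (hA : SupportedOn (ball G a b q).vertsᶜ A) {t : ℝ} (ht : t ∈ Set.Icc 0 T) :
    ‖⁅evolve G T α t (cutOp s(a, b)), A⁆‖ ≤ localSum G T α A ⟨s(a, b), hab⟩ (q + 1) := by
  have hB := isBiregular_incMatrix hreg
  have hbdd : ∀ j, BddAbove (Set.range fun t : Set.Icc 0 T => ‖gamComm G T α A j t‖) := by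
    intro j
    obtain ⟨C, hC⟩ := (isCompact_Icc (a := 0) (b := T)).exists_bound_of_continuousOn
      (continuous_gamComm (T := T) (α := α) A j).continuousOn
    exact ⟨C, by rintro _ ⟨t, rfl⟩; exact hC t t.2⟩
  have key := le_of_integral_inequality Sum.isLeft (incMatrix G) hB.nonneg hB.color hT
    (by positivity : 0 ≤ 2 / α) (fun j t => ‖gamComm G T α A j t‖)
    (fun j => (continuous_gamComm A j).norm) (fun j => ‖gamComm G T α A j 0‖)
    (fun j => ⨆ t : Set.Icc 0 T, ‖gamComm G T α A j t‖)
    (fun j t ht => le_ciSup (hbdd j) (⟨t, ht⟩ : Set.Icc 0 T))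
    (fun j t ht => norm_gamComm_le_integral hT hα A j ht) (2 * (q + 1) + 6)
    (Sum.inr ⟨s(a, b), hab⟩) ht
  refine le_trans (le_of_eq rfl) (key.trans ?_)
  have ht' : t / T ∈ Set.Icc (0 : ℝ) 1 := ⟨div_nonneg ht.1 hT.le, (div_le_one hT).2 ht.2⟩
  have hnest : ∀ n, nested false n (t / T) ≤ schedInt n := fun n =>
    nested_le_nested_one false n ht'
  rw [localSum_eq]
  simp only [Sum.isLeft_inr, ← numPaths_eq hα.ne']
  rw [Finset.sum_range_add, Finset.sum_eq_zero (s := Finset.range (2 * (q + 1))), zero_add]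
  · refine add_le_add (Finset.sum_le_sum fun r _ => ?_) ?_
    · have h1 : vertexCount false (2 * (q + 1) + r) = q + 1 + r / 2 := by
        simp only [vertexCount]; simp; omega
      rw [h1]
      gcongr
      exact hnest _
    · have h1 : vertexCount false (2 * (q + 1) + 6) = q + 1 + 3 := by
        simp only [vertexCount]; simp; omega
      rw [h1]
      have h2 : ∀ j, 0 ≤ ⨆ t : Set.Icc 0 T, ‖gamComm G T α A j t‖ := fun j =>
        Real.iSup_nonneg fun t => norm_nonneg _
      have h3 : 0 ≤ ∑ j, (numPaths G α ⟨s(a, b), hab⟩ (2 * (q + 1) + 6) j : ℝ) *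
          ⨆ t : Set.Icc 0 T, ‖gamComm G T α A j t‖ :=
        Finset.sum_nonneg fun j _ => mul_nonneg (Nat.cast_nonneg _) (h2 j)
      gcongr
      exact hnest _
  -- Orders below `2k` vanish: no path this short ends outside, and inside the ball the initial
  -- commutator is zero.
  · intro n hn
    rw [Finset.sum_eq_zero, mul_zero]
    intro j _
    by_cases hj : IsOutside G a b q j
    · rw [numPaths_eq hα.ne', incMatrix_pow_of_isOutside hreg hab hq
        (Finset.mem_range.1 hn) hj, zero_mul]
    · rw [gamComm_zero_of_not_isOutside hA hj, norm_zero, mul_zero]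

/-- Paths of odd length end at vertices, where the commutator costs another `2/α`. This turns the
exponent `⌊r/2⌋` into `⌈r/2⌉`. At edges the commutator is at most `1`. -/
theorem localSum_le_epsLocIn [G.LocallyFinite] (hreg : G.IsRegularOfDegree d)
    (hab : G.Adj a b) (hT : 0 < T) (hα : 0 < α) {A : Op V}
    (hAu : A ∈ Matrix.unitaryGroup (V → Fin 2) ℂ) (hA : SupportedOn (ball G a b q).vertsᶜ A) :
    localSum G T α A ⟨s(a, b), hab⟩ (q + 1) ≤ epsLocIn d G hab q T α := by
  classical
  have hB := isBiregular_incMatrix hreg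
  have hcol : ∀ n j, (numPaths G α ⟨s(a, b), hab⟩ n j : ℝ) ≠ 0 → j.isLeft = n.bodd := by
    intro n j hne
    rw [numPaths_eq hα.ne'] at hne
    exact hB.color_pow rfl hne
  rw [localSum_eq, epsLocIn]
  refine add_le_add (Finset.sum_le_sum fun r _ => ?_) ?_
  · have hI := schedInt_nonneg (2 * (q + 1) + r)
    have hsum : ∑ j, (numPaths G α ⟨s(a, b), hab⟩ (2 * (q + 1) + r) j : ℝ) *
        ‖gamComm G T α A j 0‖ ≤
        (if r.bodd then 2 / α else 1) * numExit G α hab q (2 * (q + 1) + r) := by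
      rw [numExit_eq hα.ne', Finset.sum_filter, Finset.mul_sum]
      refine Finset.sum_le_sum fun j _ => ?_
      rw [← numPaths_eq hα.ne']
      split_ifs with h1 h2 h2
      · by_cases hz : (numPaths G α ⟨s(a, b), hab⟩ (2 * (q + 1) + r) j : ℝ) = 0
        · simp [hz]
        · have h3 := norm_gamComm_le (T := T) hα hAu j 0
          rw [hcol _ j hz] at h3
          simp [h1] at h3
          rw [mul_comm]
          gcongr
      · rw [gamComm_zero_of_not_isOutside hA h2]
        simp
      · by_cases hz : (numPaths G α ⟨s(a, b), hab⟩ (2 * (q + 1) + r) j : ℝ) = 0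
        · simp [hz]
        · have h3 := norm_gamComm_le (T := T) hα hAu j 0
          rw [hcol _ j hz] at h3
          simp [h1] at h3
          rw [mul_comm]
          gcongr
      · rw [gamComm_zero_of_not_isOutside hA h2]
        simp
    have hpow : (2 / α) ^ (q + 1 + r / 2) * (if r.bodd then 2 / α else 1) =
        (2 / α) ^ (q + 1 + (r + 1) / 2) := by
      have := Nat.mod_two_of_bodd r
      cases hb : r.bodd
      · rw [hb] at this
        simp at this
        rw [show (r + 1) / 2 = r / 2 by omega]
        simp
      · rw [hb] at this
        simp at this
        rw [show (r + 1) / 2 = r / 2 + 1 by omega, ← add_assoc, pow_succ]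
        simp
    calc _ ≤ T ^ (2 * (q + 1) + r) * (2 / α) ^ (q + 1 + r / 2) * schedInt (2 * (q + 1) + r) *
          ((if r.bodd then 2 / α else 1) * numExit G α hab q (2 * (q + 1) + r)) := by gcongr
      _ = _ := by rw [← hpow]; ring
  · have hI := schedInt_nonneg (2 * (q + 1) + 6)
    have : Nonempty (Set.Icc 0 T) := ⟨⟨0, le_rfl, hT.le⟩⟩
    have hs := hB.sum_pow (X := Sum.inr ⟨s(a, b), hab⟩) rfl (q + 1 + 3)
    rw [show 2 * (q + 1 + 3) = 2 * (q + 1) + 6 by ring] at hs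
    simp only [← numPaths_eq hα.ne'] at hs
    rw [← hs]
    gcongr with j
    by_cases hz : (numPaths G α ⟨s(a, b), hab⟩ (2 * (q + 1) + 6) j : ℝ) = 0
    · simp [hz]
    · refine mul_le_of_le_one_right (Nat.cast_nonneg _) (ciSup_le fun t => ?_)
      have h3 := norm_gamComm_le (T := T) hα hAu j t
      rw [hcol _ j hz] at h3
      simpa using h3

theorem norm_lie_evolve_le_firstExitBound [G.LocallyFinite] (hreg : G.IsRegularOfDegree d)
    (hab : G.Adj a b) (hq : 1 ≤ q) (hT : 0 < T) (hα : 0 < α) {A : Op V}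
    (hAu : A ∈ Matrix.unitaryGroup (V → Fin 2) ℂ) (hA : SupportedOn (ball G a b q).vertsᶜ A)
    {t : ℝ} (ht : t ∈ Set.Icc 0 T) :
    ‖⁅evolve G T α t (cutOp s(a, b)), A⁆‖ ≤ firstExitBound d G hab q T α := by
  refine le_trans (le_of_eq rfl) (le_firstExitBound hreg hab hq hT hα
    (fun j t => ‖gamComm G T α A j t‖) (fun j => (continuous_gamComm A j).norm) ?_ ?_ ht)
  · intro e t _
    simpa using norm_gamComm_le hα hAu (Sum.inr e) t
  · intro j hj t ht
    have := norm_gamComm_le_integral hT hα A j ht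
    rwa [gamComm_zero_of_not_isOutside hA hj, norm_zero, zero_add] at this

theorem norm_cutOp_sub_le (e : Sym2 V) : ‖cutOp e - (2⁻¹ : ℂ) • (1 : Op V)‖ ≤ 1 / 2 := by
  induction e with | _ x y
  have hu := mul_mem (onSite_mem_unitary x pauliZ_mul_self star_pauliZ)
    (onSite_mem_unitary y pauliZ_mul_self star_pauliZ)
  rw [cutOp_mk, smul_sub, sub_sub_cancel_left, norm_neg, norm_smul,
    CStarRing.norm_of_mem_unitary hu]
  norm_num

/-- This is why terms are frozen at `1/2`: the full and the truncated evolution of an edge both stay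
within `1/2` of the same scalar, so they differ by at most `1`, even outside the ball. -/
theorem norm_heis_sub_half_le {In : V ⊕ G.edgeSet → Prop} {U : ℝ → Op V} {t : ℝ}
    (hU : U t ∈ unitary (Op V)) (e : G.edgeSet) :
    ‖heis α In U (Sum.inr e) t - (2⁻¹ : ℂ) • (1 : Op V)‖ ≤ 1 / 2 := by
  classical
  by_cases h : In (Sum.inr e)
  · have : heis α In U (Sum.inr e) t - (2⁻¹ : ℂ) • (1 : Op V) =
        star (U t) * (cutOp (e : Sym2 V) - (2⁻¹ : ℂ) • (1 : Op V)) * U t := by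
      simp [heis, h, gam, mul_sub, sub_mul, Unitary.star_mul_self_of_mem hU]
    rw [this, norm_star_mul_mul_of_mem_unitary hU]
    exact norm_cutOp_sub_le _
  · simp [heis, h]

theorem edgeEnergy_coe (H : G.Subgraph) (_ : Fintype H.verts) (_ : DecidableEq H.verts)
    {x y : H.verts} (hxy : H.Adj x y) : edgeEnergy H.coe T α s(x, y) =
      (expect (heis α (InSubgraph H) (fun t => extendOp H.verts (propagator H.coe T α t))
        (Sum.inr ⟨s(↑x, ↑y), H.adj_sub hxy⟩) T)).re := by
  have hXin : InSubgraph H (Sum.inr ⟨s(↑x, ↑y), H.adj_sub hxy⟩) := hxy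
  rw [edgeEnergy_eq, ← expect_extendOp]
  simp only [heis, if_pos hXin, evolve, map_mul, extendOp_cutOp, ← Matrix.star_eq_conjTranspose,
    star_extendOp]
  rfl

theorem isEvolution_extendOp_propagator (H : G.Subgraph) (_ : Fintype H.verts)
    (_ : DecidableEq H.verts) : IsEvolution (hamOn G T α (InSubgraph H))
      (fun t => extendOp H.verts (propagator H.coe T α t)) := by
  have := (isEvolution_propagator H.coe T α).extendOp
  simp only [extendOp_ham] at this
  exact this

theorem exists_ballEnergy_eq (hab : G.Adj a b) (hq : 1 ≤ q) :
    ∃ W, IsEvolution (hamOn G T α (InSubgraph (ball G a b q))) W ∧ ballEnergy G a b q T α =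
      (expect (heis α (InSubgraph (ball G a b q)) W (Sum.inr ⟨s(a, b), hab⟩) T)).re := by
  have hadj : (ball G a b q).Adj (ballLeft G a b q) (ballRight G a b q) :=
    ball_adj_endpoints hab hq
  exact ⟨_, isEvolution_extendOp_propagator _ _ _, edgeEnergy_coe _ _ _ hadj⟩

theorem abs_edgeEnergy_sub_ballEnergy_le [G.LocallyFinite] (hreg : G.IsRegularOfDegree d)
    (hab : G.Adj a b) (hq : 1 ≤ q) (hT : 0 < T) (hα : 0 < α) :
    |edgeEnergy G T α s(a, b) - ballEnergy G a b q T α| ≤ firstExitBound d G hab q T α := by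
  set H := ball G a b q with hH
  obtain ⟨W, hW, hball⟩ := exists_ballEnergy_eq (T := T) (α := α) hab hq
  have hU := isEvolution_propagator_hamOn G T α
  have hIn : ∀ j, ¬ IsOutside G a b q j → InSubgraph H j := by
    rintro (v | e) hj
    · exact not_not.1 hj
    · exact not_not.1 hj
  have hfull : edgeEnergy G T α s(a, b) =
      (expect (heis α (fun _ => True) (propagator G T α) (Sum.inr ⟨s(a, b), hab⟩) T)).re := by
    rw [edgeEnergy_eq, heis_propagator]
    rfl
  rw [hfull, hball, ← Complex.sub_re, ← expect_sub]
  refine (Complex.abs_re_le_norm _).trans ((norm_expect_le _).trans ?_)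
  refine le_firstExitBound hreg hab hq hT hα (fun j t =>
    ‖heis α (fun _ => True) (propagator G T α) j t - heis α (InSubgraph H) W j t‖) ?_ ?_ ?_
    (t := T) ⟨hT.le, le_rfl⟩
  · intro j
    exact ((continuous_heis hU.continuous j).sub (continuous_heis hW.continuous j)).norm
  · intro e t _
    have h1 := norm_heis_sub_half_le (α := α) (In := fun _ => True) (hU.mem_unitary star_hamOn t) e
    have h2 := norm_heis_sub_half_le (α := α) (In := InSubgraph H) (hW.mem_unitary star_hamOn t) e
    have h3 := norm_sub_le (heis α (fun _ => True) (propagator G T α) (Sum.inr e) t -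
      (2⁻¹ : ℂ) • (1 : Op V)) (heis α (InSubgraph H) W (Sum.inr e) t - (2⁻¹ : ℂ) • (1 : Op V))
    rw [sub_sub_sub_cancel_right] at h3
    linarith
  · intro j hj t ht
    exact norm_heis_sub_le_integral hT hα hU hW (hIn j hj) ht

/-- `G` is one of the admissible extensions of its own ball. The real supremum is meaningful because
`coverExit` bounds the path counts of every competitor in terms of `d` and `q` alone. -/
theorem epsLocIn_le_epsLoc [G.LocallyFinite] (hreg : G.IsRegularOfDegree d)
    (hab : G.Adj a b) (hq : 1 ≤ q) (hT : 0 < T) (hα : 0 < α) : epsLocIn d G hab q T α ≤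
      epsLoc d (ball G a b q).coe (ballLeft G a b q) (ballRight G a b q) q T α := by
  refine le_csSup ⟨(∑ r ∈ Finset.range 6, T ^ (2 * (q + 1) + r) *
      (2 / α) ^ (q + 1 + (r + 1) / 2) * schedInt (2 * (q + 1) + r) *
      coverExit d (q + 1) (2 * (q + 1) + r)) +
    T ^ (2 * (q + 1) + 6) * (2 / α) ^ (q + 1 + 3) * schedInt (2 * (q + 1) + 6) *
      (2 * d : ℝ) ^ (q + 1 + 3), ?_⟩ ?_
  · rintro ε ⟨V', _, _, G', _, a', b', hab', hreg', -, rfl⟩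
    have : Fintype G'.edgeSet := Fintype.ofFinite _
    rw [epsLocIn]
    refine add_le_add (Finset.sum_le_sum fun r _ => ?_) le_rfl
    have hI := schedInt_nonneg (2 * (q + 1) + r)
    gcongr
    exact numExit_le_coverExit hreg' hab' hα.ne' hq _
  · exact ⟨V, inferInstance, inferInstance, G, inferInstance, a, b, hab, hreg,
      ⟨SimpleGraph.Iso.refl, rfl⟩, rfl⟩

end Bounds

end QAnneal

/-! ### The main theorem -/

open QAnneal

theorem mainTheorem2 {V : Type u} [Fintype V] [DecidableEq V] (G : SimpleGraph V)
    [G.LocallyFinite] (d : ℕ) (hreg : G.IsRegularOfDegree d) {a b : V} (hab : G.Adj a b)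
    (q k : ℕ) (hq : 1 ≤ q) (hk : k = q + 1) (T α : ℝ) (hT : 0 < T) (hα : 0 < α) :
    -- bounds on the commutator with a unitary supported outside the ball
    (∀ A ∈ Matrix.unitaryGroup (V → Fin 2) ℂ, SupportedOn (ball G a b q).vertsᶜ A →
      (∀ t ∈ Set.Icc 0 T, ‖⁅evolve G T α t (cutOp s(a, b)), A⁆‖ ≤
        localSum G T α A ⟨s(a, b), hab⟩ k) ∧
      localSum G T α A ⟨s(a, b), hab⟩ k ≤ epsLocIn d G hab q T α ∧
      (∀ t ∈ Set.Icc 0 T, ‖⁅evolve G T α t (cutOp s(a, b)), A⁆‖ ≤ epsGlobal d q T α)) ∧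
    -- bounds on the change of the edge energy
    |edgeEnergy G T α s(a, b) - ballEnergy G a b q T α| ≤ epsLocIn d G hab q T α ∧
    |edgeEnergy G T α s(a, b) - ballEnergy G a b q T α| ≤ epsGlobal d q T α ∧
    -- the local bound is controlled by a function of the ball alone
    epsLocIn d G hab q T α ≤
      epsLoc d (ball G a b q).coe (ballLeft G a b q) (ballRight G a b q) q T α ∧
    -- the path counts
    (∑ᶠ j, numPaths G α ⟨s(a, b), hab⟩ (2 * k + 6) j = (2 * d) ^ (k + 3)) ∧
    (∀ r : Fin 4, numExit G α hab q (2 * k + r) ≤ treeCount d k r) ∧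
    ((ball G a b (q + 3)).coe.IsAcyclic →
      (∀ r : Fin 4, numExit G α hab q (2 * k + r) = treeCount d k r) ∧
      ∀ (V' : Type u) [Fintype V'] [DecidableEq V'] (G' : SimpleGraph V') [G'.LocallyFinite]
        (a' b' : V') (hab' : G'.Adj a' b'), G'.IsRegularOfDegree d →
        ∀ r : Fin 6, numExit G' α hab' q (2 * k + r) ≤ numExit G α hab q (2 * k + r)) := by
  subst hk
  have : Fintype G.edgeSet := Fintype.ofFinite _
  have hd := one_le_of_isRegularOfDegree hreg hab
  have hen := abs_edgeEnergy_sub_ballEnergy_le hreg hab hq hT hα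
  have hglob := firstExitBound_le_epsGlobal hreg hab hT hα hq
  refine ⟨fun A hAu hA => ⟨fun t ht => norm_lie_evolve_le_localSum hreg hab hq hT hα hA ht,
    localSum_le_epsLocIn hreg hab hT hα hAu hA, fun t ht =>
      (norm_lie_evolve_le_firstExitBound hreg hab hq hT hα hAu hA ht).trans hglob⟩,
    hen.trans (firstExitBound_le_epsLocIn hreg hab hT hα q), hen.trans hglob,
    epsLocIn_le_epsLoc hreg hab hq hT hα, finsum_numPaths hreg hab hα.ne' (q + 1 + 3),
    fun r => ?_, fun hac => ⟨fun r => ?_, ?_⟩⟩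
  · have h := numExit_le_coverExit hreg hab hα.ne' hq (2 * (q + 1) + r)
    rw [coverExit_eq_treeCount hd (by omega)] at h
    exact_mod_cast h
  · have h := numExit_eq_coverExit hreg hab hα.ne' hq hac (n := 2 * (q + 1) + r)
      (by have := r.2; omega)
    rw [coverExit_eq_treeCount hd (by omega)] at h
    exact_mod_cast h
  · intro V' _ _ G' _ a' b' hab' hreg' r
    have : Fintype G'.edgeSet := Fintype.ofFinite _
    -- The universal cover bounds the counts of every competitor, and `G` attains this bound up to
    -- length `2(q + 3) + 1 = 2k + 5`, which is why `r` runs up to `5`.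
    have h1 := numExit_le_coverExit hreg' hab' hα.ne' hq (2 * (q + 1) + r)
    rw [← numExit_eq_coverExit hreg hab hα.ne' hq hac (by have := r.2; omega)] at h1
    exact_mod_cast h1
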